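/- A Lorenz map on $I=[a,b]$ is a map $f$ on $I$ with a point $c\in(a,b)$ such that $f$ is continuous and strictly increasing on $[a,c)$ and on $(c,b]$, $\lim_{x\uparrow c}f(x)=b$ and $\lim_{x\downarrow c}f(x)=a$; the point $c$ is regarded as having the two images $f(c-)=b$ and $f(c+)=a$, and images, preimages and orbits of sets are taken accordingly. $f$ is expanding if $\bigcup_{n\ge0}f^{-n}(c)$ is dense in $I$. For an open interval $U$ let $N(U)$ be the least $n\ge 0$ with $c\in f^n(U)$, and put $orb(B)=\bigcup_{n\ge0}f^n(B)$. A renormalization of $f$ is a Lorenz map $g$ on a proper subinterval $[u,v]\ni c$ of $I$, with discontinuity $c$, such that $g=f^{\ell}$ on $[u,c)$ and $g=f^{r}$ on $(c,v]$ for some integers $\ell,r>1$, which has a critical interval: an interval $(e_-,e_+)\supseteq(u,v)$ with $e_\pm\in I$, $f^\ell(e_-)=e_-$, $f^r(e_+)=e_+$, $N((e_-,c))=\ell$, $N((c,e_+))=r$, such that the orbits of $e_-$ and $e_+$ do not meet $(e_-,e_+)$. It is periodic if $e_-$ and $e_+$ belong to the same periodic orbit; it is minimal if $\ell\le\ell'$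 and $r\le r'$ for every renormalization $(f^{\ell'},f^{r'})$ of $f$. $f$ is $m$-renormalizable, $0\le m\le\infty$, if, starting from $R^0f=f$ and taking for $R^{i+1}f$ the minimal renormalization of $R^if$, the process can be carried out exactly $m$ times. A set $E\subseteq I$ is completely invariant if $f(E)=E=f^{-1}(E)$. The restriction $f|_S$ is l.e.o. if for every open $U$ meeting $S$ there is $N$ with $\bigcup_{n=0}^{N}f^n(U\cap S)=S$. **Proposition.** Let $f$ be an $m$-renormalizable ($0\le m\le\infty$) expanding Lorenz map on $I$, and suppose that no renormalization of $f$ fixes an end point of its renormalization interval. Let $I_i=[a_i,b_i]$ be the renormalization interval of $R^if$ ($I_0=I$). Then the $\alpha$-limit sets of $f$ are $I$ together with $m$ proper ones, $\emptyset=E_0\subsetneq E_1\subsetneq E_2\subsetneq\cdots\subsetneq E_m\subsetneq I$ (infinitely many $E_i$ if $m=\infty$), each $R^if$ has a least nonempty completely invariant closed set $D_i$, and the nonwandering set decomposes as a disjoint union $$\Omega(f)=\bigcup_{i=1}^m\Omega_i\cup A$$ of closed sets with $f(\Omega_i)=\Omega_i$, $f(A)=A$, such that: 1. For $1\le i\le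 m$, $\Omega_i=E_i\cap orb(I_{i-1})=orb(D_{i-1})$ and $f|_{\Omega_i}$ is l.e.o.; $\Omega_i$ is a periodic orbit if the renormalization $R^if$ of $f$ is periodic, and a Cantor set otherwise. 2. $A=\bigcap_{i=0}^m orb([a_i,b_i])$ is the attractor of $f$: $\omega(x)\subseteq A$ for every $x\in I\setminus E_\infty$, where $E_\infty=\bigcup_{i}E_i$, and $f|_A$ is l.e.o. Moreover $A=I$ if $m=0$, $A$ is a finite union of nondegenerate closed intervals if $0<m<\infty$, and $A$ is a Cantor set if $m=\infty$; in the last case $\omega(x)=A$ for every $x\in I\setminus E_\infty$. -/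

import Mathlib

open Set Filter Topology

/-- A Lorenz map on `I = [a, b]` with discontinuity `c`.  The underlying function is only
meaningful on `[a, c) ∪ (c, b]`; its value at `c` is never used: the point `c` stands for the two
points `c-` and `c+`, with `f (c-) = b` and `f (c+) = a`, see `LorenzMap.Step`. -/
structure LorenzMap where
  a : ℝ
  b : ℝ
  c : ℝ
  toFun : ℝ → ℝ
  a_lt_c : a < c
  c_lt_b : c < b
  mapsTo : ∀ x ∈ Icc a b, x ≠ c → toFun x ∈ Icc a b
  strictMonoOn_left : StrictMonoOn toFun (Ico a c)
  strictMonoOn_right : StrictMonoOn toFun (Ioc c b)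
  continuousOn_left : ContinuousOn toFun (Ico a c)
  continuousOn_right : ContinuousOn toFun (Ioc c b)
  tendsto_left : Tendsto toFun (𝓝[<] c) (𝓝 b)
  tendsto_right : Tendsto toFun (𝓝[>] c) (𝓝 a)

namespace LorenzMap

/-- The interval `I = [a, b]` on which the map lives. -/
def I (f : LorenzMap) : Set ℝ := Icc f.a f.b

/-- `f.Step x y` means that `y` is an image of `x`; the point `c` has the two images
`f (c-) = b` and `f (c+) = a`, every other point of `I` has exactly one image. -/
def Step (f : LorenzMap) (x y : ℝ) : Prop :=
  x ∈ f.I ∧ ((x ≠ f.c ∧ y = f.toFun x) ∨ (x = f.c ∧ (y = f.a ∨ y = f.b)))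

/-- The image `f(A)`. -/
def image (f : LorenzMap) (A : Set ℝ) : Set ℝ := {y | ∃ x ∈ A, f.Step x y}

/-- The preimage `f⁻¹(B)`. -/
def preimage (f : LorenzMap) (B : Set ℝ) : Set ℝ := {x | ∃ y ∈ B, f.Step x y}

/-- The forward orbit `orb(A) = ⋃ n ≥ 0, fⁿ(A)`. -/
def orb (f : LorenzMap) (A : Set ℝ) : Set ℝ := ⋃ n : ℕ, f.image^[n] A

/-- The map is expanding: the set of preimages of `c` of all orders is dense in `I`. -/
def IsExpanding (f : LorenzMap) : Prop :=
  f.I ⊆ closure (⋃ n : ℕ, f.preimage^[n] {f.c})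

/-- The `α`-limit set of `x`. -/
def alphaLimit (f : LorenzMap) (x : ℝ) : Set ℝ :=
  ⋂ n : ℕ, closure (⋃ k : ℕ, ⋃ _ : n ≤ k, f.preimage^[k] {x})

/-- The `ω`-limit set of `x`. -/
def omegaLimit (f : LorenzMap) (x : ℝ) : Set ℝ :=
  ⋂ n : ℕ, closure (⋃ k : ℕ, ⋃ _ : n ≤ k, f.image^[k] {x})

/-- The nonwandering set: points each of whose neighbourhoods returns to itself after some
positive time. -/
def nonwandering (f : LorenzMap) : Set ℝ :=
  {x | x ∈ f.I ∧ ∀ U : Set ℝ, IsOpen U → x ∈ U →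
    ∃ n : ℕ, 1 ≤ n ∧ (f.image^[n] (U ∩ f.I) ∩ U).Nonempty}

/-- `E ⊆ I` is completely invariant: `f(E) = E = f⁻¹(E)`. -/
def IsCompletelyInvariant (f : LorenzMap) (E : Set ℝ) : Prop :=
  E ⊆ f.I ∧ f.image E = E ∧ f.preimage E = E

/-- `D` is the minimal completely invariant closed set: the least one among the nonempty
completely invariant closed sets. -/
def IsMinimalInvariant (f : LorenzMap) (D : Set ℝ) : Prop :=
  IsLeast {E : Set ℝ | E.Nonempty ∧ IsClosed E ∧ f.IsCompletelyInvariant E} D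

/-- The restriction of `f` to `S` is locally eventually onto: the first finitely many images of
any nonempty relatively open subset of `S` cover `S`. -/
def IsLeoOn (f : LorenzMap) (S : Set ℝ) : Prop :=
  ∀ U : Set ℝ, IsOpen U → (U ∩ S).Nonempty →
    ∃ N : ℕ, (⋃ n : ℕ, ⋃ _ : n ≤ N, f.image^[n] (U ∩ S)) = S

/-- `S` is a periodic orbit (not passing through the discontinuity). -/
def IsPeriodicOrbit (f : LorenzMap) (S : Set ℝ) : Prop :=
  ∃ x ∈ f.I, ∃ n : ℕ, 1 ≤ n ∧ f.toFun^[n] x = x ∧ f.c ∉ f.orb {x} ∧ S = f.orb {x}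

/-- `f.IsFirstHit U n` says that `N(U) = n`: `n` is the least time at which some point of `U` is
mapped to `c`. -/
def IsFirstHit (f : LorenzMap) (U : Set ℝ) (n : ℕ) : Prop :=
  IsLeast {k : ℕ | f.c ∈ f.image^[k] U} n

/-- The Lorenz map `g` on `[u, v] = [g.a, g.b]` is a renormalization `(f^ℓ, f^r)` of `f`, with
critical interval `(p, q)`. -/
structure IsRenormalizationWith (f g : LorenzMap) (l r : ℕ) (p q : ℝ) : Prop where
  one_lt_l : 1 < l
  one_lt_r : 1 < r
  /-- `g` has the same discontinuity as `f`. -/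
  c_eq : g.c = f.c
  /-- `[u, v]` is a proper subinterval of `I`. -/
  proper : g.I ⊂ f.I
  left : ∀ x ∈ Ico g.a g.c, g.toFun x = f.toFun^[l] x
  right : ∀ x ∈ Ioc g.c g.b, g.toFun x = f.toFun^[r] x
  /-- The critical interval `(p, q)` contains the interior of the renormalization interval. -/
  left_mem : f.a ≤ p ∧ p ≤ g.a
  right_mem : g.b ≤ q ∧ q ≤ f.b
  /-- The end points of the critical interval are periodic. -/
  left_periodic : f.toFun^[l] p = p
  right_periodic : f.toFun^[r] q = q
  /-- The orbits of the end points do not enter the critical interval. -/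
  left_orb : Disjoint (f.orb {p}) (Ioo p q)
  right_orb : Disjoint (f.orb {q}) (Ioo p q)
  /-- `N((p, c)) = ℓ` and `N((c, q)) = r`. -/
  left_hit : f.IsFirstHit (Ioo p f.c) l
  right_hit : f.IsFirstHit (Ioo f.c q) r

/-- `g` is a renormalization of `f`. -/
def IsRenormalization (f g : LorenzMap) : Prop :=
  ∃ l r : ℕ, ∃ p q : ℝ, f.IsRenormalizationWith g l r p q

/-- `g` is the minimal renormalization of `f`: both of its return times are least possible. -/
def IsMinimalRenormalization (f g : LorenzMap) : Prop :=
  ∃ l r : ℕ, ∃ p q : ℝ, f.IsRenormalizationWith g l r p q ∧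
    ∀ (g' : LorenzMap) (l' r' : ℕ) (p' q' : ℝ),
      f.IsRenormalizationWith g' l' r' p' q' → l ≤ l' ∧ r ≤ r'

/-- `g` is a periodic renormalization of `f`: the end points of its critical interval belong to
the same periodic orbit. -/
def IsPeriodicRenormalization (f g : LorenzMap) : Prop :=
  ∃ l r : ℕ, ∃ p q : ℝ, f.IsRenormalizationWith g l r p q ∧ q ∈ f.orb {p}

/-- No renormalization of `f` fixes an end point of its renormalization interval. -/
def NoFixedEndpoint (f : LorenzMap) : Prop :=
  ∀ g : LorenzMap, f.IsRenormalization g → g.toFun g.a ≠ g.a ∧ g.toFun g.b ≠ g.b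

/-- `f` is exactly `m` times renormalizable (`0 ≤ m ≤ ∞`), and `R i` is its `i`-th
renormalization for `0 ≤ i ≤ m`: `R 0 = f`, each `R (i + 1)` is the minimal renormalization of
`R i`, and if `m` is finite then `R m` is prime. -/
structure IsRenormalizationSequence (f : LorenzMap) (m : ℕ∞) (R : ℕ → LorenzMap) : Prop where
  zero : R 0 = f
  succ : ∀ i : ℕ, (i : ℕ∞) < m → (R i).IsMinimalRenormalization (R (i + 1))
  last : ∀ i : ℕ, (i : ℕ∞) = m → ¬ ∃ g : LorenzMap, (R i).IsRenormalization g

end LorenzMap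

/-- A Cantor set in the real line: nonempty, compact, perfect and totally disconnected. -/
def IsCantorSet (S : Set ℝ) : Prop :=
  S.Nonempty ∧ IsCompact S ∧ Perfect S ∧ IsTotallyDisconnected S

/-- A finite union of (nondegenerate) closed intervals. -/
def IsFiniteUnionOfIntervals (S : Set ℝ) : Prop :=
  ∃ T : Finset (ℝ × ℝ), (∀ t ∈ T, t.1 < t.2) ∧ S = ⋃ t ∈ T, Icc t.1 t.2

/-! Everything is governed by the proper closed completely invariant sets K. Preimages of `c` are
dense, so K misses `c`, hence also `a` and `b`, which are images of `c`. Let (p, q) be the gap of K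
around `c`. At the first time when the image of (p, c) covers `c`, the branch must fix p, since no
point of the gap may fall into K; symmetrically for q. The return to (p, q) is thus a
renormalization (`IsInvariantSet.exists_renormalization`). Conversely, a renormalization with
critical interval (p, q) yields the set `avoiding p q` of points that never enter (p, q). With no
fixed end points, the renormalization interval lies strictly inside (p, q), and this makes the set
completely invariant. Expansion shows that K is determined by its gap
(`IsInvariantSet.eq_avoiding`), and two critical intervals are equal or strictly nested
(`IsRenormalizationWith.trichotomy`).

The sets K therefore form a chain, and the minimal renormalization, having the largest critical
interval, gives the smallest K. A renormalization of a renormalization is again one of `f`, and the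
tower of minimal ones exhausts the chain (`IsTower.exists_eq_avoiding`): a missing set would
renormalize the prime last map or, if m = ∞, have a return time larger than all those of the tower,
which are unbounded. Every α-limit set other than I is such a K, and the periodic end point p_i has
α-limit set E_i.

The sets orb(I_i) are closed, forward invariant and decreasing. A nonwandering point of orb(I_i)
outside orb(I_{i+1}) cannot have an orbit entering I_{i+1}, so it lies in E_{i+1} ∩ orb(I_i) =
orb(D_i). On D_i all α-limit sets of R^i f are equal to D_i, and compactness gives l.e.o.; the first
return structure transfers it to the orbit (`Induced.isLeoOn_orb`).

For finite m the attractor is orb(I_m), and l.e.o. of a prime map holds because the points not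
reached would accumulate on an invariant set (`isLeoOn_I`). For m = ∞ the points p_i tend to `c` and
miss A, so A contains no interval. A small neighbourhood of a point of A then contains a whole
interval visited by a branch at some level, and orbits staying in the next level have to pass
through it (`IsTower.exists_return`). -/

namespace LorenzMap

/-! ### Itineraries through the two-valued discontinuity -/

variable {f g : LorenzMap}

/-- `f.Reach n x y`: the point `y` is one of the images of `x` under `fⁿ`. -/
def Reach (f : LorenzMap) : ℕ → ℝ → ℝ → Prop
  | 0, x, y => x = y
  | n + 1, x, y => ∃ z, f.Step x z ∧ Reach f n z y

/-- The orbit of `x ∈ I` does not meet the discontinuity before time `n`. -/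
def Avoids (f : LorenzMap) (n : ℕ) (x : ℝ) : Prop :=
  x ∈ f.I ∧ ∀ j < n, f.toFun^[j] x ≠ f.c

lemma a_lt_b (f : LorenzMap) : f.a < f.b := f.a_lt_c.trans f.c_lt_b

lemma c_mem (f : LorenzMap) : f.c ∈ f.I := ⟨f.a_lt_c.le, f.c_lt_b.le⟩

lemma a_mem (f : LorenzMap) : f.a ∈ f.I := ⟨le_rfl, f.a_lt_b.le⟩

lemma b_mem (f : LorenzMap) : f.b ∈ f.I := ⟨f.a_lt_b.le, le_rfl⟩

lemma step_of_ne {x : ℝ} (hx : x ∈ f.I) (hc : x ≠ f.c) : f.Step x (f.toFun x) :=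
  ⟨hx, Or.inl ⟨hc, rfl⟩⟩

lemma step_c_a (f : LorenzMap) : f.Step f.c f.a := ⟨f.c_mem, Or.inr ⟨rfl, Or.inl rfl⟩⟩

lemma step_c_b (f : LorenzMap) : f.Step f.c f.b := ⟨f.c_mem, Or.inr ⟨rfl, Or.inr rfl⟩⟩

lemma Step.eq_of_ne {x y : ℝ} (h : f.Step x y) (hc : x ≠ f.c) : y = f.toFun x := by
  rcases h.2 with h | h
  · exact h.2
  · exact absurd h.1 hc

lemma Step.of_c {y : ℝ} (h : f.Step f.c y) : y = f.a ∨ y = f.b := by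
  rcases h.2 with h | h
  · exact absurd rfl h.1
  · exact h.2

lemma Step.mem {x y : ℝ} (h : f.Step x y) : y ∈ f.I := by
  rcases h with ⟨hx, ⟨hc, rfl⟩ | ⟨-, rfl | rfl⟩⟩
  · exact f.mapsTo x hx hc
  · exact f.a_mem
  · exact f.b_mem

lemma reach_one {x y : ℝ} : f.Reach 1 x y ↔ f.Step x y := by
  simp [Reach]

lemma reach_add {m n : ℕ} {x y : ℝ} :
    f.Reach (m + n) x y ↔ ∃ z, f.Reach m x z ∧ f.Reach n z y := by
  induction m generalizing x with
  | zero => simp [Reach]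
  | succ m ih =>
    rw [Nat.succ_add]
    simp only [Reach, ih]
    constructor
    · rintro ⟨z, hz, w, hw, h⟩
      exact ⟨w, ⟨z, hz, hw⟩, h⟩
    · rintro ⟨w, ⟨z, hz, hw⟩, h⟩
      exact ⟨z, hz, w, hw, h⟩

lemma Reach.trans {m n : ℕ} {x y z : ℝ} (h : f.Reach m x y) (h' : f.Reach n y z) :
    f.Reach (m + n) x z := reach_add.2 ⟨y, h, h'⟩

lemma reach_succ' {n : ℕ} {x y : ℝ} :
    f.Reach (n + 1) x y ↔ ∃ z, f.Reach n x z ∧ f.Step z y := by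
  simp only [reach_add, reach_one]

lemma Reach.mem {n : ℕ} {x y : ℝ} (h : f.Reach n x y) (hx : x ∈ f.I) : y ∈ f.I := by
  cases n with
  | zero => exact h ▸ hx
  | succ n =>
    obtain ⟨z, -, hz⟩ := reach_succ'.1 h
    exact hz.mem

lemma Reach.mem_left {n : ℕ} {x y : ℝ} (h : f.Reach n x y) (hy : y ∈ f.I) : x ∈ f.I := by
  cases n with
  | zero => exact h ▸ hy
  | succ n =>
    obtain ⟨z, hz, -⟩ := h
    exact hz.1

lemma mem_image_iterate {n : ℕ} {A : Set ℝ} {y : ℝ} :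
    y ∈ f.image^[n] A ↔ ∃ x ∈ A, f.Reach n x y := by
  induction n generalizing A with
  | zero => simp [Reach]
  | succ n ih =>
    rw [Function.iterate_succ_apply, ih]
    simp only [Reach, image, mem_ofPred_eq]
    constructor
    · rintro ⟨x, ⟨z, hz, hs⟩, h⟩
      exact ⟨z, hz, x, hs, h⟩
    · rintro ⟨z, hz, x, hs, h⟩
      exact ⟨x, ⟨z, hz, hs⟩, h⟩

lemma mem_preimage_iterate {n : ℕ} {B : Set ℝ} {x : ℝ} :
    x ∈ f.preimage^[n] B ↔ ∃ y ∈ B, f.Reach n x y := by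
  induction n generalizing x with
  | zero => simp [Reach]
  | succ n ih =>
    rw [Function.iterate_succ_apply']
    simp only [preimage, mem_ofPred_eq, ih, Reach]
    constructor
    · rintro ⟨x, ⟨z, hz, hs⟩, h⟩
      exact ⟨z, hz, x, h, hs⟩
    · rintro ⟨z, hz, x, hs, h⟩
      exact ⟨x, ⟨z, hz, h⟩, hs⟩

lemma mem_orb {A : Set ℝ} {y : ℝ} : y ∈ f.orb A ↔ ∃ x ∈ A, ∃ n, f.Reach n x y := by
  simp only [orb, mem_iUnion, mem_image_iterate]
  constructor
  · rintro ⟨n, x, hx, h⟩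
    exact ⟨x, hx, n, h⟩
  · rintro ⟨x, hx, n, h⟩
    exact ⟨n, x, hx, h⟩

lemma subset_orb {A : Set ℝ} : A ⊆ f.orb A := fun x hx => mem_orb.2 ⟨x, hx, 0, rfl⟩

lemma orb_mono {A B : Set ℝ} (h : A ⊆ B) : f.orb A ⊆ f.orb B := fun y hy => by
  obtain ⟨x, hx, n, hr⟩ := mem_orb.1 hy
  exact mem_orb.2 ⟨x, h hx, n, hr⟩

lemma orb_subset_I {A : Set ℝ} (hA : A ⊆ f.I) : f.orb A ⊆ f.I := by
  intro y hy
  obtain ⟨x, hx, n, h⟩ := mem_orb.1 hy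
  exact h.mem (hA hx)

lemma Avoids.mono {m n : ℕ} {x : ℝ} (h : f.Avoids n x) (hmn : m ≤ n) : f.Avoids m x :=
  ⟨h.1, fun j hj => h.2 j (hj.trans_le hmn)⟩

lemma avoids_zero {x : ℝ} (hx : x ∈ f.I) : f.Avoids 0 x := ⟨hx, fun j hj => by omega⟩

lemma Avoids.iterate_mem {n : ℕ} {x : ℝ} (h : f.Avoids n x) : f.toFun^[n] x ∈ f.I := by
  induction n with
  | zero => exact h.1
  | succ n ih =>
    rw [Function.iterate_succ_apply']
    exact f.mapsTo _ (ih (h.mono n.le_succ)) (h.2 n n.lt_succ_self)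

lemma avoids_succ {n : ℕ} {x : ℝ} :
    f.Avoids (n + 1) x ↔ f.Avoids n x ∧ f.toFun^[n] x ≠ f.c := by
  constructor
  · exact fun h => ⟨h.mono n.le_succ, h.2 n n.lt_succ_self⟩
  · rintro ⟨h, h'⟩
    refine ⟨h.1, fun j hj => ?_⟩
    rcases Nat.lt_succ_iff_lt_or_eq.1 hj with hj | rfl
    · exact h.2 j hj
    · exact h'

lemma avoids_add {m n : ℕ} {x : ℝ} :
    f.Avoids (m + n) x ↔ f.Avoids m x ∧ f.Avoids n (f.toFun^[m] x) := by
  constructor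
  · intro h
    have hm := h.mono (Nat.le_add_right m n)
    refine ⟨hm, hm.iterate_mem, fun j hj => ?_⟩
    rw [← Function.iterate_add_apply, add_comm]
    exact h.2 _ (by omega)
  · rintro ⟨h, h'⟩
    refine ⟨h.1, fun j hj => ?_⟩
    rcases lt_or_ge j m with hjm | hjm
    · exact h.2 j hjm
    · have := h'.2 (j - m) (by omega)
      rwa [← Function.iterate_add_apply, Nat.sub_add_cancel hjm] at this

lemma Avoids.reach_iff {n : ℕ} {x y : ℝ} (h : f.Avoids n x) :
    f.Reach n x y ↔ y = f.toFun^[n] x := by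
  induction n generalizing y with
  | zero => exact eq_comm
  | succ n ih =>
    have h1 := avoids_succ.1 h
    rw [reach_succ']
    simp only [ih h1.1, exists_eq_left, Function.iterate_succ_apply']
    exact ⟨fun hs => hs.eq_of_ne h1.2, fun hs => hs ▸ step_of_ne h1.1.iterate_mem h1.2⟩

lemma Avoids.reach {n : ℕ} {x : ℝ} (h : f.Avoids n x) : f.Reach n x (f.toFun^[n] x) :=
  h.reach_iff.2 rfl

/-- Either the orbit avoids the discontinuity up to time `n`, or there is a first visit. -/
lemma avoids_or_hit (n : ℕ) {x : ℝ} (hx : x ∈ f.I) :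
    f.Avoids n x ∨ ∃ j < n, f.Avoids j x ∧ f.toFun^[j] x = f.c := by
  induction n with
  | zero => exact Or.inl (avoids_zero hx)
  | succ n ih =>
    rcases ih with h | ⟨j, hj, h⟩
    · by_cases hc : f.toFun^[n] x = f.c
      · exact Or.inr ⟨n, n.lt_succ_self, h, hc⟩
      · exact Or.inl (avoids_succ.2 ⟨h, hc⟩)
    · exact Or.inr ⟨j, hj.trans n.lt_succ_self, h⟩

/-- Every itinerary from `x` follows `toFun` until the first visit of `c`. -/
lemma Reach.split {n : ℕ} {x y : ℝ} (h : f.Reach n x y) (hx : x ∈ f.I) :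
    (f.Avoids n x ∧ y = f.toFun^[n] x) ∨
      ∃ j < n, f.Avoids j x ∧ f.toFun^[j] x = f.c ∧ f.Reach (n - j) f.c y := by
  rcases avoids_or_hit n hx with ha | ⟨j, hj, ha, hc⟩
  · exact Or.inl ⟨ha, ha.reach_iff.1 h⟩
  · refine Or.inr ⟨j, hj, ha, hc, ?_⟩
    rw [show n = j + (n - j) by omega, reach_add] at h
    obtain ⟨z, hz, h⟩ := h
    rw [ha.reach_iff] at hz
    rwa [hz, hc] at h

/-! ### Branches of the iterates -/

lemma toFun_lt_b {x : ℝ} (h1 : f.a ≤ x) (h2 : x < f.c) : f.toFun x < f.b := by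
  obtain ⟨y, hy⟩ := exists_between h2
  have h3 : f.toFun x < f.toFun y :=
    f.strictMonoOn_left ⟨h1, h2⟩ ⟨h1.trans hy.1.le, hy.2⟩ hy.1
  exact h3.trans_le (f.mapsTo y ⟨h1.trans hy.1.le, hy.2.le.trans f.c_lt_b.le⟩ hy.2.ne).2

lemma a_lt_toFun {x : ℝ} (h1 : f.c < x) (h2 : x ≤ f.b) : f.a < f.toFun x := by
  obtain ⟨y, hy⟩ := exists_between h1
  have h3 : f.toFun y < f.toFun x :=
    f.strictMonoOn_right ⟨hy.1, hy.2.le.trans h2⟩ ⟨h1, h2⟩ hy.2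
  exact (f.mapsTo y ⟨f.a_lt_c.le.trans hy.1.le, hy.2.le.trans h2⟩ hy.1.ne').1.trans_lt h3

lemma subset_side {J : Set ℝ} (hJ : J.OrdConnected) (hI : J ⊆ f.I) (hc : f.c ∉ J) :
    J ⊆ Ico f.a f.c ∨ J ⊆ Ioc f.c f.b := by
  by_contra! h
  obtain ⟨⟨x, hx, hx'⟩, ⟨y, hy, hy'⟩⟩ := And.imp not_subset.1 not_subset.1 h
  have h1 : f.c ≤ x := by
    by_contra! hlt
    exact hx' ⟨(hI hx).1, hlt⟩
  have h2 : y ≤ f.c := by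
    by_contra! hlt
    exact hy' ⟨hlt, (hI hy).2⟩
  exact hc (hJ.out hy hx ⟨h2, h1⟩)

/-- On an interval whose points avoid `c` up to time `n`, the iterate `fⁿ` is continuous and
strictly increasing. -/
lemma branch {J : Set ℝ} (hJ : J.OrdConnected) {n : ℕ} (h : ∀ x ∈ J, f.Avoids n x) :
    StrictMonoOn f.toFun^[n] J ∧ ContinuousOn f.toFun^[n] J := by
  induction n with
  | zero => exact ⟨strictMonoOn_id, continuousOn_id⟩
  | succ n ih =>
    obtain ⟨hm, hcont⟩ := ih fun x hx => (h x hx).mono n.le_succ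
    have hoc : (f.toFun^[n] '' J).OrdConnected :=
      (hJ.isPreconnected.image _ hcont).ordConnected
    have hI : f.toFun^[n] '' J ⊆ f.I := by
      rintro _ ⟨x, hx, rfl⟩
      exact ((h x hx).mono n.le_succ).iterate_mem
    have hc : f.c ∉ f.toFun^[n] '' J := by
      rintro ⟨x, hx, hxc⟩
      exact (h x hx).2 n n.lt_succ_self hxc
    rw [Function.iterate_succ']
    rcases subset_side hoc hI hc with hs | hs
    · exact ⟨f.strictMonoOn_left.comp hm fun x hx => hs ⟨x, hx, rfl⟩,
        f.continuousOn_left.comp hcont fun x hx => hs ⟨x, hx, rfl⟩⟩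
    · exact ⟨f.strictMonoOn_right.comp hm fun x hx => hs ⟨x, hx, rfl⟩,
        f.continuousOn_right.comp hcont fun x hx => hs ⟨x, hx, rfl⟩⟩

lemma continuousWithinAt_toFun {x : ℝ} (hx : x ∈ f.I) (hc : x ≠ f.c) :
    ContinuousWithinAt f.toFun f.I x := by
  rcases lt_or_gt_of_ne hc with h | h
  · refine (f.continuousOn_left x ⟨hx.1, h⟩).mono_of_mem_nhdsWithin ?_
    filter_upwards [self_mem_nhdsWithin, mem_nhdsWithin_of_mem_nhds (Iio_mem_nhds h)] with y hy hy'
    exact ⟨hy.1, hy'⟩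
  · refine (f.continuousOn_right x ⟨h, hx.2⟩).mono_of_mem_nhdsWithin ?_
    filter_upwards [self_mem_nhdsWithin, mem_nhdsWithin_of_mem_nhds (Ioi_mem_nhds h)] with y hy hy'
    exact ⟨hy', hy.2⟩

/-- The two claims need a common induction: continuity of the n-th iterate is what keeps nearby
orbits away from `c` one step longer. -/
lemma Avoids.eventually_and_continuousWithinAt {n : ℕ} {x : ℝ} (h : f.Avoids n x) :
    (∀ᶠ y in 𝓝[f.I] x, f.Avoids n y) ∧ ContinuousWithinAt f.toFun^[n] f.I x := by
  induction n with
  | zero =>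
    refine ⟨?_, continuousWithinAt_id⟩
    filter_upwards [self_mem_nhdsWithin] with y hy using avoids_zero hy
  | succ n ih =>
    obtain ⟨h1, h2⟩ := avoids_succ.1 h
    obtain ⟨ha, hcont⟩ := ih h1
    have hev : ∀ᶠ y in 𝓝[f.I] x, f.Avoids (n + 1) y := by
      filter_upwards [ha, hcont.eventually_ne h2] with y hy hy'
      exact avoids_succ.2 ⟨hy, hy'⟩
    refine ⟨hev, ?_⟩
    have h3 : Tendsto f.toFun^[n] (𝓝[f.I] x) (𝓝[f.I] (f.toFun^[n] x)) := by
      refine tendsto_nhdsWithin_iff.2 ⟨hcont, ?_⟩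
      filter_upwards [ha] with y hy using hy.iterate_mem
    rw [Function.iterate_succ']
    exact (continuousWithinAt_toFun h1.iterate_mem h2).tendsto.comp h3

lemma Avoids.eventually {n : ℕ} {x : ℝ} (h : f.Avoids n x) : ∀ᶠ y in 𝓝[f.I] x, f.Avoids n y :=
  h.eventually_and_continuousWithinAt.1

lemma Avoids.continuousWithinAt {n : ℕ} {x : ℝ} (h : f.Avoids n x) :
    ContinuousWithinAt f.toFun^[n] f.I x :=
  h.eventually_and_continuousWithinAt.2

/-! ### Reflection -/

lemma tendsto_neg_nhdsLT (x : ℝ) : Tendsto (fun y : ℝ => -y) (𝓝[<] (-x)) (𝓝[>] x) := by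
  refine tendsto_nhdsWithin_iff.2 ⟨?_, ?_⟩
  · have : Tendsto (fun y : ℝ => -y) (𝓝 (-x)) (𝓝 (- -x)) := continuous_neg.tendsto _
    rw [neg_neg] at this
    exact this.mono_left nhdsWithin_le_nhds
  · filter_upwards [self_mem_nhdsWithin] with y hy
    exact lt_neg_of_lt_neg (mem_Iio.1 hy)

lemma tendsto_neg_nhdsGT (x : ℝ) : Tendsto (fun y : ℝ => -y) (𝓝[>] (-x)) (𝓝[<] x) := by
  refine tendsto_nhdsWithin_iff.2 ⟨?_, ?_⟩
  · have : Tendsto (fun y : ℝ => -y) (𝓝 (-x)) (𝓝 (- -x)) := continuous_neg.tendsto _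
    rw [neg_neg] at this
    exact this.mono_left nhdsWithin_le_nhds
  · filter_upwards [self_mem_nhdsWithin] with y hy
    exact neg_lt_of_neg_lt (mem_Ioi.1 hy)

/-- The Lorenz map conjugate to `f` by `x ↦ -x`. -/
def reflect (f : LorenzMap) : LorenzMap where
  a := -f.b
  b := -f.a
  c := -f.c
  toFun x := -f.toFun (-x)
  a_lt_c := neg_lt_neg f.c_lt_b
  c_lt_b := neg_lt_neg f.a_lt_c
  mapsTo x hx hc := by
    have := f.mapsTo (-x) ⟨by linarith [hx.2], by linarith [hx.1]⟩ fun h => hc (by linarith)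
    exact ⟨by linarith [this.2], by linarith [this.1]⟩
  strictMonoOn_left x hx y hy hxy :=
    neg_lt_neg (f.strictMonoOn_right ⟨by linarith [hy.2], by linarith [hy.1]⟩
      ⟨by linarith [hx.2], by linarith [hx.1]⟩ (neg_lt_neg hxy))
  strictMonoOn_right x hx y hy hxy :=
    neg_lt_neg (f.strictMonoOn_left ⟨by linarith [hy.2], by linarith [hy.1]⟩
      ⟨by linarith [hx.2], by linarith [hx.1]⟩ (neg_lt_neg hxy))
  continuousOn_left := (f.continuousOn_right.comp continuous_neg.continuousOn
    fun x hx => ⟨by linarith [hx.2], by linarith [hx.1]⟩).neg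
  continuousOn_right := (f.continuousOn_left.comp continuous_neg.continuousOn
    fun x hx => ⟨by linarith [hx.2], by linarith [hx.1]⟩).neg
  tendsto_left := (f.tendsto_right.comp (tendsto_neg_nhdsLT f.c)).neg
  tendsto_right := (f.tendsto_left.comp (tendsto_neg_nhdsGT f.c)).neg

@[simp] lemma reflect_a (f : LorenzMap) : f.reflect.a = -f.b := rfl
@[simp] lemma reflect_b (f : LorenzMap) : f.reflect.b = -f.a := rfl
@[simp] lemma reflect_c (f : LorenzMap) : f.reflect.c = -f.c := rfl
lemma reflect_toFun (f : LorenzMap) (x : ℝ) : f.reflect.toFun x = -f.toFun (-x) := rfl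

lemma reflect_iterate (f : LorenzMap) (n : ℕ) (x : ℝ) :
    f.reflect.toFun^[n] x = -f.toFun^[n] (-x) := by
  induction n generalizing x with
  | zero => simp
  | succ n ih => simp [ih, reflect_toFun]

@[simp] lemma mem_reflect_I {x : ℝ} : x ∈ f.reflect.I ↔ -x ∈ f.I := by
  constructor
  · exact fun h => ⟨by linarith [h.2, f.reflect_b], by linarith [h.1, f.reflect_a]⟩
  · exact fun h => ⟨by linarith [h.2, f.reflect_a], by linarith [h.1, f.reflect_b]⟩

lemma reflect_step {x y : ℝ} : f.reflect.Step x y ↔ f.Step (-x) (-y) := by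
  simp only [Step, mem_reflect_I, reflect_c, reflect_toFun, reflect_a, reflect_b, ne_eq,
    neg_eq_iff_eq_neg]
  tauto

lemma reflect_reach {n : ℕ} {x y : ℝ} : f.reflect.Reach n x y ↔ f.Reach n (-x) (-y) := by
  induction n generalizing x with
  | zero => simp [Reach]
  | succ n ih =>
    simp only [Reach, ih, reflect_step]
    constructor
    · rintro ⟨z, h⟩
      exact ⟨-z, h⟩
    · rintro ⟨z, h⟩
      exact ⟨-z, by simpa using h⟩

lemma reflect_avoids {n : ℕ} {x : ℝ} : f.reflect.Avoids n x ↔ f.Avoids n (-x) := by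
  simp [Avoids, reflect_iterate]

/-! ### Expanding maps -/

lemma IsExpanding.exists_reach (hf : f.IsExpanding) {s t : ℝ} (hst : s < t)
    (hI : Ioo s t ⊆ f.I) : ∃ n, ∃ x ∈ Ioo s t, f.Reach n x f.c := by
  obtain ⟨y, hy⟩ := nonempty_Ioo.2 hst
  obtain ⟨x, hx, hx'⟩ := mem_closure_iff.1 (hf (hI hy)) _ isOpen_Ioo hy
  obtain ⟨n, hn⟩ := mem_iUnion.1 hx'
  obtain ⟨_, rfl, h⟩ := mem_preimage_iterate.1 hn
  exact ⟨n, x, hx, h⟩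

lemma avoids_of_forall_not_reach {U : Set ℝ} (hU : U ⊆ f.I) {n : ℕ}
    (h : ∀ k < n, ¬ ∃ x ∈ U, f.Reach k x f.c) : ∀ x ∈ U, f.Avoids n x := by
  intro x hx
  rcases avoids_or_hit n (hU hx) with ha | ⟨j, hj, ha, hc⟩
  · exact ha
  · exact absurd ⟨x, hx, hc ▸ ha.reach⟩ (h j hj)

lemma IsExpanding.exists_firstHit (hf : f.IsExpanding) {s t : ℝ} (hst : s < t)
    (hI : Ioo s t ⊆ f.I) :
    ∃ n, (∀ x ∈ Ioo s t, f.Avoids n x) ∧ ∃ x ∈ Ioo s t, f.toFun^[n] x = f.c := by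
  classical
  have hex := hf.exists_reach hst hI
  have ha := avoids_of_forall_not_reach hI fun k hk => Nat.find_min hex hk
  obtain ⟨x, hx, hr⟩ := Nat.find_spec hex
  exact ⟨_, ha, x, hx, ((ha x hx).reach_iff.1 hr).symm⟩

lemma isFirstHit_iff {U : Set ℝ} (hU : U ⊆ f.I) {n : ℕ} :
    f.IsFirstHit U n ↔ (∀ x ∈ U, f.Avoids n x) ∧ ∃ x ∈ U, f.toFun^[n] x = f.c := by
  constructor
  · rintro ⟨h1, h2⟩
    have ha : ∀ x ∈ U, f.Avoids n x := avoids_of_forall_not_reach hU fun k hk h =>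
      hk.not_ge (h2 (mem_image_iterate.2 h))
    obtain ⟨x, hx, hr⟩ := mem_image_iterate.1 h1
    exact ⟨ha, x, hx, ((ha x hx).reach_iff.1 hr).symm⟩
  · rintro ⟨ha, x, hx, hc⟩
    refine ⟨mem_image_iterate.2 ⟨x, hx, hc ▸ (ha x hx).reach⟩, fun k hk => ?_⟩
    obtain ⟨y, hy, hr⟩ := mem_image_iterate.1 hk
    by_contra! hlt
    exact (ha y hy).2 k hlt (((ha y hy).mono hlt.le).reach_iff.1 hr).symm

/-- No branch of an iterate of an expanding map sends an interval into itself. -/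
lemma IsExpanding.not_mapsTo (hf : f.IsExpanding) {s t : ℝ} (hst : s < t) {n : ℕ} (hn : 1 ≤ n)
    (ha : ∀ x ∈ Ioo s t, f.Avoids n x) : ¬ MapsTo f.toFun^[n] (Ioo s t) (Ioo s t) := by
  intro hmaps
  -- Invariance lets the avoidance up to time n be repeated, so the interval would contain no
  -- preimage of `c` at all.
  have hall : ∀ i, ∀ x ∈ Ioo s t, f.Avoids i x := by
    intro i
    induction i using Nat.strong_induction_on with
    | _ i ih =>
      intro x hx
      rcases le_total i n with h | h
      · exact (ha x hx).mono h
      · have := avoids_add.2 ⟨ha x hx, ih (i - n) (by omega) _ (hmaps hx)⟩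
        rwa [Nat.add_sub_cancel' h] at this
  obtain ⟨n, x, hx, hr⟩ := hf.exists_reach hst fun x hx => (ha x hx).1
  exact (hall (n + 1) x hx).2 n n.lt_succ_self ((hall n x hx).reach_iff.1 hr).symm

lemma IsExpanding.reflect (hf : f.IsExpanding) : f.reflect.IsExpanding := by
  intro x hx
  rw [mem_closure_iff]
  intro U hU hxU
  obtain ⟨y, hy, hy'⟩ := mem_closure_iff.1 (hf (mem_reflect_I.1 hx)) _
    (hU.preimage continuous_neg) (by simpa using hxU)
  obtain ⟨n, hn⟩ := mem_iUnion.1 hy'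
  obtain ⟨_, rfl, h⟩ := mem_preimage_iterate.1 hn
  exact ⟨-y, hy, mem_iUnion.2 ⟨n, mem_preimage_iterate.2
    ⟨-f.c, rfl, by simpa [reflect_reach] using h⟩⟩⟩

lemma finite_preimage_singleton (f : LorenzMap) (y : ℝ) : {x | f.Step x y}.Finite := by
  have h1 : {x | x ∈ Ico f.a f.c ∧ f.toFun x = y}.Finite := by
    refine Set.Subsingleton.finite fun x hx z hz => ?_
    exact f.strictMonoOn_left.injOn hx.1 hz.1 (hx.2.trans hz.2.symm)
  have h2 : {x | x ∈ Ioc f.c f.b ∧ f.toFun x = y}.Finite := by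
    refine Set.Subsingleton.finite fun x hx z hz => ?_
    exact f.strictMonoOn_right.injOn hx.1 hz.1 (hx.2.trans hz.2.symm)
  refine ((h1.union h2).union (finite_singleton f.c)).subset fun x hx => ?_
  rcases lt_trichotomy x f.c with h | h | h
  · exact Or.inl (Or.inl ⟨⟨hx.1.1, h⟩, (hx.eq_of_ne h.ne).symm⟩)
  · exact Or.inr h
  · exact Or.inl (Or.inr ⟨⟨h, hx.1.2⟩, (hx.eq_of_ne h.ne').symm⟩)

lemma finite_reach (f : LorenzMap) (n : ℕ) (y : ℝ) : {x | f.Reach n x y}.Finite := by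
  induction n generalizing y with
  | zero => exact (finite_singleton y).subset fun x hx => hx
  | succ n ih =>
    refine ((ih y).biUnion fun z _ => finite_preimage_singleton f z).subset fun x hx => ?_
    obtain ⟨z, hz, h⟩ := hx
    exact mem_biUnion h hz

/-- Only finitely many points reach `c` in fewer than N steps; density is applied to a subinterval
free of them. -/
lemma IsExpanding.exists_reach_ge (hf : f.IsExpanding) {s t : ℝ} (hst : s < t)
    (hI : Ioo s t ⊆ f.I) (N : ℕ) : ∃ n ≥ N, ∃ x ∈ Ioo s t, f.Reach n x f.c := by
  have hfin : (⋃ n ∈ Finset.range N, {x | f.Reach n x f.c}).Finite :=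
    (Finset.range N).finite_toSet.biUnion fun n _ => finite_reach f n f.c
  have hinf : (Ioo s t \ ⋃ n ∈ Finset.range N, {x | f.Reach n x f.c}).Nonempty :=
    ((Ioo_infinite hst).sdiff hfin).nonempty
  obtain ⟨y, hy⟩ := hinf
  have hopen : IsOpen (Ioo s t \ ⋃ n ∈ Finset.range N, {x | f.Reach n x f.c}) :=
    isOpen_Ioo.sdiff hfin.isClosed
  obtain ⟨s', t', hy', hsub⟩ := mem_nhds_iff_exists_Ioo_subset.1 (hopen.mem_nhds hy)
  obtain ⟨n, x, hx, hr⟩ := hf.exists_reach (hy'.1.trans hy'.2) fun z hz => hI (hsub hz).1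
  refine ⟨n, ?_, x, (hsub hx).1, hr⟩
  by_contra! hlt
  exact (hsub hx).2 (mem_biUnion (by simpa using hlt) hr)

lemma exists_step_left {y : ℝ} (h1 : f.toFun f.a ≤ y) (h2 : y < f.b) :
    ∃ x ∈ Ico f.a f.c, f.toFun x = y := by
  obtain ⟨x, hx, hxc⟩ := ((f.tendsto_left.eventually_const_lt h2).and
    (Ioo_mem_nhdsLT f.a_lt_c)).exists
  obtain ⟨z, hz, hzy⟩ := intermediate_value_Icc hxc.1.le
    (f.continuousOn_left.mono fun z hz => ⟨hz.1, hz.2.trans_lt hxc.2⟩) ⟨h1, hx.le⟩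
  exact ⟨z, ⟨hz.1, hz.2.trans_lt hxc.2⟩, hzy⟩

lemma exists_step_right {y : ℝ} (h1 : y ≤ f.toFun f.b) (h2 : f.a < y) :
    ∃ x ∈ Ioc f.c f.b, f.toFun x = y := by
  obtain ⟨x, hx, hxc⟩ := ((f.tendsto_right.eventually_lt_const h2).and
    (Ioo_mem_nhdsGT f.c_lt_b)).exists
  obtain ⟨z, hz, hzy⟩ := intermediate_value_Icc hxc.2.le
    (f.continuousOn_right.mono fun z hz => ⟨hxc.1.trans_le hz.1, hz.2⟩) ⟨hx.le, h1⟩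
  exact ⟨z, ⟨hxc.1.trans_le hz.1, hz.2⟩, hzy⟩

/-- Otherwise the ranges of the two branches leave a gap and backward itineraries are unique. The
gap contains two preimages of `c` of different orders, and the one of higher order passes through
the other, which however has no preimage. -/
lemma IsExpanding.toFun_a_le (hf : f.IsExpanding) : f.toFun f.a ≤ f.toFun f.b := by
  by_contra! hlt
  have hleft : ∀ x ∈ Ico f.a f.c, f.toFun f.a ≤ f.toFun x := fun x hx =>
    f.strictMonoOn_left.monotoneOn ⟨le_rfl, f.a_lt_c⟩ hx hx.1
  have hright : ∀ x ∈ Ioc f.c f.b, f.toFun x ≤ f.toFun f.b := fun x hx =>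
    f.strictMonoOn_right.monotoneOn hx ⟨f.c_lt_b, le_rfl⟩ hx.2
  have hab : f.a < f.toFun f.a := (a_lt_toFun f.c_lt_b le_rfl).trans hlt
  have hba : f.toFun f.b < f.b := hlt.trans (toFun_lt_b le_rfl f.a_lt_c)
  -- Values of the left branch lie in [f(a), b), those of the right branch in (a, f(b)], and the
  -- images of `c` are a and b: all disjoint.
  have hinj : ∀ x x' y, f.Step x y → f.Step x' y → x = x' := by
    have key : ∀ x x' y, x ≤ x' → f.Step x y → f.Step x' y → x = x' := by
      intro x x' y hxx h h'
      rcases lt_trichotomy x f.c with hx | hx | hx <;>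
        rcases lt_trichotomy x' f.c with hx' | hx' | hx'
      · exact f.strictMonoOn_left.injOn ⟨h.1.1, hx⟩ ⟨h'.1.1, hx'⟩
          ((h.eq_of_ne hx.ne).symm.trans (h'.eq_of_ne hx'.ne))
      · subst hx'
        have h1 := hleft x ⟨h.1.1, hx⟩
        have h2 := toFun_lt_b h.1.1 hx
        rw [← h.eq_of_ne hx.ne] at h1 h2
        rcases h'.of_c with rfl | rfl <;> linarith
      · have h1 := hleft x ⟨h.1.1, hx⟩
        have h2 := hright x' ⟨hx', h'.1.2⟩
        rw [← h.eq_of_ne hx.ne] at h1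
        rw [← h'.eq_of_ne hx'.ne'] at h2
        linarith
      · linarith
      · rw [hx, hx']
      · subst hx
        have h1 := hright x' ⟨hx', h'.1.2⟩
        have h2 := a_lt_toFun hx' h'.1.2
        rw [← h'.eq_of_ne hx'.ne'] at h1 h2
        rcases h.of_c with rfl | rfl <;> linarith
      · linarith
      · linarith
      · exact f.strictMonoOn_right.injOn ⟨hx, h.1.2⟩ ⟨hx', h'.1.2⟩
          ((h.eq_of_ne hx.ne').symm.trans (h'.eq_of_ne hx'.ne'))
    intro x x' y h h'
    rcases le_total x x' with hle | hle
    · exact key x x' y hle h h'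
    · exact (key x' x y hle h' h).symm
  have hinj' : ∀ n x x' y, f.Reach n x y → f.Reach n x' y → x = x' := by
    intro n
    induction n with
    | zero => intro x x' y h h'; exact Eq.trans h (Eq.symm h')
    | succ n ih =>
      rintro x x' y ⟨z, hz, h⟩ ⟨z', hz', h'⟩
      obtain rfl := ih z z' y h h'
      exact hinj x x' z hz hz'
  have hgap : Ioo (f.toFun f.b) (f.toFun f.a) ⊆ f.I := fun x hx =>
    ⟨(a_lt_toFun f.c_lt_b le_rfl).le.trans hx.1.le, hx.2.le.trans (toFun_lt_b le_rfl f.a_lt_c).le⟩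
  obtain ⟨n, x, hx, hr⟩ := hf.exists_reach hlt hgap
  obtain ⟨m, hm, x', hx', hr'⟩ := hf.exists_reach_ge hlt hgap (n + 1)
  rw [show m = (m - n - 1 + 1) + n by omega, reach_add] at hr'
  obtain ⟨z, hz, hzc⟩ := hr'
  obtain rfl := hinj' n _ _ _ hr hzc
  obtain ⟨w, -, hw⟩ := reach_succ'.1 hz
  rcases lt_trichotomy w f.c with hwc | rfl | hwc
  · have := hleft w ⟨hw.1.1, hwc⟩
    rw [← hw.eq_of_ne hwc.ne] at this
    exact this.not_gt hx.2
  · rcases hw.of_c with rfl | rfl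
    · linarith [hx.1, a_lt_toFun f.c_lt_b (le_refl f.b)]
    · linarith [hx.2, toFun_lt_b (le_refl f.a) f.a_lt_c]
  · have := hright w ⟨hwc, hw.1.2⟩
    rw [← hw.eq_of_ne hwc.ne'] at this
    exact this.not_gt hx.1

/-- Since f(a) ≤ f(b), the two branches cover (a, b); the end points are images of `c`. -/
lemma IsExpanding.exists_step (hf : f.IsExpanding) {y : ℝ} (hy : y ∈ f.I) : ∃ x, f.Step x y := by
  rcases eq_or_ne y f.a with rfl | ha
  · exact ⟨_, f.step_c_a⟩
  rcases eq_or_ne y f.b with rfl | hb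
  · exact ⟨_, f.step_c_b⟩
  rcases le_total (f.toFun f.a) y with h | h
  · obtain ⟨x, hx, rfl⟩ := exists_step_left h (lt_of_le_of_ne hy.2 hb)
    exact ⟨x, step_of_ne ⟨hx.1, hx.2.le.trans f.c_lt_b.le⟩ hx.2.ne⟩
  · obtain ⟨x, hx, rfl⟩ := exists_step_right (h.trans hf.toFun_a_le) (lt_of_le_of_ne' hy.1 ha)
    exact ⟨x, step_of_ne ⟨f.a_lt_c.le.trans hx.1.le, hx.2⟩ hx.1.ne'⟩

lemma IsExpanding.exists_reach_left (hf : f.IsExpanding) (n : ℕ) {y : ℝ} (hy : y ∈ f.I) :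
    ∃ x ∈ f.I, f.Reach n x y := by
  induction n with
  | zero => exact ⟨y, hy, rfl⟩
  | succ n ih =>
    obtain ⟨x, hx, hr⟩ := ih
    obtain ⟨z, hz⟩ := hf.exists_step hx
    exact ⟨z, hz.1, x, hz, hr⟩

lemma IsExpanding.image_I (hf : f.IsExpanding) : f.image f.I = f.I := by
  ext y
  constructor
  · rintro ⟨x, -, h⟩
    exact h.mem
  · intro hy
    obtain ⟨x, hx⟩ := hf.exists_step hy
    exact ⟨x, hx.1, hx⟩

/-- A branch of an iterate which fixes the left end point `p` and covers `c` moves the points of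
`(p, c)` to the right. -/
lemma IsExpanding.lt_iterate (hf : f.IsExpanding) {p v : ℝ} {l : ℕ} (hl : 1 ≤ l)
    (ha : ∀ x ∈ Ico p f.c, f.Avoids l x) (hp : f.toFun^[l] p = p)
    (ht : Tendsto f.toFun^[l] (𝓝[<] f.c) (𝓝 v)) (hv : f.c < v) {x : ℝ} (hx : x ∈ Ioo p f.c) :
    x < f.toFun^[l] x := by
  obtain ⟨hm, hcont⟩ := branch ordConnected_Ico ha
  -- A second fixed point z would make (p, z) invariant.
  have hne : ∀ z ∈ Ioo p f.c, f.toFun^[l] z ≠ z := by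
    intro z hz hzz
    refine hf.not_mapsTo hz.1 hl (fun y hy => ha y ⟨hy.1.le, hy.2.trans hz.2⟩) fun y hy => ?_
    have h1 := hm ⟨le_rfl, hx.1.trans hx.2⟩ ⟨hy.1.le, hy.2.trans hz.2⟩ hy.1
    have h2 := hm ⟨hy.1.le, hy.2.trans hz.2⟩ ⟨hz.1.le, hz.2⟩ hy.2
    rw [hp] at h1
    rw [hzz] at h2
    exact ⟨h1, h2⟩
  by_contra! hle
  -- Close to `c` the branch exceeds `c`, so a point not moved to the right would produce a fixed
  -- point in between.
  obtain ⟨y, hy, hyc⟩ := ((ht.eventually_const_lt hv).and (Ioo_mem_nhdsLT hx.2)).exists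
  have hcont : ContinuousOn (fun z => f.toFun^[l] z - z) (Icc x y) :=
    (hcont.mono fun z hz => ⟨hx.1.le.trans hz.1, hz.2.trans_lt hyc.2⟩).sub continuousOn_id
  obtain ⟨z, hz, hz0⟩ := intermediate_value_Icc hyc.1.le hcont
    (show (0 : ℝ) ∈ Icc _ _ from ⟨by linarith, by linarith [hyc.2]⟩)
  exact hne z ⟨hx.1.trans_le hz.1, hz.2.trans_lt hyc.2⟩ (by simpa [sub_eq_zero] using hz0)

lemma lt_of_strictMonoOn_of_tendsto {φ : ℝ → ℝ} {p c v : ℝ} (hm : StrictMonoOn φ (Ico p c))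
    (ht : Tendsto φ (𝓝[<] c) (𝓝 v)) {x : ℝ} (hx : x ∈ Ico p c) : φ x < v := by
  obtain ⟨y, hy⟩ := exists_between hx.2
  have hy' : y ∈ Ico p c := ⟨hx.1.trans hy.1.le, hy.2⟩
  refine (hm hx hy' hy.1).trans_le (ge_of_tendsto ht ?_)
  filter_upwards [Ioo_mem_nhdsLT hy.2] with z hz
  exact hm.monotoneOn hy' ⟨hy'.1.trans hz.1.le, hz.2⟩ hz.1.le

/-! ### The critical interval of a renormalization -/

namespace IsRenormalizationWith

variable {l r : ℕ} {p q : ℝ}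

lemma p_lt_c (h : f.IsRenormalizationWith g l r p q) : p < f.c :=
  h.c_eq ▸ h.left_mem.2.trans_lt g.a_lt_c

lemma c_lt_q (h : f.IsRenormalizationWith g l r p q) : f.c < q :=
  h.c_eq ▸ g.c_lt_b.trans_le h.right_mem.1

lemma p_mem (h : f.IsRenormalizationWith g l r p q) : p ∈ f.I :=
  ⟨h.left_mem.1, h.p_lt_c.le.trans f.c_lt_b.le⟩

lemma q_mem (h : f.IsRenormalizationWith g l r p q) : q ∈ f.I :=
  ⟨f.a_lt_c.le.trans h.c_lt_q.le, h.right_mem.2⟩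

lemma Ioo_subset (h : f.IsRenormalizationWith g l r p q) : Ioo p q ⊆ f.I := fun _ hx =>
  ⟨h.p_mem.1.trans hx.1.le, hx.2.le.trans h.q_mem.2⟩

lemma Ioo_left_subset (h : f.IsRenormalizationWith g l r p q) : Ioo p f.c ⊆ f.I := fun _ hx =>
  h.Ioo_subset ⟨hx.1, hx.2.trans h.c_lt_q⟩

lemma Ioo_right_subset (h : f.IsRenormalizationWith g l r p q) : Ioo f.c q ⊆ f.I := fun _ hx =>
  h.Ioo_subset ⟨h.p_lt_c.trans hx.1, hx.2⟩

lemma reflect (h : f.IsRenormalizationWith g l r p q) :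
    f.reflect.IsRenormalizationWith g.reflect r l (-q) (-p) := by
  have horb : ∀ x, Disjoint (f.orb {x}) (Ioo p q) →
      Disjoint (f.reflect.orb {-x}) (Ioo (-q) (-p)) := by
    intro x hx
    refine disjoint_left.2 fun y hy hy' => ?_
    obtain ⟨_, rfl, n, hr⟩ := mem_orb.1 hy
    rw [reflect_reach, neg_neg] at hr
    exact disjoint_left.1 hx (mem_orb.2 ⟨x, rfl, n, hr⟩)
      ⟨by linarith [hy'.2], by linarith [hy'.1]⟩
  refine ⟨h.one_lt_r, h.one_lt_l, by simp [h.c_eq], ?_, ?_, ?_, ?_, ?_, ?_, ?_, horb q h.right_orb,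
    horb p h.left_orb, ?_, ?_⟩
  · refine ⟨fun x hx => mem_reflect_I.2 (h.proper.1 (mem_reflect_I.1 hx)), fun hsub => ?_⟩
    refine h.proper.2 fun x hx => ?_
    have := mem_reflect_I.1 (hsub (a := -x) (mem_reflect_I.2 (by simpa using hx)))
    simpa using this
  · intro x hx
    rw [reflect_iterate, reflect_toFun, h.right]
    exact ⟨by linarith [hx.2, g.reflect_c], by linarith [hx.1, g.reflect_a]⟩
  · intro x hx
    rw [reflect_iterate, reflect_toFun, h.left]
    exact ⟨by linarith [hx.2, g.reflect_b], by linarith [hx.1, g.reflect_c]⟩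
  · exact ⟨neg_le_neg h.right_mem.2, neg_le_neg h.right_mem.1⟩
  · exact ⟨neg_le_neg h.left_mem.2, neg_le_neg h.left_mem.1⟩
  · simp [reflect_iterate, h.right_periodic]
  · simp [reflect_iterate, h.left_periodic]
  · obtain ⟨h1, x, hx, h2⟩ := (isFirstHit_iff h.Ioo_right_subset).1 h.right_hit
    refine (isFirstHit_iff fun x hx => mem_reflect_I.2 (h.Ioo_right_subset ?_)).2 ⟨?_, -x, ?_, ?_⟩
    · exact ⟨by linarith [hx.2, f.reflect_c], by linarith [hx.1]⟩
    · exact fun x hx => reflect_avoids.2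
        (h1 _ ⟨by linarith [hx.2, f.reflect_c], by linarith [hx.1]⟩)
    · exact ⟨neg_lt_neg hx.2, neg_lt_neg hx.1⟩
    · simp [reflect_iterate, h2]
  · obtain ⟨h1, x, hx, h2⟩ := (isFirstHit_iff h.Ioo_left_subset).1 h.left_hit
    refine (isFirstHit_iff fun x hx => mem_reflect_I.2 (h.Ioo_left_subset ?_)).2 ⟨?_, -x, ?_, ?_⟩
    · exact ⟨by linarith [hx.2], by linarith [hx.1, f.reflect_c]⟩
    · exact fun x hx => reflect_avoids.2
        (h1 _ ⟨by linarith [hx.2], by linarith [hx.1, f.reflect_c]⟩)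
    · exact ⟨neg_lt_neg hx.2, neg_lt_neg hx.1⟩
    · simp [reflect_iterate, h2]

lemma avoids_p (h : f.IsRenormalizationWith g l r p q) (n : ℕ) : f.Avoids n p := by
  rcases avoids_or_hit n h.p_mem with ha | ⟨j, -, ha, hc⟩
  · exact ha
  · exact absurd ⟨h.p_lt_c, h.c_lt_q⟩
      (disjoint_left.1 h.left_orb (mem_orb.2 ⟨p, rfl, j, hc ▸ ha.reach⟩))

lemma iterate_p_notMem (h : f.IsRenormalizationWith g l r p q) (n : ℕ) :
    f.toFun^[n] p ∉ Ioo p q :=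
  disjoint_left.1 h.left_orb (mem_orb.2 ⟨p, rfl, n, (h.avoids_p n).reach⟩)

lemma avoids_left (h : f.IsRenormalizationWith g l r p q) {x : ℝ} (hx : x ∈ Ico p f.c) :
    f.Avoids l x := by
  rcases eq_or_lt_of_le hx.1 with rfl | hlt
  · exact h.avoids_p l
  · exact ((isFirstHit_iff h.Ioo_left_subset).1 h.left_hit).1 x ⟨hlt, hx.2⟩

lemma strictMonoOn_left (h : f.IsRenormalizationWith g l r p q) {j : ℕ} (hj : j ≤ l) :
    StrictMonoOn f.toFun^[j] (Ico p f.c) :=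
  (branch ordConnected_Ico fun _ hx => (h.avoids_left hx).mono hj).1

lemma continuousOn_left (h : f.IsRenormalizationWith g l r p q) {j : ℕ} (hj : j ≤ l) :
    ContinuousOn f.toFun^[j] (Ico p f.c) :=
  (branch ordConnected_Ico fun _ hx => (h.avoids_left hx).mono hj).2

lemma tendsto_left (h : f.IsRenormalizationWith g l r p q) :
    Tendsto f.toFun^[l] (𝓝[<] f.c) (𝓝 g.b) := by
  have h1 := g.tendsto_left
  rw [h.c_eq] at h1
  refine h1.congr' ?_
  filter_upwards [Ioo_mem_nhdsLT (h.c_eq ▸ g.a_lt_c : g.a < f.c)] with x hx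
  exact h.left x ⟨hx.1.le, h.c_eq ▸ hx.2⟩

lemma iterate_left_mem (h : f.IsRenormalizationWith g l r p q) {x : ℝ} (hx : x ∈ Ioo p f.c) :
    f.toFun^[l] x ∈ Ioo p g.b := by
  have hm := h.strictMonoOn_left le_rfl
  refine ⟨?_, ?_⟩
  · have := hm ⟨le_rfl, h.p_lt_c⟩ ⟨hx.1.le, hx.2⟩ hx.1
    rwa [h.left_periodic] at this
  · exact lt_of_strictMonoOn_of_tendsto hm h.tendsto_left ⟨hx.1.le, hx.2⟩

lemma lt_iterate_left (hf : f.IsExpanding) (h : f.IsRenormalizationWith g l r p q) {x : ℝ}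
    (hx : x ∈ Ioo p f.c) : x < f.toFun^[l] x :=
  hf.lt_iterate h.one_lt_l.le (fun _ hx => h.avoids_left hx) h.left_periodic h.tendsto_left
    (h.c_eq ▸ g.c_lt_b) hx

/-- The orbit of a point to the left of `c` leaves the critical interval until time `l`. -/
lemma first_return_left (hf : f.IsExpanding) (h : f.IsRenormalizationWith g l r p q) {x : ℝ}
    (hx : x ∈ Ico p f.c) {j : ℕ} (h0 : 0 < j) (hj : j < l) : f.toFun^[j] x ∉ Ioo p q := by
  intro hmem
  have hm := h.strictMonoOn_left hj.le
  have hcont := h.continuousOn_left hj.le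
  -- Otherwise monotonicity puts the image of p itself into (p, q), which the orbit of p avoids.
  have hp : f.toFun^[j] p ≤ p := by
    by_contra! hlt
    exact h.iterate_p_notMem j
      ⟨hlt, (hm.monotoneOn ⟨le_rfl, h.p_lt_c⟩ hx hx.1).trans_lt hmem.2⟩
  obtain ⟨z, hz, hzp⟩ := intermediate_value_Icc hx.1
    (hcont.mono fun z hz => ⟨hz.1, hz.2.trans_lt hx.2⟩) ⟨hp, hmem.1.le⟩
  have hzc : z < f.c := hz.2.trans_lt hx.2
  rcases eq_or_lt_of_le hz.1 with rfl | hlt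
  -- If p is already fixed at time j, then (p, c) is mapped into itself, because its image cannot
  -- cover `c` before time l.
  · refine hf.not_mapsTo h.p_lt_c h0
      (fun y hy => (h.avoids_left ⟨hy.1.le, hy.2⟩).mono hj.le) fun y hy => ⟨?_, ?_⟩
    · have := hm ⟨le_rfl, h.p_lt_c⟩ ⟨hy.1.le, hy.2⟩ hy.1
      rwa [hzp] at this
    · by_contra! hle
      obtain ⟨w, hw, hwc⟩ := intermediate_value_Icc hy.1.le
        (hcont.mono fun z hz => ⟨hz.1, hz.2.trans_lt hy.2⟩) ⟨hzp.le.trans h.p_lt_c.le, hle⟩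
      exact (h.avoids_left ⟨hw.1, hw.2.trans_lt hy.2⟩).2 j hj hwc
  -- If z > p is sent to p at time j, its image at time l lies both in the orbit of p and in (p, q).
  · have h1 := h.iterate_left_mem ⟨hlt, hzc⟩
    rw [show l = (l - j) + j by omega, Function.iterate_add_apply, hzp] at h1
    exact h.iterate_p_notMem _ ⟨h1.1, h1.2.trans_le h.right_mem.1⟩

lemma iterate_q_notMem (h : f.IsRenormalizationWith g l r p q) (n : ℕ) :
    f.toFun^[n] q ∉ Ioo p q := by
  simpa [reflect_iterate, and_comm] using h.reflect.iterate_p_notMem n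

lemma avoids_right (h : f.IsRenormalizationWith g l r p q) {x : ℝ} (hx : x ∈ Ioc f.c q) :
    f.Avoids r x := by
  have := h.reflect.avoids_left (x := -x) ⟨neg_le_neg hx.2, neg_lt_neg hx.1⟩
  simpa [reflect_avoids] using this

lemma iterate_right_mem (h : f.IsRenormalizationWith g l r p q) {x : ℝ} (hx : x ∈ Ioo f.c q) :
    f.toFun^[r] x ∈ Ioo g.a q := by
  have := h.reflect.iterate_left_mem (x := -x) ⟨neg_lt_neg hx.2, neg_lt_neg hx.1⟩
  simpa [reflect_iterate, and_comm] using this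

lemma iterate_right_lt (hf : f.IsExpanding) (h : f.IsRenormalizationWith g l r p q) {x : ℝ}
    (hx : x ∈ Ioo f.c q) : f.toFun^[r] x < x := by
  have := h.reflect.lt_iterate_left hf.reflect (x := -x) ⟨neg_lt_neg hx.2, neg_lt_neg hx.1⟩
  simpa [reflect_iterate] using this

lemma first_return_right (hf : f.IsExpanding) (h : f.IsRenormalizationWith g l r p q) {x : ℝ}
    (hx : x ∈ Ioc f.c q) {j : ℕ} (h0 : 0 < j) (hj : j < r) : f.toFun^[j] x ∉ Ioo p q := by
  have := h.reflect.first_return_left hf.reflect (x := -x)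
    ⟨neg_le_neg hx.2, neg_lt_neg hx.1⟩ h0 hj
  simpa [reflect_iterate, and_comm] using this

end IsRenormalizationWith

/-! ### First return maps -/

lemma exists_Ioo_subset {x : ℝ} (hx : x ∈ f.I) {U : Set ℝ} (hU : U ∈ 𝓝 x) :
    ∃ s t, s < t ∧ Ioo s t ⊆ U ∧ Ioo s t ⊆ Ioo f.a f.b := by
  obtain ⟨s, t, hxst, hsub⟩ := mem_nhds_iff_exists_Ioo_subset.1 hU
  refine ⟨max s f.a, min t f.b, ?_, fun y hy => hsub ⟨(le_max_left _ _).trans_lt hy.1,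
    hy.2.trans_le (min_le_left _ _)⟩, fun y hy => ⟨(le_max_right _ _).trans_lt hy.1,
    hy.2.trans_le (min_le_right _ _)⟩⟩
  exact max_lt (lt_min (hxst.1.trans hxst.2) (hxst.1.trans_le hx.2))
    (lt_min (hx.1.trans_lt hxst.2) f.a_lt_b)

/-- The orbit of `f.b` is the left-sided limit of orbits at `c`, shifted by one step. -/
lemma tendsto_iterate_left {k : ℕ} (h : f.Avoids k f.b) :
    Tendsto f.toFun^[k + 1] (𝓝[<] f.c) (𝓝 (f.toFun^[k] f.b)) := by
  have h1 : Tendsto f.toFun (𝓝[<] f.c) (𝓝[f.I] f.b) := by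
    refine tendsto_nhdsWithin_iff.2 ⟨f.tendsto_left, ?_⟩
    filter_upwards [Ioo_mem_nhdsLT f.a_lt_c] with x hx
    exact f.mapsTo x ⟨hx.1.le, hx.2.le.trans f.c_lt_b.le⟩ hx.2.ne
  exact h.continuousWithinAt.tendsto.comp h1

/-- `g` is the first return map of `f`, with return times `l` and `r`, of the points of
`g.I` to an interval `(p, q)` containing `g.I`. -/
structure Induced (f g : LorenzMap) (l r : ℕ) (p q : ℝ) : Prop where
  one_le_l : 1 ≤ l
  one_le_r : 1 ≤ r
  c_eq : g.c = f.c
  subset : g.I ⊆ f.I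
  p_lt : p < g.a
  lt_q : g.b < q
  left : ∀ x ∈ Ico g.a f.c, f.Avoids l x ∧ g.toFun x = f.toFun^[l] x
  right : ∀ x ∈ Ioc f.c g.b, f.Avoids r x ∧ g.toFun x = f.toFun^[r] x
  return_left : ∀ x ∈ Ico g.a f.c, ∀ j, 0 < j → j < l → f.toFun^[j] x ∉ Ioo p q
  return_right : ∀ x ∈ Ioc f.c g.b, ∀ j, 0 < j → j < r → f.toFun^[j] x ∉ Ioo p q

/-- This is level zero of a tower. The interval is enlarged by 1 on each side only to make the
inclusion of `f.I` strict. -/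
lemma Induced.refl (f : LorenzMap) : f.Induced f 1 1 (f.a - 1) (f.b + 1) where
  one_le_l := le_rfl
  one_le_r := le_rfl
  c_eq := rfl
  subset := Subset.rfl
  p_lt := by linarith
  lt_q := by linarith
  left x hx := by
    have hI : x ∈ f.I := ⟨hx.1, hx.2.le.trans f.c_lt_b.le⟩
    exact ⟨avoids_succ.2 ⟨avoids_zero hI, hx.2.ne⟩, rfl⟩
  right x hx := by
    have hI : x ∈ f.I := ⟨f.a_lt_c.le.trans hx.1.le, hx.2⟩
    exact ⟨avoids_succ.2 ⟨avoids_zero hI, hx.1.ne'⟩, rfl⟩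
  return_left x _ j h0 hj := by omega
  return_right x _ j h0 hj := by omega

namespace Induced

variable {l r : ℕ} {p q : ℝ}

lemma reflect (h : f.Induced g l r p q) : f.reflect.Induced g.reflect r l (-q) (-p) where
  one_le_l := h.one_le_r
  one_le_r := h.one_le_l
  c_eq := by simp [h.c_eq]
  subset x hx := mem_reflect_I.2 (h.subset (mem_reflect_I.1 hx))
  p_lt := neg_lt_neg h.lt_q
  lt_q := neg_lt_neg h.p_lt
  left x hx := by
    obtain ⟨h1, h2⟩ := h.right (-x) ⟨by linarith [hx.2, f.reflect_c], by linarith [hx.1, g.reflect_a]⟩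
    exact ⟨reflect_avoids.2 h1, by rw [reflect_iterate, reflect_toFun, h2]⟩
  right x hx := by
    obtain ⟨h1, h2⟩ := h.left (-x) ⟨by linarith [hx.2, g.reflect_b], by linarith [hx.1, f.reflect_c]⟩
    exact ⟨reflect_avoids.2 h1, by rw [reflect_iterate, reflect_toFun, h2]⟩
  return_left x hx j h0 hj hmem := by
    refine h.return_right (-x) ⟨by linarith [hx.2, f.reflect_c], by linarith [hx.1, g.reflect_a]⟩
      j h0 hj ?_
    rw [reflect_iterate] at hmem
    exact ⟨by linarith [hmem.2], by linarith [hmem.1]⟩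
  return_right x hx j h0 hj hmem := by
    refine h.return_left (-x) ⟨by linarith [hx.2, g.reflect_b], by linarith [hx.1, f.reflect_c]⟩
      j h0 hj ?_
    rw [reflect_iterate] at hmem
    exact ⟨by linarith [hmem.2], by linarith [hmem.1]⟩

lemma a_lt_c (h : f.Induced g l r p q) : g.a < f.c := h.c_eq ▸ g.a_lt_c

lemma c_lt_b (h : f.Induced g l r p q) : f.c < g.b := h.c_eq ▸ g.c_lt_b

lemma I_subset (h : f.Induced g l r p q) : g.I ⊆ Ioo p q :=
  fun _ hx => ⟨h.p_lt.trans_le hx.1, hx.2.trans_lt h.lt_q⟩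

lemma c_mem (h : f.Induced g l r p q) : f.c ∈ g.I := h.c_eq ▸ g.c_mem

/-- The interval (p, q) is open: if the k-th iterate of `f.b` were in it, so would be the (k+1)-st
iterates of points just left of `c`, before their return time. As `c` lies in (p, q), this also
yields avoidance of `c` one step later. -/
lemma avoids_b_and_notMem (h : f.Induced g l r p q) (k : ℕ) (hk : k < l) :
    f.Avoids k f.b ∧ (k + 1 < l → f.toFun^[k] f.b ∉ Ioo p q) := by
  induction k with
  | zero =>
    refine ⟨avoids_zero f.b_mem, fun h1 hmem => ?_⟩
    obtain ⟨x, hx, hx'⟩ := (((tendsto_iterate_left (avoids_zero f.b_mem)).eventually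
      (isOpen_Ioo.mem_nhds hmem)).and (Ioo_mem_nhdsLT h.a_lt_c)).exists
    exact h.return_left x ⟨hx'.1.le, hx'.2⟩ 1 one_pos h1 hx
  | succ k ih =>
    obtain ⟨ha, hn⟩ := ih (by omega)
    have ha' : f.Avoids (k + 1) f.b :=
      avoids_succ.2 ⟨ha, fun hc => hn hk (hc ▸ h.I_subset h.c_mem)⟩
    refine ⟨ha', fun h1 hmem => ?_⟩
    obtain ⟨x, hx, hx'⟩ := (((tendsto_iterate_left ha').eventually
      (isOpen_Ioo.mem_nhds hmem)).and (Ioo_mem_nhdsLT h.a_lt_c)).exists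
    exact h.return_left x ⟨hx'.1.le, hx'.2⟩ _ (Nat.succ_pos _) h1 hx

lemma avoids_b (h : f.Induced g l r p q) {k : ℕ} (hk : k < l) : f.Avoids k f.b :=
  (h.avoids_b_and_notMem k hk).1

lemma iterate_b_notMem (h : f.Induced g l r p q) {k : ℕ} (hk : k + 1 < l) :
    f.toFun^[k] f.b ∉ Ioo p q :=
  (h.avoids_b_and_notMem k (by omega)).2 hk

lemma iterate_b (h : f.Induced g l r p q) : f.toFun^[l - 1] f.b = g.b := by
  have h1 := tendsto_iterate_left (h.avoids_b (k := l - 1) (by have := h.one_le_l; omega))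
  rw [Nat.sub_add_cancel h.one_le_l] at h1
  have h2 := g.tendsto_left
  rw [h.c_eq] at h2
  refine tendsto_nhds_unique h1 (h2.congr' ?_)
  filter_upwards [Ioo_mem_nhdsLT h.a_lt_c] with x hx
  exact (h.left x ⟨hx.1.le, hx.2⟩).2

lemma avoids_a (h : f.Induced g l r p q) {k : ℕ} (hk : k < r) : f.Avoids k f.a := by
  simpa [reflect_avoids] using h.reflect.avoids_b hk

lemma iterate_a_notMem (h : f.Induced g l r p q) {k : ℕ} (hk : k + 1 < r) :
    f.toFun^[k] f.a ∉ Ioo p q := by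
  simpa [reflect_iterate, and_comm] using h.reflect.iterate_b_notMem hk

lemma iterate_a (h : f.Induced g l r p q) : f.toFun^[r - 1] f.a = g.a := by
  simpa [reflect_iterate] using h.reflect.iterate_b

lemma reach_c_b (h : f.Induced g l r p q) : f.Reach l f.c g.b := by
  have h1 := (h.avoids_b (k := l - 1) (by have := h.one_le_l; omega)).reach
  rw [h.iterate_b] at h1
  have := (reach_one.2 f.step_c_b).trans h1
  rwa [Nat.add_sub_cancel' h.one_le_l] at this

lemma reach_c_a (h : f.Induced g l r p q) : f.Reach r f.c g.a := by
  have h1 := (h.avoids_a (k := r - 1) (by have := h.one_le_r; omega)).reach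
  rw [h.iterate_a] at h1
  have := (reach_one.2 f.step_c_a).trans h1
  rwa [Nat.add_sub_cancel' h.one_le_r] at this

lemma reach_of_step (h : f.Induced g l r p q) {x y : ℝ} (hs : g.Step x y) :
    ∃ k, 1 ≤ k ∧ k ≤ max l r ∧ f.Reach k x y := by
  rcases lt_trichotomy x f.c with hx | rfl | hx
  · obtain ⟨h1, h2⟩ := h.left x ⟨hs.1.1, hx⟩
    rw [hs.eq_of_ne (h.c_eq ▸ hx.ne), h2]
    exact ⟨l, h.one_le_l, le_max_left _ _, h1.reach⟩
  · rw [← h.c_eq] at hs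
    rcases hs.of_c with rfl | rfl
    · exact ⟨r, h.one_le_r, le_max_right _ _, h.c_eq ▸ h.reach_c_a⟩
    · exact ⟨l, h.one_le_l, le_max_left _ _, h.c_eq ▸ h.reach_c_b⟩
  · obtain ⟨h1, h2⟩ := h.right x ⟨hx, hs.1.2⟩
    rw [hs.eq_of_ne (h.c_eq ▸ hx.ne'), h2]
    exact ⟨r, h.one_le_r, le_max_right _ _, h1.reach⟩

lemma reach_of_reach (h : f.Induced g l r p q) {n : ℕ} {x y : ℝ} (hr : g.Reach n x y) :
    ∃ k, n ≤ k ∧ k ≤ n * max l r ∧ f.Reach k x y := by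
  induction n generalizing x with
  | zero => exact ⟨0, le_rfl, by simp, hr⟩
  | succ n ih =>
    obtain ⟨z, hz, hr⟩ := hr
    obtain ⟨k, hk1, hk2, hk⟩ := h.reach_of_step hz
    obtain ⟨m, hm1, hm2, hm⟩ := ih hr
    exact ⟨k + m, by omega, by rw [Nat.succ_mul]; omega, hk.trans hm⟩

/-- Either the itinerary stops before the first return, hence outside (p, q) unless n = 0, or it
contains a complete step of `g`. At `c` the return times are counted along the orbits of `f.a` and
`f.b`, which start one step late. -/
lemma excursion (h : f.Induced g l r p q) {n : ℕ} {x y : ℝ} (hx : x ∈ g.I)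
    (hr : f.Reach n x y) : (n < max l r ∧ (0 < n → y ∉ Ioo p q)) ∨
      ∃ z, g.Step x z ∧ ∃ m < n, f.Reach m z y := by
  have hl := h.one_le_l
  have hr1 := h.one_le_r
  rcases lt_trichotomy x f.c with hxc | rfl | hxc
  · obtain ⟨h1, h2⟩ := h.left x ⟨hx.1, hxc⟩
    rcases lt_or_ge n l with hn | hn
    · refine Or.inl ⟨by omega, fun h0 => ?_⟩
      rw [(h1.mono hn.le).reach_iff.1 hr]
      exact h.return_left x ⟨hx.1, hxc⟩ n h0 hn
    · refine Or.inr ⟨_, step_of_ne hx (h.c_eq ▸ hxc.ne), n - l, by omega, ?_⟩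
      rw [show n = l + (n - l) by omega, reach_add] at hr
      obtain ⟨z, hz, hr⟩ := hr
      rwa [h2, ← h1.reach_iff.1 hz]
  · cases n with
    | zero => exact Or.inl ⟨by omega, fun h0 => absurd h0 (lt_irrefl 0)⟩
    | succ n =>
      obtain ⟨w, hw, hr⟩ := hr
      rcases hw.of_c with rfl | rfl
      · rcases lt_or_ge (n + 1) r with hn | hn
        · refine Or.inl ⟨by omega, fun _ => ?_⟩
          rw [(h.avoids_a (k := n) (by omega)).reach_iff.1 hr]
          exact h.iterate_a_notMem hn
        · refine Or.inr ⟨g.a, h.c_eq ▸ g.step_c_a, n - (r - 1), by omega, ?_⟩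
          rw [show n = (r - 1) + (n - (r - 1)) by omega, reach_add] at hr
          obtain ⟨z, hz, hr⟩ := hr
          rwa [← h.iterate_a, ← (h.avoids_a (k := r - 1) (by omega)).reach_iff.1 hz]
      · rcases lt_or_ge (n + 1) l with hn | hn
        · refine Or.inl ⟨by omega, fun _ => ?_⟩
          rw [(h.avoids_b (k := n) (by omega)).reach_iff.1 hr]
          exact h.iterate_b_notMem hn
        · refine Or.inr ⟨g.b, h.c_eq ▸ g.step_c_b, n - (l - 1), by omega, ?_⟩
          rw [show n = (l - 1) + (n - (l - 1)) by omega, reach_add] at hr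
          obtain ⟨z, hz, hr⟩ := hr
          rwa [← h.iterate_b, ← (h.avoids_b (k := l - 1) (by omega)).reach_iff.1 hz]
  · obtain ⟨h1, h2⟩ := h.right x ⟨hxc, hx.2⟩
    rcases lt_or_ge n r with hn | hn
    · refine Or.inl ⟨by omega, fun h0 => ?_⟩
      rw [(h1.mono hn.le).reach_iff.1 hr]
      exact h.return_right x ⟨hxc, hx.2⟩ n h0 hn
    · refine Or.inr ⟨_, step_of_ne hx (h.c_eq ▸ hxc.ne'), n - r, by omega, ?_⟩
      rw [show n = r + (n - r) by omega, reach_add] at hr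
      obtain ⟨z, hz, hr⟩ := hr
      rwa [h2, ← h1.reach_iff.1 hz]

/-- An itinerary of `f` starting in `g.I` follows `g`, up to a last incomplete excursion. -/
lemma decompose (h : f.Induced g l r p q) {n : ℕ} {x y : ℝ} (hx : x ∈ g.I)
    (hr : f.Reach n x y) : ∃ k z j, g.Reach k x z ∧ f.Reach j z y ∧ j < max l r ∧
      (y ∈ Ioo p q → j = 0) ∧ (k = 0 → j = n) := by
  induction n using Nat.strong_induction_on generalizing x with
  | _ n ih =>
    rcases h.excursion hx hr with ⟨h1, h2⟩ | ⟨z, hz, m, hm, hr'⟩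
    · refine ⟨0, x, n, rfl, hr, h1, fun hy => ?_, fun _ => rfl⟩
      by_contra h0
      exact h2 (Nat.pos_of_ne_zero h0) hy
    · obtain ⟨k, w, j, h1, h2, h3, h4, -⟩ := ih m hm hz.mem hr'
      exact ⟨k + 1, w, j, ⟨z, hz, h1⟩, h2, h3, h4, fun h0 => absurd h0 k.succ_ne_zero⟩

lemma reach_return (h : f.Induced g l r p q) {n : ℕ} {x y : ℝ} (hx : x ∈ g.I)
    (hy : y ∈ Ioo p q) (hr : f.Reach n x y) : ∃ k, g.Reach k x y ∧ (k = 0 → n = 0) := by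
  obtain ⟨k, z, j, h1, h2, -, h4, h5⟩ := h.decompose hx hr
  obtain rfl := h4 hy
  obtain rfl : z = y := h2
  exact ⟨k, h1, fun hk => (h5 hk).symm⟩

lemma expanding (hf : f.IsExpanding) (h : f.Induced g l r p q) : g.IsExpanding := by
  intro x hx
  rw [mem_closure_iff]
  intro U hU hxU
  obtain ⟨s, t, hst, hsub, hsub'⟩ := exists_Ioo_subset hx (hU.mem_nhds hxU)
  have hI : Ioo s t ⊆ g.I := fun y hy => Ioo_subset_Icc_self (hsub' hy)
  obtain ⟨n, y, hy, hr⟩ := hf.exists_reach hst fun y hy => h.subset (hI hy)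
  obtain ⟨k, hk, -⟩ := h.reach_return (hI hy) (h.I_subset h.c_mem) hr
  exact ⟨y, hsub hy, mem_iUnion.2 ⟨k, mem_preimage_iterate.2 ⟨g.c, rfl, h.c_eq ▸ hk⟩⟩⟩

/-- While an interval avoids the discontinuity of `g`, each of its images lies on one side of it, so
the same return time applies to all its points. -/
lemma exists_iterate_eq (h : f.Induced g l r p q) {J : Set ℝ} (hJ : J.OrdConnected) {n : ℕ}
    (ha : ∀ x ∈ J, g.Avoids n x) :
    ∃ N ≥ n, ∀ x ∈ J, f.Avoids N x ∧ g.toFun^[n] x = f.toFun^[N] x := by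
  induction n with
  | zero => exact ⟨0, le_rfl, fun x hx => ⟨avoids_zero (h.subset (ha x hx).1), rfl⟩⟩
  | succ n ih =>
    obtain ⟨N, hN, hx⟩ := ih fun x hx => (ha x hx).mono n.le_succ
    have hcont := (branch hJ fun x hx => (ha x hx).mono n.le_succ).2
    have hoc : (g.toFun^[n] '' J).OrdConnected := (hJ.isPreconnected.image _ hcont).ordConnected
    have hI : g.toFun^[n] '' J ⊆ g.I := by
      rintro _ ⟨x, hx, rfl⟩
      exact ((ha x hx).mono n.le_succ).iterate_mem
    have hc : g.c ∉ g.toFun^[n] '' J := by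
      rintro ⟨x, hx, hxc⟩
      exact (ha x hx).2 n n.lt_succ_self hxc
    have key : ∀ m, 1 ≤ m → (∀ y ∈ g.toFun^[n] '' J, f.Avoids m y ∧ g.toFun y = f.toFun^[m] y) →
        ∃ N ≥ n + 1, ∀ x ∈ J, f.Avoids N x ∧ g.toFun^[n + 1] x = f.toFun^[N] x := by
      intro m hm hy
      refine ⟨N + m, by omega, fun x hxJ => ?_⟩
      obtain ⟨h1, h2⟩ := hx x hxJ
      obtain ⟨h3, h4⟩ := hy _ ⟨x, hxJ, rfl⟩
      refine ⟨avoids_add.2 ⟨h1, h2 ▸ h3⟩, ?_⟩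
      rw [Function.iterate_succ_apply', h4, h2, ← Function.iterate_add_apply, add_comm]
    rcases subset_side hoc hI hc with hs | hs
    · exact key l h.one_le_l fun y hy => h.left y ⟨(hs hy).1, h.c_eq ▸ (hs hy).2⟩
    · exact key r h.one_le_r fun y hy => h.right y ⟨h.c_eq ▸ (hs hy).1, (hs hy).2⟩

end Induced

/-! ### Renormalizations without fixed end points -/

/-- A renormalization whose interval is compactly contained in the critical interval. -/
structure IsStrictRenormalization (f g : LorenzMap) (l r : ℕ) (p q : ℝ) : Prop extends
    IsRenormalizationWith f g l r p q where
  p_lt : p < g.a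
  lt_q : g.b < q

/-- An end point shared with the critical interval is periodic with the return time as a period,
hence fixed by `g`. -/
lemma IsRenormalizationWith.strict {l r : ℕ} {p q : ℝ} (h : f.IsRenormalizationWith g l r p q)
    (ha : g.toFun g.a ≠ g.a) (hb : g.toFun g.b ≠ g.b) : f.IsStrictRenormalization g l r p q := by
  refine ⟨h, lt_of_le_of_ne h.left_mem.2 ?_, lt_of_le_of_ne h.right_mem.1 ?_⟩
  · rintro rfl
    exact ha ((h.left _ ⟨le_rfl, g.a_lt_c⟩).trans h.left_periodic)
  · rintro rfl
    exact hb ((h.right _ ⟨g.c_lt_b, le_rfl⟩).trans h.right_periodic)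

lemma NoFixedEndpoint.strict (hnd : f.NoFixedEndpoint) {l r : ℕ} {p q : ℝ}
    (h : f.IsRenormalizationWith g l r p q) : f.IsStrictRenormalization g l r p q :=
  h.strict (hnd g ⟨l, r, p, q, h⟩).1 (hnd g ⟨l, r, p, q, h⟩).2

namespace IsStrictRenormalization

variable {l r : ℕ} {p q : ℝ}

lemma reflect (h : f.IsStrictRenormalization g l r p q) :
    f.reflect.IsStrictRenormalization g.reflect r l (-q) (-p) :=
  ⟨h.toIsRenormalizationWith.reflect, neg_lt_neg h.lt_q, neg_lt_neg h.p_lt⟩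

lemma induced (hf : f.IsExpanding) (h : f.IsStrictRenormalization g l r p q) :
    f.Induced g l r p q where
  one_le_l := h.one_lt_l.le
  one_le_r := h.one_lt_r.le
  c_eq := h.c_eq
  subset := h.proper.1
  p_lt := h.p_lt
  lt_q := h.lt_q
  left _ hx := ⟨h.avoids_left ⟨h.left_mem.2.trans hx.1, hx.2⟩, h.left _ ⟨hx.1, h.c_eq ▸ hx.2⟩⟩
  right _ hx := ⟨h.avoids_right ⟨hx.1, hx.2.trans h.right_mem.1⟩,
    h.right _ ⟨h.c_eq ▸ hx.1, hx.2⟩⟩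
  return_left _ hx _ h0 hj :=
    h.toIsRenormalizationWith.first_return_left hf ⟨h.left_mem.2.trans hx.1, hx.2⟩ h0 hj
  return_right _ hx _ h0 hj :=
    h.toIsRenormalizationWith.first_return_right hf ⟨hx.1, hx.2.trans h.right_mem.1⟩ h0 hj

end IsStrictRenormalization

/-- A renormalization of a renormalization is a renormalization. -/
lemma IsStrictRenormalization.comp {h : LorenzMap} {l r L R : ℕ} {p q P Q : ℝ}
    (hf : f.IsExpanding) (hg : f.IsStrictRenormalization g l r p q)
    (hh : g.IsRenormalizationWith h L R P Q) :
    ∃ l' r', f.IsRenormalizationWith h l' r' P Q := by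
  have hi := hg.induced hf
  have hce : g.c = f.c := hg.c_eq
  obtain ⟨l', hl', hL⟩ := hi.exists_iterate_eq ordConnected_Ico fun x hx => hh.avoids_left hx
  obtain ⟨r', hr', hR⟩ := hi.exists_iterate_eq ordConnected_Ioc fun x hx => hh.avoids_right hx
  have hPQ : Ioo P Q ⊆ Ioo p q := fun x hx =>
    ⟨hg.p_lt.trans (hh.left_mem.1.trans_lt hx.1), (hx.2.trans_le hh.right_mem.2).trans hg.lt_q⟩
  -- A visit to (P, Q) is a return to (p, q), so the orbit under `g` sees it too.
  have horb : ∀ x ∈ g.I, Disjoint (g.orb {x}) (Ioo P Q) → Disjoint (f.orb {x}) (Ioo P Q) := by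
    intro x hx hd
    refine disjoint_left.2 fun y hy hy' => ?_
    obtain ⟨_, rfl, n, hr⟩ := mem_orb.1 hy
    obtain ⟨k, hk, -⟩ := hi.reach_return hx (hPQ hy') hr
    exact disjoint_left.1 hd (mem_orb.2 ⟨_, rfl, k, hk⟩) hy'
  have hPc : P < g.c := hh.p_lt_c
  have hcQ : g.c < Q := hh.c_lt_q
  refine ⟨l', r', hh.one_lt_l.trans_le hl', hh.one_lt_r.trans_le hr', hh.c_eq.trans hce,
    hh.proper.trans_subset hg.proper.1, ?_, ?_, ⟨hg.left_mem.1.trans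
      (hg.left_mem.2.trans hh.left_mem.1), hh.left_mem.2⟩, ⟨hh.right_mem.1, hh.right_mem.2.trans
      (hg.right_mem.1.trans hg.right_mem.2)⟩, ?_, ?_, horb P hh.p_mem hh.left_orb,
      horb Q hh.q_mem hh.right_orb, ?_, ?_⟩
  · intro x hx
    rw [hh.left x hx]
    exact (hL x ⟨hh.left_mem.2.trans hx.1, hh.c_eq ▸ hx.2⟩).2
  · intro x hx
    rw [hh.right x hx]
    exact (hR x ⟨hh.c_eq ▸ hx.1, hx.2.trans hh.right_mem.1⟩).2
  · rw [← (hL P ⟨le_rfl, hPc⟩).2, hh.left_periodic]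
  · rw [← (hR Q ⟨hcQ, le_rfl⟩).2, hh.right_periodic]
  · obtain ⟨-, x, hx, hxc⟩ := (isFirstHit_iff hh.Ioo_left_subset).1 hh.left_hit
    rw [← hce]
    refine (isFirstHit_iff fun y hy => hi.subset (hh.Ioo_left_subset hy)).2
      ⟨fun y hy => (hL y ⟨hy.1.le, hy.2⟩).1, x, hx, ?_⟩
    rw [← (hL x ⟨hx.1.le, hx.2⟩).2, hxc, hce]
  · obtain ⟨-, x, hx, hxc⟩ := (isFirstHit_iff hh.Ioo_right_subset).1 hh.right_hit
    rw [← hce]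
    refine (isFirstHit_iff fun y hy => hi.subset (hh.Ioo_right_subset hy)).2
      ⟨fun y hy => (hR y ⟨hy.1, hy.2.le⟩).1, x, hx, ?_⟩
    rw [← (hR x ⟨hx.1, hx.2.le⟩).2, hxc, hce]

/-! ### Comparison of critical intervals -/

namespace IsRenormalizationWith

variable {g' : LorenzMap} {l r l' r' : ℕ} {p q p' q' : ℝ}

/-- The right branch f^r moves points of (c, q) to the left, so it does not fix q', and r' ≠ r. Nor
is r' < r, because (c, q') hits `c` at time r' while points of (c, q] avoid it before time r. The
image of q' lies in (g.a, q') but outside (p', q'), hence not to the right of p'. -/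
lemma lt_of_q_lt (hf : f.IsExpanding) (h : f.IsRenormalizationWith g l r p q)
    (h' : f.IsRenormalizationWith g' l' r' p' q') (hq : q' < q) : g.a < p' ∧ r < r' := by
  have hq' : q' ∈ Ioo f.c q := ⟨h'.c_lt_q, hq⟩
  have hlt := h.iterate_right_lt hf hq'
  have hrr : r < r' := by
    rcases lt_trichotomy r r' with h1 | rfl | h1
    · exact h1
    · exact absurd h'.right_periodic hlt.ne
    · obtain ⟨-, x, hx, hxc⟩ := (isFirstHit_iff h'.Ioo_right_subset).1 h'.right_hit
      exact absurd hxc ((h.avoids_right ⟨hx.1, hx.2.le.trans hq.le⟩).2 r' h1)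
  refine ⟨?_, hrr⟩
  by_contra! hle
  exact h'.iterate_q_notMem r ⟨hle.trans_lt (h.iterate_right_mem hq').1, hlt⟩

lemma lt_of_lt_p (hf : f.IsExpanding) (h : f.IsRenormalizationWith g l r p q)
    (h' : f.IsRenormalizationWith g' l' r' p' q') (hp : p < p') : q' < g.b ∧ l < l' := by
  have := h.reflect.lt_of_q_lt hf.reflect h'.reflect (neg_lt_neg hp)
  exact ⟨neg_lt_neg_iff.1 this.1, this.2⟩

/-- Two critical intervals are equal or strictly nested. -/
lemma trichotomy (hf : f.IsExpanding) (h : f.IsRenormalizationWith g l r p q)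
    (h' : f.IsRenormalizationWith g' l' r' p' q') :
    (p = p' ∧ q = q') ∨ (g.a < p' ∧ q' < g.b ∧ l < l' ∧ r < r') ∨
      (g'.a < p ∧ q < g'.b ∧ l' < l ∧ r' < r) := by
  rcases lt_trichotomy q q' with hq | hq | hq
  · obtain ⟨h1, h2⟩ := h'.lt_of_q_lt hf h hq
    obtain ⟨h3, h4⟩ := h'.lt_of_lt_p hf h (h'.left_mem.2.trans_lt h1)
    exact Or.inr (Or.inr ⟨h1, h3, h4, h2⟩)
  · rcases lt_trichotomy p p' with hp | hp | hp
    · have := (h.lt_of_lt_p hf h' hp).1.trans_le h.right_mem.1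
      exact absurd hq this.ne'
    · exact Or.inl ⟨hp, hq⟩
    · have := (h'.lt_of_lt_p hf h hp).1.trans_le h'.right_mem.1
      exact absurd hq this.ne
  · obtain ⟨h1, h2⟩ := h.lt_of_q_lt hf h' hq
    obtain ⟨h3, h4⟩ := h.lt_of_lt_p hf h' (h.left_mem.2.trans_lt h1)
    exact Or.inr (Or.inl ⟨h1, h3, h4, h2⟩)

lemma unique (hf : f.IsExpanding) (h : f.IsRenormalizationWith g l r p q)
    (h' : f.IsRenormalizationWith g l' r' p' q') : p = p' ∧ q = q' := by
  rcases h.trichotomy hf h' with h1 | ⟨h1, -⟩ | ⟨h1, -⟩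
  · exact h1
  · exact absurd h'.left_mem.2 h1.not_ge
  · exact absurd h.left_mem.2 h1.not_ge

end IsRenormalizationWith

/-! ### Invariant sets and renormalizations -/

/-- A nonempty closed set in `(a, b) \ {c}` which is forward invariant and contains all preimages
of its points in `(a, b) \ {c}`. -/
structure IsInvariantSet (f : LorenzMap) (K : Set ℝ) : Prop where
  nonempty : K.Nonempty
  isClosed : IsClosed K
  subset : K ⊆ Ioo f.a f.b
  c_notMem : f.c ∉ K
  forward : ∀ x ∈ K, f.toFun x ∈ K
  backward : ∀ x ∈ Ioo f.a f.b, x ≠ f.c → f.toFun x ∈ K → x ∈ K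

/-- Strict monotonicity on an open interval keeps the images off the end points of I, as the
`backward` field of `IsInvariantSet` requires. -/
lemma iterate_mem_Ioo {s t : ℝ} {n : ℕ} (ha : ∀ x ∈ Ioo s t, f.Avoids n x) {x : ℝ}
    (hx : x ∈ Ioo s t) : f.toFun^[n] x ∈ Ioo f.a f.b := by
  have hm := (branch ordConnected_Ioo ha).1
  obtain ⟨y, hy⟩ := exists_between hx.1
  obtain ⟨z, hz⟩ := exists_between hx.2
  have hy' : y ∈ Ioo s t := ⟨hy.1, hy.2.trans hx.2⟩
  have hz' : z ∈ Ioo s t := ⟨hx.1.trans hz.1, hz.2⟩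
  exact ⟨(ha y hy').iterate_mem.1.trans_lt (hm hy' hx hy.2),
    (hm hx hz' hz.1).trans_le (ha z hz').iterate_mem.2⟩

namespace IsInvariantSet

variable {K : Set ℝ}

lemma reflect (h : f.IsInvariantSet K) : f.reflect.IsInvariantSet {x | -x ∈ K} where
  nonempty := by
    obtain ⟨x, hx⟩ := h.nonempty
    exact ⟨-x, by simpa using hx⟩
  isClosed := h.isClosed.preimage continuous_neg
  subset x hx := ⟨by linarith [(h.subset hx).2, f.reflect_a], by linarith [(h.subset hx).1, f.reflect_b]⟩
  c_notMem := by simpa using h.c_notMem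
  forward x hx := by simpa [reflect_toFun] using h.forward _ hx
  backward x hx hc hm := by
    refine h.backward _ ⟨by linarith [hx.2, f.reflect_b], by linarith [hx.1, f.reflect_a]⟩
      (fun hxc => hc (by simp [← hxc])) (by simpa [reflect_toFun] using hm)

lemma subset_I (h : f.IsInvariantSet K) : K ⊆ f.I := h.subset.trans Ioo_subset_Icc_self

lemma isCompact (h : f.IsInvariantSet K) : IsCompact K :=
  isCompact_Icc.of_isClosed_subset h.isClosed h.subset_I

lemma iterate_mem (h : f.IsInvariantSet K) {x : ℝ} (hx : x ∈ K) (n : ℕ) :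
    f.toFun^[n] x ∈ K := by
  induction n with
  | zero => exact hx
  | succ n ih =>
    rw [Function.iterate_succ_apply']
    exact h.forward _ ih

lemma ne_c (h : f.IsInvariantSet K) {x : ℝ} (hx : x ∈ K) : x ≠ f.c :=
  fun hc => h.c_notMem (hc ▸ hx)

lemma avoids (h : f.IsInvariantSet K) {x : ℝ} (hx : x ∈ K) (n : ℕ) : f.Avoids n x :=
  ⟨h.subset_I hx, fun j _ => h.ne_c (h.iterate_mem hx j)⟩

lemma mem_of_reach (h : f.IsInvariantSet K) {x y : ℝ} {n : ℕ} (hr : f.Reach n x y) (hx : x ∈ K) :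
    y ∈ K := by
  rw [(h.avoids hx n).reach_iff.1 hr]
  exact h.iterate_mem hx n

lemma iterate_notMem (h : f.IsInvariantSet K) {s t : ℝ} {n : ℕ} (ha : ∀ x ∈ Ioo s t, f.Avoids n x)
    (hd : Disjoint (Ioo s t) K) {x : ℝ} (hx : x ∈ Ioo s t) : f.toFun^[n] x ∉ K := by
  induction n with
  | zero => exact disjoint_left.1 hd hx
  | succ n ih =>
    have ha' : ∀ x ∈ Ioo s t, f.Avoids n x := fun x hx => (ha x hx).mono n.le_succ
    intro hmem
    rw [Function.iterate_succ_apply'] at hmem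
    exact ih ha' (h.backward _ (iterate_mem_Ioo ha' hx) ((ha x hx).2 n n.lt_succ_self) hmem)

/-- If K were on the right of `c`, the increasing right branch would map the interval between the
least and greatest points of K into itself; if these coincide, it maps the interval from that point
to b into itself. -/
lemma exists_lt_c (hf : f.IsExpanding) (h : f.IsInvariantSet K) : ∃ x ∈ K, x < f.c := by
  by_contra! hcon
  have hside : K ⊆ Ioc f.c f.b := fun x hx =>
    ⟨lt_of_le_of_ne (hcon x hx) (h.ne_c hx).symm, (h.subset hx).2.le⟩
  obtain ⟨m, hm, hmin⟩ := h.isCompact.exists_isLeast h.nonempty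
  obtain ⟨M, hM, hmax⟩ := h.isCompact.exists_isGreatest h.nonempty
  have hmono := f.strictMonoOn_right
  have hcm := (hside hm).1
  have hMb := (h.subset hM).2
  have hTm : m ≤ f.toFun m := hmin (h.forward m hm)
  have hTM : f.toFun M ≤ M := hmax (h.forward M hM)
  have hmM : m = M := by
    refine eq_of_le_of_not_lt (hmax hm) fun hlt => ?_
    refine hf.not_mapsTo hlt le_rfl (fun x hx => ?_) fun x hx => ?_
    · exact avoids_succ.2 ⟨avoids_zero ⟨(f.a_lt_c.trans (hcm.trans hx.1)).le,
        (hx.2.trans hMb).le⟩, (hcm.trans hx.1).ne'⟩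
    · have hx' : x ∈ Ioc f.c f.b := ⟨hcm.trans hx.1, (hx.2.trans hMb).le⟩
      exact ⟨hTm.trans_lt (hmono (hside hm) hx' hx.1), (hmono hx' (hside hM) hx.2).trans_le hTM⟩
  subst hmM
  refine hf.not_mapsTo hMb le_rfl (fun x hx => ?_) fun x hx => ?_
  · exact avoids_succ.2 ⟨avoids_zero ⟨(f.a_lt_c.trans (hcm.trans hx.1)).le, hx.2.le⟩,
      (hcm.trans hx.1).ne'⟩
  · have hx' : x ∈ Ioc f.c f.b := ⟨hcm.trans hx.1, hx.2.le⟩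
    refine ⟨hTm.trans_lt (hmono (hside hm) hx' hx.1), ?_⟩
    exact (hmono hx' ⟨f.c_lt_b, le_rfl⟩ hx.2).trans_le (f.mapsTo f.b f.b_mem f.c_lt_b.ne').2

lemma exists_gap (hf : f.IsExpanding) (h : f.IsInvariantSet K) :
    ∃ p q, p ∈ K ∧ q ∈ K ∧ p < f.c ∧ f.c < q ∧ Disjoint (Ioo p q) K := by
  obtain ⟨x, hx, hxc⟩ := h.exists_lt_c hf
  obtain ⟨y, hy, hyc⟩ := h.reflect.exists_lt_c hf.reflect
  obtain ⟨p, hp, hpmax⟩ := (h.isCompact.inter_right isClosed_Iic).exists_isGreatest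
    ⟨x, hx, hxc.le⟩
  obtain ⟨q, hq, hqmin⟩ := (h.isCompact.inter_right isClosed_Ici).exists_isLeast
    ⟨-y, hy, (show f.c ≤ -y by linarith [f.reflect_c])⟩
  refine ⟨p, q, hp.1, hq.1, lt_of_le_of_ne hp.2 (h.ne_c hp.1),
    lt_of_le_of_ne hq.2 (h.ne_c hq.1).symm, disjoint_left.2 fun z hz hzK => ?_⟩
  rcases le_total z f.c with hzc | hzc
  · exact hz.1.not_ge (hpmax ⟨hzK, hzc⟩)
  · exact hz.2.not_ge (hqmin ⟨hzK, hzc⟩)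

/-- Here l is the first time at which (p, c) covers `c`. The image of p is in K, so it is not in the
gap; if it were left of p, or if the branch reached q, the intermediate value theorem would send a
gap point to p or q, although such points cannot enter K. The limit v is the supremum of the branch.
-/
lemma exists_left_branch (hf : f.IsExpanding) (h : f.IsInvariantSet K) {p q : ℝ} (hp : p ∈ K)
    (hq : q ∈ K) (hpc : p < f.c) (hcq : f.c < q) (hd : Disjoint (Ioo p q) K) :
    ∃ l v, 1 < l ∧ f.toFun^[l] p = p ∧ f.IsFirstHit (Ioo p f.c) l ∧ f.c < v ∧ v ≤ q ∧
      (∀ x ∈ Ico p f.c, f.Avoids l x) ∧ Tendsto f.toFun^[l] (𝓝[<] f.c) (𝓝 v) := by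
  have hap := (h.subset hp).1
  have hI : Ioo p f.c ⊆ f.I := fun x hx => ⟨(hap.trans hx.1).le, (hx.2.trans f.c_lt_b).le⟩
  have hd' : Disjoint (Ioo p f.c) K := hd.mono_left (Ioo_subset_Ioo_right hcq.le)
  obtain ⟨l, ha, x, hx, hxc⟩ := hf.exists_firstHit hpc hI
  have ha' : ∀ y ∈ Ico p f.c, f.Avoids l y := by
    intro y hy
    rcases eq_or_lt_of_le hy.1 with rfl | hlt
    · exact h.avoids hp l
    · exact ha y ⟨hlt, hy.2⟩
  obtain ⟨hm, hcont⟩ := branch ordConnected_Ico ha'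
  have hp' : p ∈ Ico p f.c := ⟨le_rfl, hpc⟩
  have hTp : f.toFun^[l] p ≤ p := by
    by_contra! hlt
    refine disjoint_left.1 hd ⟨hlt, ?_⟩ (h.iterate_mem hp l)
    exact (hm hp' ⟨hx.1.le, hx.2⟩ hx.1).trans (hxc.trans_lt hcq)
  have hfix : f.toFun^[l] p = p := by
    refine le_antisymm hTp ?_
    by_contra! hlt
    obtain ⟨z, hz, hzp⟩ := intermediate_value_Icc hx.1.le
      (hcont.mono fun z hz => ⟨hz.1, hz.2.trans_lt hx.2⟩) ⟨hTp, hxc ▸ hpc.le⟩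
    have hzne : p ≠ z := by
      rintro rfl
      exact hlt.ne hzp
    exact h.iterate_notMem ha hd' ⟨lt_of_le_of_ne hz.1 hzne, hz.2.trans_lt hx.2⟩ (hzp ▸ hp)
  have hlq : ∀ y ∈ Ioo p f.c, f.toFun^[l] y < q := by
    intro y hy
    by_contra! hle
    obtain ⟨z, hz, hzq⟩ := intermediate_value_Icc hy.1.le
      (hcont.mono fun z hz => ⟨hz.1, hz.2.trans_lt hy.2⟩)
      ⟨hfix.le.trans (hpc.trans hcq).le, hle⟩
    have hzne : p ≠ z := by
      rintro rfl
      exact (hpc.trans hcq).ne (hfix.symm.trans hzq)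
    exact h.iterate_notMem ha hd' ⟨lt_of_le_of_ne hz.1 hzne, hz.2.trans_lt hy.2⟩ (hzq ▸ hq)
  have hbdd : BddAbove (f.toFun^[l] '' Ioo p f.c) :=
    ⟨q, by rintro _ ⟨y, hy, rfl⟩; exact (hlq y hy).le⟩
  have ht := MonotoneOn.tendsto_nhdsWithin_Ioo_left (nonempty_Ioo.2 hpc)
    (hm.monotoneOn.mono Ioo_subset_Ico_self) hbdd
  refine ⟨l, _, ?_, hfix, (isFirstHit_iff hI).2 ⟨ha, x, hx, hxc⟩, ?_, ?_, ha', ht⟩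
  · by_contra! hle
    -- For l = 0 the point x would be `c`; for l = 1 the point p would be fixed by the left branch
    -- and (a, p) would be invariant.
    interval_cases l
    · exact hx.2.ne hxc
    · have hmono := f.strictMonoOn_left
      refine hf.not_mapsTo hap le_rfl (fun y hy => ?_) fun y hy => ?_
      · exact avoids_succ.2 ⟨avoids_zero ⟨hy.1.le, (hy.2.trans (hpc.trans f.c_lt_b)).le⟩,
          (hy.2.trans hpc).ne⟩
      · have hy' : y ∈ Ico f.a f.c := ⟨hy.1.le, hy.2.trans hpc⟩
        refine ⟨(f.mapsTo f.a f.a_mem f.a_lt_c.ne).1.trans_lt (hmono ⟨le_rfl, f.a_lt_c⟩ hy' hy.1),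
          ?_⟩
        exact (hmono hy' ⟨hap.le, hpc⟩ hy.2).trans_le hfix.le
  · have := lt_of_strictMonoOn_of_tendsto hm ht ⟨hx.1.le, hx.2⟩
    rwa [hxc] at this
  · exact csSup_le ((nonempty_Ioo.2 hpc).image _) (by rintro _ ⟨y, hy, rfl⟩; exact (hlq y hy).le)

/-- Every invariant set gives rise to a renormalization whose critical interval is its gap
around `c`. -/
theorem exists_renormalization (hf : f.IsExpanding) (h : f.IsInvariantSet K) :
    ∃ g l r p q, f.IsRenormalizationWith g l r p q ∧ p ∈ K ∧ q ∈ K ∧ Disjoint (Ioo p q) K := by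
  obtain ⟨p, q, hp, hq, hpc, hcq, hd⟩ := h.exists_gap hf
  obtain ⟨l, v, hl, hlp, hlhit, hcv, hvq, hla, hlt⟩ :=
    h.exists_left_branch hf hp hq hpc hcq hd
  obtain ⟨r, u', hr, hrq, hrhit, hcu', hup', hra', hrt'⟩ :=
    h.reflect.exists_left_branch hf.reflect (p := -q) (q := -p) (by simpa using hq)
      (by simpa using hp) (neg_lt_neg hcq) (neg_lt_neg hpc) (disjoint_left.2 fun z hz hzK =>
        disjoint_left.1 hd ⟨by linarith [hz.2], by linarith [hz.1]⟩ hzK)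
  obtain ⟨u, rfl⟩ : ∃ u, u' = -u := ⟨-u', by simp⟩
  have hcu : u < f.c := neg_lt_neg_iff.1 hcu'
  have hup : p ≤ u := neg_le_neg_iff.1 hup'
  have hra : ∀ x ∈ Ioc f.c q, f.Avoids r x := fun x hx => by
    simpa [reflect_avoids] using hra' (-x) ⟨neg_le_neg hx.2, neg_lt_neg hx.1⟩
  have hrq : f.toFun^[r] q = q := by simpa [reflect_iterate] using hrq
  have hrt : Tendsto f.toFun^[r] (𝓝[>] f.c) (𝓝 u) := by
    have := (hrt'.comp (by simpa using tendsto_neg_nhdsGT (-f.c))).neg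
    simpa [Function.comp_def, reflect_iterate] using this
  obtain ⟨hlm, hlcont⟩ := branch ordConnected_Ico hla
  obtain ⟨hrm, hrcont⟩ := branch ordConnected_Ioc hra
  have hlv : ∀ x ∈ Ico p f.c, f.toFun^[l] x < v := fun x hx =>
    lt_of_strictMonoOn_of_tendsto hlm hlt hx
  have hru : ∀ x ∈ Ioc f.c q, u < f.toFun^[r] x := by
    intro x hx
    have hm' := (branch ordConnected_Ico hra').1
    have := lt_of_strictMonoOn_of_tendsto hm' hrt' (x := -x) ⟨neg_le_neg hx.2, neg_lt_neg hx.1⟩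
    simpa [reflect_iterate] using this
  have hlx : ∀ x ∈ Ico p f.c, x ≤ f.toFun^[l] x := by
    intro x hx
    rcases eq_or_lt_of_le hx.1 with rfl | hlt'
    · exact hlp.ge
    · exact (hf.lt_iterate hl.le hla hlp hlt hcv ⟨hlt', hx.2⟩).le
  have hrx : ∀ x ∈ Ioc f.c q, f.toFun^[r] x ≤ x := by
    intro x hx
    rcases eq_or_lt_of_le hx.2 with rfl | hlt'
    · exact hrq.le
    · have := hf.reflect.lt_iterate hr.le hra' (by simp [reflect_iterate, hrq]) hrt' hcu' (x := -x)
        ⟨neg_lt_neg hlt', neg_lt_neg hx.1⟩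
      simpa [reflect_iterate] using this.le
  -- The value at `c` is immaterial.
  let G : ℝ → ℝ := fun x => if x < f.c then f.toFun^[l] x else f.toFun^[r] x
  have hGl : ∀ x, x < f.c → G x = f.toFun^[l] x := fun x hx => if_pos hx
  have hGr : ∀ x, f.c < x → G x = f.toFun^[r] x := fun x hx => if_neg hx.not_gt
  have hsubl : Ico u f.c ⊆ Ico p f.c := Ico_subset_Ico_left hup
  have hsubr : Ioc f.c v ⊆ Ioc f.c q := Ioc_subset_Ioc_right hvq
  let g : LorenzMap :=
    { a := u
      b := v
      c := f.c
      toFun := G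
      a_lt_c := hcu
      c_lt_b := hcv
      -- The left branch moves points to the right but stays below v, and the right branch moves
      -- points to the left but stays above u.
      mapsTo := by
        intro x hx hc
        rcases lt_or_gt_of_ne hc with hlt' | hgt
        · rw [hGl x hlt']
          have hx' := hsubl ⟨hx.1, hlt'⟩
          exact ⟨hx.1.trans (hlx x hx'), (hlv x hx').le⟩
        · rw [hGr x hgt]
          have hx' := hsubr ⟨hgt, hx.2⟩
          exact ⟨(hru x hx').le, (hrx x hx').trans hx.2⟩
      strictMonoOn_left := (hlm.mono hsubl).congr fun x hx => (hGl x hx.2).symm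
      strictMonoOn_right := (hrm.mono hsubr).congr fun x hx => (hGr x hx.1).symm
      continuousOn_left := (hlcont.mono hsubl).congr fun x hx => hGl x hx.2
      continuousOn_right := (hrcont.mono hsubr).congr fun x hx => hGr x hx.1
      tendsto_left := hlt.congr' (by
        filter_upwards [self_mem_nhdsWithin] with x hx using (hGl x hx).symm)
      tendsto_right := hrt.congr' (by
        filter_upwards [self_mem_nhdsWithin] with x hx using (hGr x hx).symm) }
  have horb : ∀ x ∈ K, Disjoint (f.orb {x}) (Ioo p q) := by
    intro x hx
    refine disjoint_left.2 fun y hy hy' => ?_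
    obtain ⟨_, rfl, n, hreach⟩ := mem_orb.1 hy
    exact disjoint_left.1 hd hy' (h.mem_of_reach hreach hx)
  have hap := (h.subset hp).1
  have hqb := (h.subset hq).2
  refine ⟨g, l, r, p, q, ⟨hl, hr, rfl, ?_, fun x hx => hGl x hx.2, fun x hx => hGr x hx.1,
    ⟨hap.le, hup⟩, ⟨hvq, hqb.le⟩, hlp, hrq, horb p hp, horb q hq, hlhit, ?_⟩, hp, hq, hd⟩
  · refine ⟨Icc_subset_Icc (hap.le.trans hup) (hvq.trans hqb.le), fun hsub => ?_⟩
    exact (hap.trans_le hup).not_ge (hsub f.a_mem).1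
  · have hI : Ioo (-q) f.reflect.c ⊆ f.reflect.I := fun y hy =>
      (hra' y ⟨hy.1.le, hy.2⟩).1
    obtain ⟨-, x, hx, hxc⟩ := (isFirstHit_iff hI).1 hrhit
    refine (isFirstHit_iff fun y hy => (hra y ⟨hy.1, hy.2.le⟩).1).2
      ⟨fun y hy => hra y ⟨hy.1, hy.2.le⟩, -x, ⟨by linarith [hx.2, f.reflect_c],
        by linarith [hx.1]⟩, ?_⟩
    simpa [reflect_iterate] using hxc

end IsInvariantSet

/-! ### The points whose orbit avoids an interval -/

/-- The points of `I` whose orbit does not meet `(p, q)`. -/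
def avoiding (f : LorenzMap) (p q : ℝ) : Set ℝ := {x | x ∈ f.I ∧ Disjoint (f.orb {x}) (Ioo p q)}

lemma notMem_of_mem_avoiding {p q x y : ℝ} {n : ℕ} (hx : x ∈ f.avoiding p q)
    (hr : f.Reach n x y) : y ∉ Ioo p q :=
  disjoint_left.1 hx.2 (mem_orb.2 ⟨x, rfl, n, hr⟩)

lemma mem_avoiding_of_reach {p q x y : ℝ} {n : ℕ} (hx : x ∈ f.avoiding p q)
    (hr : f.Reach n x y) : y ∈ f.avoiding p q := by
  refine ⟨hr.mem hx.1, disjoint_left.2 fun z hz => ?_⟩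
  obtain ⟨_, rfl, m, hm⟩ := mem_orb.1 hz
  exact notMem_of_mem_avoiding hx (hr.trans hm)

lemma avoiding_anti {p q p' q' : ℝ} (hp : p ≤ p') (hq : q' ≤ q) :
    f.avoiding p q ⊆ f.avoiding p' q' :=
  fun _ hx => ⟨hx.1, hx.2.mono_right (Ioo_subset_Ioo hp hq)⟩

/-- Since `c` is in (p, q), an orbit meeting `c` has already entered, so entrance can be tested
before the orbit becomes two-valued. -/
lemma exists_iterate_of_notMem_avoiding {p q x : ℝ} (hc : f.c ∈ Ioo p q) (hx : x ∈ f.I)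
    (h : x ∉ f.avoiding p q) : ∃ n, f.Avoids n x ∧ f.toFun^[n] x ∈ Ioo p q := by
  have hnd : ¬ Disjoint (f.orb {x}) (Ioo p q) := fun hd => h ⟨hx, hd⟩
  obtain ⟨y, hy, hy'⟩ := not_disjoint_iff.1 hnd
  obtain ⟨_, rfl, n, hr⟩ := mem_orb.1 hy
  rcases hr.split hx with ⟨ha, rfl⟩ | ⟨j, -, ha, hjc, -⟩
  · exact ⟨n, ha, hy'⟩
  · exact ⟨j, ha, hjc ▸ hc⟩

lemma isClosed_avoiding {p q : ℝ} (hc : f.c ∈ Ioo p q) : IsClosed (f.avoiding p q) := by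
  refine isClosed_of_closure_subset fun x hx => ?_
  have hxI : x ∈ f.I := closure_minimal (fun y hy => hy.1) isClosed_Icc hx
  by_contra hn
  obtain ⟨n, ha, hmem⟩ := exists_iterate_of_notMem_avoiding hc hxI hn
  have hev : ∀ᶠ y in 𝓝[f.I] x, y ∉ f.avoiding p q := by
    filter_upwards [ha.eventually, ha.continuousWithinAt.eventually (isOpen_Ioo.mem_nhds hmem)]
      with y hy hy' hmem
    exact notMem_of_mem_avoiding hmem hy.reach hy'
  obtain ⟨y, hy, hy'⟩ := ((mem_closure_iff_frequently.1 hx).and_eventually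
    (eventually_nhdsWithin_iff.1 hev)).exists
  exact hy' hy.1 hy

namespace IsStrictRenormalization

variable {l r : ℕ} {p q : ℝ}

lemma c_mem (h : f.IsStrictRenormalization g l r p q) : f.c ∈ Ioo p q := ⟨h.p_lt_c, h.c_lt_q⟩

lemma p_mem_avoiding (h : f.IsStrictRenormalization g l r p q) : p ∈ f.avoiding p q :=
  ⟨h.p_mem, h.left_orb⟩

lemma q_mem_avoiding (h : f.IsStrictRenormalization g l r p q) : q ∈ f.avoiding p q :=
  ⟨h.q_mem, h.right_orb⟩

lemma c_notMem (h : f.IsStrictRenormalization g l r p q) : f.c ∉ f.avoiding p q := fun hc =>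
  notMem_of_mem_avoiding (n := 0) hc rfl h.c_mem

/-- The orbit of `f.b` passes through `g.b`, which is inside (p, q) precisely because the
renormalization is strict. -/
lemma b_notMem (hf : f.IsExpanding) (h : f.IsStrictRenormalization g l r p q) :
    f.b ∉ f.avoiding p q := by
  intro hb
  have hi := h.induced hf
  have hr := (hi.avoids_b (k := l - 1) (by have := hi.one_le_l; omega)).reach
  rw [hi.iterate_b] at hr
  exact notMem_of_mem_avoiding hb hr (hi.I_subset g.b_mem)

lemma a_notMem (hf : f.IsExpanding) (h : f.IsStrictRenormalization g l r p q) :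
    f.a ∉ f.avoiding p q := by
  intro ha
  have hi := h.induced hf
  have hr := (hi.avoids_a (k := r - 1) (by have := hi.one_le_r; omega)).reach
  rw [hi.iterate_a] at hr
  exact notMem_of_mem_avoiding ha hr (hi.I_subset g.a_mem)

/-- If x ≠ `c`, the orbit of x could enter (p, q) at time 0 only, the rest being the orbit of y. But
a point of (p, q) comes back after l or r steps, which would be a visit of the orbit of y. -/
lemma mem_avoiding_of_step (hf : f.IsExpanding) (h : f.IsStrictRenormalization g l r p q)
    {x y : ℝ} (hs : f.Step x y) (hy : y ∈ f.avoiding p q) : x ∈ f.avoiding p q := by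
  rcases eq_or_ne x f.c with rfl | hc
  · rcases hs.of_c with rfl | rfl
    · exact absurd hy (h.a_notMem hf)
    · exact absurd hy (h.b_notMem hf)
  by_contra hx
  obtain rfl := hs.eq_of_ne hc
  obtain ⟨n, ha, hmem⟩ := exists_iterate_of_notMem_avoiding h.c_mem hs.1 hx
  have key : ∀ n, f.Avoids (n + 1) x → f.toFun^[n + 1] x ∉ Ioo p q := by
    intro n ha hmem
    have := (ha.reach)
    obtain ⟨z, hz, hr⟩ := this
    obtain rfl := hz.eq_of_ne hc
    exact notMem_of_mem_avoiding hy hr hmem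
  cases n with
  | zero =>
    obtain ⟨l', rfl⟩ : ∃ l', l = l' + 1 := ⟨l - 1, by have := h.one_lt_l; omega⟩
    obtain ⟨r', rfl⟩ : ∃ r', r = r' + 1 := ⟨r - 1, by have := h.one_lt_r; omega⟩
    rcases lt_or_gt_of_ne hc with hlt | hgt
    · have h1 := h.iterate_left_mem ⟨hmem.1, hlt⟩
      exact key l' (h.avoids_left ⟨hmem.1.le, hlt⟩) ⟨h1.1, h1.2.trans_le h.right_mem.1⟩
    · have h1 := h.iterate_right_mem ⟨hgt, hmem.2⟩
      exact key r' (h.avoids_right ⟨hgt, hmem.2.le⟩) ⟨h.left_mem.2.trans_lt h1.1, h1.2⟩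
  | succ n => exact key n ha hmem

lemma isCompletelyInvariant (hf : f.IsExpanding) (h : f.IsStrictRenormalization g l r p q) :
    f.IsCompletelyInvariant (f.avoiding p q) := by
  refine ⟨fun x hx => hx.1, Subset.antisymm ?_ ?_, Subset.antisymm ?_ ?_⟩
  · rintro y ⟨x, hx, hs⟩
    exact mem_avoiding_of_reach hx (reach_one.2 hs)
  · intro y hy
    obtain ⟨x, hx⟩ := hf.exists_step hy.1
    exact ⟨x, h.mem_avoiding_of_step hf hx hy, hx⟩
  · rintro x ⟨y, hy, hs⟩
    exact h.mem_avoiding_of_step hf hs hy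
  · intro x hx
    have hc : x ≠ f.c := fun hc => h.c_notMem (hc ▸ hx)
    exact ⟨_, mem_avoiding_of_reach hx (reach_one.2 (step_of_ne hx.1 hc)), step_of_ne hx.1 hc⟩

lemma isInvariantSet (hf : f.IsExpanding) (h : f.IsStrictRenormalization g l r p q) :
    f.IsInvariantSet (f.avoiding p q) where
  nonempty := ⟨p, h.p_mem_avoiding⟩
  isClosed := isClosed_avoiding h.c_mem
  subset x hx := ⟨lt_of_le_of_ne hx.1.1 fun he => h.a_notMem hf (he ▸ hx),
    lt_of_le_of_ne hx.1.2 fun he => h.b_notMem hf (he ▸ hx)⟩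
  c_notMem := h.c_notMem
  forward x hx := by
    have hc : x ≠ f.c := fun hc => h.c_notMem (hc ▸ hx)
    exact mem_avoiding_of_reach hx (reach_one.2 (step_of_ne hx.1 hc))
  backward x hx hc hm :=
    h.mem_avoiding_of_step hf (step_of_ne (Ioo_subset_Icc_self hx) hc) hm

end IsStrictRenormalization

/-- An invariant set is determined by its gap around `c`. -/
lemma IsInvariantSet.eq_avoiding (hf : f.IsExpanding) {K : Set ℝ} (h : f.IsInvariantSet K)
    {l r : ℕ} {p q : ℝ} (hg : f.IsStrictRenormalization g l r p q) (hp : p ∈ K) (hq : q ∈ K)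
    (hd : Disjoint (Ioo p q) K) : K = f.avoiding p q := by
  refine Subset.antisymm (fun x hx => ⟨h.subset_I hx, disjoint_left.2 fun y hy hy' => ?_⟩) ?_
  · obtain ⟨_, rfl, n, hr⟩ := mem_orb.1 hy
    exact disjoint_left.1 hd hy' (h.mem_of_reach hr hx)
  intro x hx
  by_contra hxK
  have hxI := (hg.isInvariantSet hf).subset hx
  -- A small interval around x off K is iterated until it covers `c`. Its image is an interval
  -- missing K and containing `c`, so it lies in the gap, and the orbit of x enters (p, q).
  obtain ⟨s, t, hxst, hsub⟩ := mem_nhds_iff_exists_Ioo_subset.1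
    ((h.isClosed.isOpen_compl.inter isOpen_Ioo).mem_nhds ⟨hxK, hxI⟩)
  obtain ⟨n, ha, z, hz, hzc⟩ := hf.exists_firstHit (hxst.1.trans hxst.2)
    fun y hy => Ioo_subset_Icc_self (hsub hy).2
  have hd' : Disjoint (Ioo s t) K := disjoint_left.2 fun y hy => (hsub hy).1
  obtain ⟨hm, hcont⟩ := branch ordConnected_Ioo ha
  have hoc : (f.toFun^[n] '' Ioo s t).OrdConnected :=
    (isPreconnected_Ioo.image _ hcont).ordConnected
  have hdisj : ∀ y ∈ f.toFun^[n] '' Ioo s t, y ∉ K := by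
    rintro _ ⟨y, hy, rfl⟩
    exact h.iterate_notMem ha hd' hy
  have hzmem : f.c ∈ f.toFun^[n] '' Ioo s t := ⟨z, hz, hzc⟩
  have hxmem : f.toFun^[n] x ∈ f.toFun^[n] '' Ioo s t := ⟨x, hxst, rfl⟩
  refine notMem_of_mem_avoiding hx (ha x hxst).reach ⟨?_, ?_⟩
  · by_contra! hle
    exact hdisj p (hoc.out hxmem hzmem ⟨hle, hg.p_lt_c.le⟩) hp
  · by_contra! hle
    exact hdisj q (hoc.out hzmem hxmem ⟨hg.c_lt_q.le, hle⟩) hq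

lemma IsInvariantSet.exists_eq_avoiding (hf : f.IsExpanding) (hnd : f.NoFixedEndpoint)
    {K : Set ℝ} (h : f.IsInvariantSet K) :
    ∃ g l r p q, f.IsStrictRenormalization g l r p q ∧ K = f.avoiding p q := by
  obtain ⟨g, l, r, p, q, hg, hp, hq, hd⟩ := h.exists_renormalization hf
  exact ⟨g, l, r, p, q, hnd.strict hg, h.eq_avoiding hf (hnd.strict hg) hp hq hd⟩

namespace IsCompletelyInvariant

variable {K : Set ℝ}

lemma mem_of_reach (h : f.IsCompletelyInvariant K) {n : ℕ} {x y : ℝ} (hr : f.Reach n x y)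
    (hx : x ∈ K) : y ∈ K := by
  induction n generalizing x with
  | zero => exact hr ▸ hx
  | succ n ih =>
    obtain ⟨z, hz, hr⟩ := hr
    exact ih hr (h.2.1 ▸ ⟨x, hx, hz⟩)

lemma mem_of_reach' (h : f.IsCompletelyInvariant K) {n : ℕ} {x y : ℝ} (hr : f.Reach n x y)
    (hy : y ∈ K) : x ∈ K := by
  induction n generalizing x with
  | zero => exact hr ▸ hy
  | succ n ih =>
    obtain ⟨z, hz, hr⟩ := hr
    exact h.2.2 ▸ ⟨z, ih hr, hz⟩

lemma eq_I_of_c_mem (hf : f.IsExpanding) (h : f.IsCompletelyInvariant K) (hK : IsClosed K)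
    (hc : f.c ∈ K) : K = f.I := by
  refine Subset.antisymm h.1 (hf.trans (closure_minimal ?_ hK))
  refine iUnion_subset fun n x hx => ?_
  obtain ⟨_, rfl, hr⟩ := mem_preimage_iterate.1 hx
  exact h.mem_of_reach' hr hc

lemma isInvariantSet (hf : f.IsExpanding) (h : f.IsCompletelyInvariant K) (hK : IsClosed K)
    (hne : K.Nonempty) (hI : K ≠ f.I) : f.IsInvariantSet K := by
  have hc : f.c ∉ K := fun hc => hI (h.eq_I_of_c_mem hf hK hc)
  have ha : f.a ∉ K := fun ha => hc (h.mem_of_reach' (reach_one.2 f.step_c_a) ha)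
  have hb : f.b ∉ K := fun hb => hc (h.mem_of_reach' (reach_one.2 f.step_c_b) hb)
  refine ⟨hne, hK, fun x hx => ⟨lt_of_le_of_ne (h.1 hx).1 fun he => ha (he ▸ hx),
    lt_of_le_of_ne (h.1 hx).2 fun he => hb (he ▸ hx)⟩, hc, fun x hx => ?_, fun x hx hxc hm => ?_⟩
  · exact h.mem_of_reach (reach_one.2 (step_of_ne (h.1 hx) fun he => hc (he ▸ hx))) hx
  · exact h.mem_of_reach' (reach_one.2 (step_of_ne (Ioo_subset_Icc_self hx) hxc)) hm

end IsCompletelyInvariant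

/-! ### Local surjectivity -/

lemma exists_step_near {x : ℝ} (hx : x ∈ Ioo f.a f.b) (hc : x ≠ f.c) {U : Set ℝ} (hU : U ∈ 𝓝 x) :
    ∃ V ∈ 𝓝 (f.toFun x), ∀ y ∈ V, ∃ w ∈ U, f.Step w y := by
  obtain ⟨s, t, hst, hsub⟩ := mem_nhds_iff_exists_Ioo_subset.1
    (inter_mem hU ((isOpen_Ioo.inter isOpen_ne).mem_nhds (⟨hx, hc⟩ : x ∈ Ioo f.a f.b ∩ {f.c}ᶜ)))
  have ha : ∀ y ∈ Ioo s t, f.Avoids 1 y := fun y hy =>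
    avoids_succ.2 ⟨avoids_zero (Ioo_subset_Icc_self (hsub hy).2.1), (hsub hy).2.2⟩
  obtain ⟨hm, hcont⟩ := branch ordConnected_Ioo ha
  obtain ⟨s', hs'⟩ := exists_between hst.1
  obtain ⟨t', ht'⟩ := exists_between hst.2
  have hIcc : Icc s' t' ⊆ Ioo s t := fun y hy =>
    ⟨hs'.1.trans_le hy.1, hy.2.trans_lt ht'.2⟩
  have hle : s' ≤ t' := (hs'.2.trans ht'.1).le
  refine ⟨Icc (f.toFun s') (f.toFun t'), Icc_mem_nhds ?_ ?_, fun y hy => ?_⟩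
  · exact hm (hIcc ⟨le_rfl, hle⟩) hst hs'.2
  · exact hm hst (hIcc ⟨hle, le_rfl⟩) ht'.1
  · obtain ⟨w, hw, rfl⟩ := intermediate_value_Icc hle (hcont.mono hIcc) hy
    have hw' := hsub (hIcc hw)
    exact ⟨w, hw'.1, step_of_ne (Ioo_subset_Icc_self hw'.2.1) hw'.2.2⟩

/-- At an end point of I the map is open on one side only; near `c` each side covers a full relative
neighbourhood of b or of a. -/
lemma exists_step_near_a {U : Set ℝ} (hU : U ∈ 𝓝 f.a) :
    ∃ V ∈ 𝓝 (f.toFun f.a), ∀ y ∈ V, f.toFun f.a ≤ y → ∃ w ∈ U, f.Step w y := by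
  obtain ⟨s, t, hst, hsub⟩ := mem_nhds_iff_exists_Ioo_subset.1 (inter_mem hU (Iio_mem_nhds f.a_lt_c))
  obtain ⟨t', ht'⟩ := exists_between hst.2
  have hIcc : Icc f.a t' ⊆ U ∩ Iio f.c := fun y hy =>
    hsub ⟨hst.1.trans_le hy.1, hy.2.trans_lt ht'.2⟩
  have hIco : Icc f.a t' ⊆ Ico f.a f.c := fun y hy => ⟨hy.1, (hIcc hy).2⟩
  have hlt := f.strictMonoOn_left (hIco ⟨le_rfl, ht'.1.le⟩) (hIco ⟨ht'.1.le, le_rfl⟩) ht'.1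
  refine ⟨Iio (f.toFun t'), Iio_mem_nhds hlt, fun y hy hya => ?_⟩
  obtain ⟨w, hw, rfl⟩ := intermediate_value_Icc ht'.1.le (f.continuousOn_left.mono hIco)
    ⟨hya, (mem_Iio.1 hy).le⟩
  exact ⟨w, (hIcc hw).1, step_of_ne ⟨hw.1, ((hIcc hw).2.trans f.c_lt_b).le⟩ (hIcc hw).2.ne⟩

lemma exists_step_c_near_b {U : Set ℝ} (hU : U ∈ 𝓝 f.c) :
    ∃ V ∈ 𝓝 f.b, ∀ y ∈ V, y ∈ f.I → ∃ w ∈ U, f.Step w y := by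
  obtain ⟨s, t, hst, hsub⟩ := mem_nhds_iff_exists_Ioo_subset.1
    (inter_mem hU (Ioi_mem_nhds f.a_lt_c))
  obtain ⟨s', hs'⟩ := exists_between hst.1
  have hI : ∀ y ∈ Ico s' f.c, y ∈ U ∧ y ∈ Ico f.a f.c := fun y hy => by
    have := hsub ⟨hs'.1.trans_le hy.1, hy.2.trans hst.2⟩
    exact ⟨this.1, (mem_Ioi.1 this.2).le, hy.2⟩
  have hs'I := hI s' ⟨le_rfl, hs'.2⟩
  refine ⟨Ioi (f.toFun s'), Ioi_mem_nhds (toFun_lt_b hs'I.2.1 hs'I.2.2), fun y hy hyI => ?_⟩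
  rcases eq_or_lt_of_le hyI.2 with rfl | hlt
  · exact ⟨f.c, mem_of_mem_nhds hU, f.step_c_b⟩
  obtain ⟨x, hx, hxc⟩ := ((f.tendsto_left.eventually_const_lt hlt).and
    (Ioo_mem_nhdsLT hs'.2)).exists
  have hsub' : Icc s' x ⊆ Ico s' f.c := fun z hz => ⟨hz.1, hz.2.trans_lt hxc.2⟩
  obtain ⟨w, hw, rfl⟩ := intermediate_value_Icc hxc.1.le
    (f.continuousOn_left.mono fun z hz => (hI z (hsub' hz)).2) ⟨(mem_Ioi.1 hy).le, hx.le⟩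
  have hw' := hI w (hsub' hw)
  exact ⟨w, hw'.1, step_of_ne ⟨hw'.2.1, (hw'.2.2.trans f.c_lt_b).le⟩ hw'.2.2.ne⟩

lemma exists_step_near_b {U : Set ℝ} (hU : U ∈ 𝓝 f.b) :
    ∃ V ∈ 𝓝 (f.toFun f.b), ∀ y ∈ V, y ≤ f.toFun f.b → ∃ w ∈ U, f.Step w y := by
  obtain ⟨V, hV, h⟩ := exists_step_near_a (f := f.reflect) (U := {x | -x ∈ U})
    (continuous_neg.continuousAt.preimage_mem_nhds (by simpa using hU))
  refine ⟨{x | -x ∈ V}, continuous_neg.continuousAt.preimage_mem_nhds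
    (by simpa [reflect_toFun] using hV), fun y hy hle => ?_⟩
  obtain ⟨w, hw, hs⟩ := h (-y) hy (by simpa [reflect_toFun] using hle)
  exact ⟨-w, hw, by simpa [reflect_step] using hs⟩

lemma exists_step_c_near_a {U : Set ℝ} (hU : U ∈ 𝓝 f.c) :
    ∃ V ∈ 𝓝 f.a, ∀ y ∈ V, y ∈ f.I → ∃ w ∈ U, f.Step w y := by
  obtain ⟨V, hV, h⟩ := exists_step_c_near_b (f := f.reflect) (U := {x | -x ∈ U})
    (continuous_neg.continuousAt.preimage_mem_nhds (by simpa using hU))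
  refine ⟨{x | -x ∈ V}, continuous_neg.continuousAt.preimage_mem_nhds (by simpa using hV),
    fun y hy hI => ?_⟩
  obtain ⟨w, hw, hs⟩ := h (-y) hy (by simpa using hI)
  exact ⟨-w, hw, by simpa [reflect_step] using hs⟩

/-! ### Limit sets of backward closed properties -/

/-- A family of properties such that the `N`-th one holds at all preimages of the points where the
`(N + 1)`-st one holds. -/
structure IsBackward (f : LorenzMap) (Q : ℕ → ℝ → Prop) : Prop where
  anti : ∀ M N z, M ≤ N → Q N z → Q M z
  back : ∀ N w z, f.Step w z → Q (N + 1) z → Q N w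

/-- The points of `I` accumulated by points satisfying `Q N`, for every `N`. -/
def limSet (f : LorenzMap) (Q : ℕ → ℝ → Prop) : Set ℝ :=
  {y | y ∈ f.I ∧ ∀ N, ∀ U ∈ 𝓝 y, ∃ z ∈ U, z ∈ f.I ∧ Q N z}

lemma mem_limSet_iff {Q : ℕ → ℝ → Prop} {y : ℝ} :
    y ∈ f.limSet Q ↔ ∀ N, y ∈ closure {z | z ∈ f.I ∧ Q N z} := by
  constructor
  · intro h N
    refine mem_closure_iff_nhds.2 fun U hU => ?_
    obtain ⟨z, hz⟩ := h.2 N U hU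
    exact ⟨z, hz⟩
  · intro h
    refine ⟨closure_minimal (fun y hy => hy.1) isClosed_Icc (h 0), fun N U hU => ?_⟩
    obtain ⟨z, hz⟩ := mem_closure_iff_nhds.1 (h N) U hU
    exact ⟨z, hz⟩

lemma isClosed_limSet {Q : ℕ → ℝ → Prop} : IsClosed (f.limSet Q) := by
  have : f.limSet Q = ⋂ N, closure {z | z ∈ f.I ∧ Q N z} := by
    ext y
    rw [mem_limSet_iff, mem_iInter]
  rw [this]
  exact isClosed_iInter fun N => isClosed_closure

namespace IsBackward

variable {Q : ℕ → ℝ → Prop}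

lemma limSet_nonempty (hQ : f.IsBackward Q) (h : ∀ N, ∃ z ∈ f.I, Q N z) :
    (f.limSet Q).Nonempty := by
  have : (⋂ N, closure {z | z ∈ f.I ∧ Q N z}).Nonempty := by
    refine IsCompact.nonempty_iInter_of_sequence_nonempty_isCompact_isClosed _ ?_ ?_ ?_ ?_
    · exact fun N => closure_mono fun z hz => ⟨hz.1, hQ.anti N (N + 1) z N.le_succ hz.2⟩
    · intro N
      obtain ⟨z, hz⟩ := h N
      exact ⟨z, subset_closure hz⟩
    · exact isCompact_Icc.of_isClosed_subset isClosed_closure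
        (closure_minimal (fun y hy => hy.1) isClosed_Icc)
    · exact fun N => isClosed_closure
  obtain ⟨y, hy⟩ := this
  exact ⟨y, mem_limSet_iff.2 (mem_iInter.1 hy)⟩

lemma mem_limSet_of_toFun_mem (hQ : f.IsBackward Q) {x : ℝ} (hx : x ∈ Ioo f.a f.b)
    (hc : x ≠ f.c) (h : f.toFun x ∈ f.limSet Q) : x ∈ f.limSet Q := by
  refine ⟨Ioo_subset_Icc_self hx, fun N U hU => ?_⟩
  obtain ⟨V, hV, hstep⟩ := exists_step_near hx hc hU
  obtain ⟨z, hz, -, hQz⟩ := h.2 (N + 1) V hV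
  obtain ⟨w, hw, hs⟩ := hstep z hz
  exact ⟨w, hw, hs.1, hQ.back N w z hs hQz⟩

lemma c_mem_of_a_mem (hQ : f.IsBackward Q) (h : f.a ∈ f.limSet Q) : f.c ∈ f.limSet Q := by
  refine ⟨f.c_mem, fun N U hU => ?_⟩
  obtain ⟨V, hV, hstep⟩ := exists_step_c_near_a hU
  obtain ⟨z, hz, hzI, hQz⟩ := h.2 (N + 1) V hV
  obtain ⟨w, hw, hs⟩ := hstep z hz hzI
  exact ⟨w, hw, hs.1, hQ.back N w z hs hQz⟩

lemma c_mem_of_b_mem (hQ : f.IsBackward Q) (h : f.b ∈ f.limSet Q) : f.c ∈ f.limSet Q := by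
  refine ⟨f.c_mem, fun N U hU => ?_⟩
  obtain ⟨V, hV, hstep⟩ := exists_step_c_near_b hU
  obtain ⟨z, hz, hzI, hQz⟩ := h.2 (N + 1) V hV
  obtain ⟨w, hw, hs⟩ := hstep z hz hzI
  exact ⟨w, hw, hs.1, hQ.back N w z hs hQz⟩

lemma limSet_subset_Ioo (hQ : f.IsBackward Q) (hc : f.c ∉ f.limSet Q) :
    f.limSet Q ⊆ Ioo f.a f.b := fun _ hx =>
  ⟨lt_of_le_of_ne hx.1.1 fun he => hc (hQ.c_mem_of_a_mem (he ▸ hx)),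
    lt_of_le_of_ne hx.1.2 fun he => hc (hQ.c_mem_of_b_mem (he ▸ hx))⟩

/-- A preimage of y interior to a branch works by local openness. The only other possibility is f(a)
= y = f(b), which is excluded: neighbourhoods of a and b jointly cover both sides of y, so a or b
would be a limit point and then so would `c`. -/
lemma exists_mem_limSet (hf : f.IsExpanding) (hQ : f.IsBackward Q) (hc : f.c ∉ f.limSet Q)
    {y : ℝ} (hy : y ∈ f.limSet Q) : ∃ x ∈ f.limSet Q, f.toFun x = y := by
  have hyI := hQ.limSet_subset_Ioo hc hy
  have ha : f.a ∉ f.limSet Q := fun h => hc (hQ.c_mem_of_a_mem h)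
  have hb : f.b ∉ f.limSet Q := fun h => hc (hQ.c_mem_of_b_mem h)
  by_cases h1 : f.toFun f.a < y
  · obtain ⟨x, hx, rfl⟩ := exists_step_left h1.le hyI.2
    refine ⟨x, hQ.mem_limSet_of_toFun_mem ⟨lt_of_le_of_ne hx.1 ?_, hx.2.trans f.c_lt_b⟩ hx.2.ne hy,
      rfl⟩
    rintro rfl
    exact lt_irrefl _ h1
  by_cases h2 : y < f.toFun f.b
  · obtain ⟨x, hx, rfl⟩ := exists_step_right h2.le hyI.1
    refine ⟨x, hQ.mem_limSet_of_toFun_mem ⟨f.a_lt_c.trans hx.1, lt_of_le_of_ne hx.2 ?_⟩ hx.1.ne' hy,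
      rfl⟩
    rintro rfl
    exact lt_irrefl _ h2
  push Not at h1 h2
  have hya : f.toFun f.a = y := le_antisymm (hf.toFun_a_le.trans h2) h1
  have hyb : f.toFun f.b = y := le_antisymm h2 (h1.trans hf.toFun_a_le)
  exfalso
  have hfar : ∀ x ∈ f.I, x ∉ f.limSet Q → ∃ N, ∃ U ∈ 𝓝 x, ∀ z ∈ U, z ∈ f.I → ¬ Q N z := by
    intro x hx hn
    by_contra! hcon
    exact hn ⟨hx, hcon⟩
  obtain ⟨N₁, U₁, hU₁, hn₁⟩ := hfar _ f.a_mem ha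
  obtain ⟨N₂, U₂, hU₂, hn₂⟩ := hfar _ f.b_mem hb
  obtain ⟨V₁, hV₁, hs₁⟩ := exists_step_near_a hU₁
  obtain ⟨V₂, hV₂, hs₂⟩ := exists_step_near_b hU₂
  rw [hya] at hV₁
  rw [hyb] at hV₂
  obtain ⟨z, hz, hzI, hQz⟩ := hy.2 (max N₁ N₂ + 1) _ (inter_mem hV₁ hV₂)
  rcases le_total y z with hle | hle
  · obtain ⟨w, hw, hs⟩ := hs₁ z hz.1 (hya ▸ hle)
    exact hn₁ w hw hs.1 (hQ.anti _ _ _ (le_max_left _ _) (hQ.back _ w z hs hQz))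
  · obtain ⟨w, hw, hs⟩ := hs₂ z hz.2 (hyb ▸ hle)
    exact hn₂ w hw hs.1 (hQ.anti _ _ _ (le_max_right _ _) (hQ.back _ w z hs hQz))

/-- The points whose whole orbit stays in the limit set form an invariant set. -/
lemma isInvariantSet (hf : f.IsExpanding) (hQ : f.IsBackward Q) (hc : f.c ∉ f.limSet Q)
    (hne : (f.limSet Q).Nonempty) :
    f.IsInvariantSet {x | ∀ n, f.toFun^[n] x ∈ f.limSet Q} := by
  -- Forward invariance of L is not assumed. The sets of points whose first n iterates stay in L are
  -- closed and nested, and nonempty because every point of L has a preimage in L.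
  set L := f.limSet Q with hL
  have hsub := hQ.limSet_subset_Ioo hc
  have havoid : ∀ n x, (∀ j ≤ n, f.toFun^[j] x ∈ L) → f.Avoids (n + 1) x := fun n x h =>
    ⟨(h 0 n.zero_le).1, fun j hj he => hc (he ▸ h j (by omega))⟩
  have hclosed : ∀ n, IsClosed {x | ∀ j ≤ n, f.toFun^[j] x ∈ L} := by
    intro n
    induction n with
    | zero =>
      have : {x | ∀ j ≤ 0, f.toFun^[j] x ∈ L} = L := by
        ext x
        simp
      rw [this]
      exact isClosed_limSet
    | succ n ih =>
      have hcont : ContinuousOn f.toFun^[n + 1] {x | ∀ j ≤ n, f.toFun^[j] x ∈ L} := fun x hx =>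
        ((havoid n x hx).continuousWithinAt).mono fun y hy => (hy 0 n.zero_le).1
      have := hcont.preimage_isClosed_of_isClosed ih (isClosed_limSet (f := f) (Q := Q))
      convert this using 1
      ext x
      constructor
      · exact fun h => ⟨fun j hj => h j (by omega), h (n + 1) le_rfl⟩
      · rintro ⟨h1, h2⟩ j hj
        rcases Nat.le_succ_iff.1 hj with hj | rfl
        · exact h1 j hj
        · exact h2
  have heq : {x | ∀ n, f.toFun^[n] x ∈ L} = ⋂ n, {x | ∀ j ≤ n, f.toFun^[j] x ∈ L} := by
    ext x
    simp only [mem_ofPred_eq, mem_iInter]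
    exact ⟨fun h n j _ => h j, fun h n => h n n le_rfl⟩
  refine ⟨?_, ?_, fun x hx => hsub (hx 0), fun h => hc (h 0), fun x hx n => ?_,
    fun x hx hxc hm n => ?_⟩
  · rw [heq]
    refine IsCompact.nonempty_iInter_of_sequence_nonempty_isCompact_isClosed _ ?_ ?_ ?_ hclosed
    · exact fun n x h j hj => h j (by omega)
    · intro n
      have : ∀ n, ∀ y ∈ L, ∃ x, (∀ j ≤ n, f.toFun^[j] x ∈ L) ∧ f.toFun^[n] x = y := by
        intro n
        induction n with
        | zero => exact fun y hy => ⟨y, fun j hj => by simpa [Nat.le_zero.1 hj] using hy, rfl⟩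
        | succ n ih =>
          intro y hy
          obtain ⟨w, hw, rfl⟩ := hQ.exists_mem_limSet hf hc hy
          obtain ⟨x, hx, rfl⟩ := ih w hw
          refine ⟨x, fun j hj => ?_, Function.iterate_succ_apply' _ _ _⟩
          rcases Nat.le_succ_iff.1 hj with hj | rfl
          · exact hx j hj
          · rwa [Function.iterate_succ_apply']
      obtain ⟨y, hy⟩ := hne
      obtain ⟨x, hx, -⟩ := this n y hy
      exact ⟨x, hx⟩
    · exact isCompact_Icc.of_isClosed_subset (hclosed 0) fun x hx => (hx 0 le_rfl).1
  · rw [heq]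
    exact isClosed_iInter hclosed
  · rw [← Function.iterate_succ_apply]
    exact hx (n + 1)
  · cases n with
    | zero => exact hQ.mem_limSet_of_toFun_mem hx hxc (hm 0)
    | succ n =>
      rw [Function.iterate_succ_apply]
      exact hm n

end IsBackward

/-! ### The images of a neighbourhood under a map without renormalizations -/

/-- At the first hit of `c` the iterate is an increasing continuous branch, so it covers both sides
of `c`. -/
lemma exists_image_mem_nhds_c (hf : f.IsExpanding) {U : Set ℝ} (hU : IsOpen U) {x : ℝ}
    (hx : x ∈ U ∩ f.I) : ∃ n, ∃ V ∈ 𝓝 f.c, ∀ y ∈ V, ∃ z ∈ U ∩ f.I, f.Reach n z y := by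
  obtain ⟨s, t, hst, hsub, hI⟩ := exists_Ioo_subset hx.2 (hU.mem_nhds hx.1)
  have hI' : Ioo s t ⊆ f.I := hI.trans Ioo_subset_Icc_self
  obtain ⟨n, ha, z, hz, hzc⟩ := hf.exists_firstHit hst hI'
  obtain ⟨hm, hcont⟩ := branch ordConnected_Ioo ha
  obtain ⟨s', hs'⟩ := exists_between hz.1
  obtain ⟨t', ht'⟩ := exists_between hz.2
  have hIcc : Icc s' t' ⊆ Ioo s t := fun y hy => ⟨hs'.1.trans_le hy.1, hy.2.trans_lt ht'.2⟩
  have hle : s' ≤ t' := (hs'.2.trans ht'.1).le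
  refine ⟨n, Icc (f.toFun^[n] s') (f.toFun^[n] t'), Icc_mem_nhds ?_ ?_, fun y hy => ?_⟩
  · rw [← hzc]
    exact hm (hIcc ⟨le_rfl, hle⟩) hz hs'.2
  · rw [← hzc]
    exact hm hz (hIcc ⟨hle, le_rfl⟩) ht'.1
  · obtain ⟨w, hw, rfl⟩ := intermediate_value_Icc hle (hcont.mono hIcc) hy
    exact ⟨w, ⟨hsub (hIcc hw), hI' (hIcc hw)⟩, (ha w (hIcc hw)).reach⟩

/-- If the images of U never fill I, the points not reached in N steps have a nonempty limit set. It
misses `c`, since some image of U is a neighbourhood of `c`; so it contains an invariant set, hence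
there is a renormalization. -/
lemma isLeoOn_I (hf : f.IsExpanding) (hprime : ¬ ∃ g, f.IsRenormalization g) : f.IsLeoOn f.I := by
  rintro U hU ⟨x, hx⟩
  by_contra! hcon
  let Q : ℕ → ℝ → Prop := fun N z => ∀ n ≤ N, ∀ w ∈ U ∩ f.I, ¬ f.Reach n w z
  have hQ : f.IsBackward Q := by
    refine ⟨fun M N z hMN h n hn => h n (hn.trans hMN), fun N w z hs h n hn v hv hr => ?_⟩
    exact h (n + 1) (by omega) v hv (reach_succ'.2 ⟨w, hr, hs⟩)
  have hne : (f.limSet Q).Nonempty := by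
    refine hQ.limSet_nonempty fun N => ?_
    by_contra! hall
    refine hcon N (Subset.antisymm ?_ fun z hz => ?_)
    · refine iUnion₂_subset fun n _ z hz => ?_
      obtain ⟨w, hw, hr⟩ := mem_image_iterate.1 hz
      exact hr.mem hw.2
    · have := hall z hz
      simp only [Q, not_forall, not_not] at this
      obtain ⟨n, hn, w, hw, hr⟩ := this
      exact mem_iUnion₂.2 ⟨n, hn, mem_image_iterate.2 ⟨w, hw, hr⟩⟩
  have hc : f.c ∉ f.limSet Q := by
    intro hc
    obtain ⟨n, V, hV, hreach⟩ := exists_image_mem_nhds_c hf hU hx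
    obtain ⟨z, hz, -, hQz⟩ := hc.2 n V hV
    obtain ⟨w, hw, hr⟩ := hreach z hz
    exact hQz n le_rfl w hw hr
  obtain ⟨g, l, r, p, q, hg, -⟩ := (hQ.isInvariantSet hf hc hne).exists_renormalization hf
  exact hprime ⟨g, l, r, p, q, hg⟩

/-! ### The `α`-limit sets -/

lemma isBackward_alpha (f : LorenzMap) (x : ℝ) :
    f.IsBackward fun N z => ∃ n ≥ N, f.Reach n z x := by
  refine ⟨fun M N z hMN ⟨n, hn, hr⟩ => ⟨n, hMN.trans hn, hr⟩, fun N w z hs ⟨n, hn, hr⟩ => ?_⟩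
  exact ⟨n + 1, by omega, z, hs, hr⟩

lemma alphaLimit_eq_limSet {x : ℝ} (hx : x ∈ f.I) :
    f.alphaLimit x = f.limSet fun N z => ∃ n ≥ N, f.Reach n z x := by
  ext y
  rw [mem_limSet_iff, alphaLimit, mem_iInter]
  refine forall_congr' fun N => ?_
  have : (⋃ k, ⋃ _ : N ≤ k, f.preimage^[k] {x}) = {z | z ∈ f.I ∧ ∃ n ≥ N, f.Reach n z x} := by
    ext z
    simp only [mem_iUnion, mem_preimage_iterate, mem_singleton_iff, exists_eq_left, exists_prop,
      mem_ofPred_eq]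
    exact ⟨fun ⟨n, hn, hr⟩ => ⟨hr.mem_left hx, n, hn, hr⟩, fun h => h.2⟩
  rw [this]

lemma mem_alphaLimit_iff {x y : ℝ} (hx : x ∈ f.I) :
    y ∈ f.alphaLimit x ↔ y ∈ f.I ∧ ∀ N, ∀ U ∈ 𝓝 y, ∃ z ∈ U, ∃ n ≥ N, f.Reach n z x := by
  rw [alphaLimit_eq_limSet hx]
  refine and_congr_right fun _ => forall_congr' fun N => forall₂_congr fun U _ => ?_
  exact ⟨fun ⟨z, hz, _, h⟩ => ⟨z, hz, h⟩, fun ⟨z, hz, n, hn, hr⟩ =>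
    ⟨z, hz, hr.mem_left hx, n, hn, hr⟩⟩

lemma alphaLimit_nonempty (hf : f.IsExpanding) {x : ℝ} (hx : x ∈ f.I) :
    (f.alphaLimit x).Nonempty := by
  rw [alphaLimit_eq_limSet hx]
  refine (isBackward_alpha f x).limSet_nonempty fun N => ?_
  obtain ⟨z, hz, hr⟩ := hf.exists_reach_left N hx
  exact ⟨z, hz, N, le_rfl, hr⟩

/-- Every open set has an image covering a neighbourhood of `c`, so preimages of x near `c` can be
pulled back into it. -/
lemma alphaLimit_eq_I (hf : f.IsExpanding) {x : ℝ} (hx : x ∈ f.I) (hc : f.c ∈ f.alphaLimit x) :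
    f.alphaLimit x = f.I := by
  refine Subset.antisymm (fun y hy => ((mem_alphaLimit_iff hx).1 hy).1) fun y hy => ?_
  refine (mem_alphaLimit_iff hx).2 ⟨hy, fun N U hU => ?_⟩
  obtain ⟨U', hU', hopen, hyU⟩ := mem_nhds_iff.1 hU
  obtain ⟨n, V, hV, hreach⟩ := exists_image_mem_nhds_c hf hopen ⟨hyU, hy⟩
  obtain ⟨z, hz, k, hk, hr⟩ := ((mem_alphaLimit_iff hx).1 hc).2 N V hV
  obtain ⟨w, hw, hr'⟩ := hreach z hz
  exact ⟨w, hU' hw.1, n + k, by omega, hr'.trans hr⟩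

lemma alphaLimit_c (hf : f.IsExpanding) : f.alphaLimit f.c = f.I := by
  refine alphaLimit_eq_I hf f.c_mem ((mem_alphaLimit_iff f.c_mem).2 ⟨f.c_mem, fun N U hU => ?_⟩)
  obtain ⟨s, t, hst, hsub, hI⟩ := exists_Ioo_subset f.c_mem hU
  obtain ⟨n, hn, x, hx, hr⟩ := hf.exists_reach_ge hst (hI.trans Ioo_subset_Icc_self) N
  exact ⟨x, hsub hx, n, hn, hr⟩

lemma isInvariantSet_alphaLimit (hf : f.IsExpanding) {x : ℝ} (hx : x ∈ f.I)
    (hne : f.alphaLimit x ≠ f.I) : f.IsInvariantSet (f.alphaLimit x) := by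
  have hc : f.c ∉ f.alphaLimit x := fun hc => hne (alphaLimit_eq_I hf hx hc)
  have hQ := isBackward_alpha f x
  have heq := alphaLimit_eq_limSet hx
  refine ⟨alphaLimit_nonempty hf hx, heq ▸ isClosed_limSet, ?_, hc, fun y hy => ?_, ?_⟩
  · rw [heq] at hc ⊢
    exact hQ.limSet_subset_Ioo hc
  · have hy' := (mem_alphaLimit_iff hx).1 hy
    have hyc : y ≠ f.c := fun he => hc (he ▸ hy)
    refine (mem_alphaLimit_iff hx).2 ⟨f.mapsTo y hy'.1 hyc, fun N U hU => ?_⟩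
    have hev := eventually_nhdsWithin_iff.1 ((continuousWithinAt_toFun hy'.1 hyc).eventually hU)
    obtain ⟨z, hz, n, hn, hr⟩ := hy'.2 (N + 1) _ (hev.and (isOpen_ne.mem_nhds hyc))
    obtain ⟨m, rfl⟩ : ∃ m, n = m + 1 := ⟨n - 1, by omega⟩
    have hzI := hr.mem_left hx
    obtain ⟨w, hw, hr⟩ := hr
    obtain rfl := hw.eq_of_ne hz.2
    exact ⟨_, hz.1 hzI, m, by omega, hr⟩
  · intro y hy hyc hm
    rw [heq] at hm ⊢
    exact hQ.mem_limSet_of_toFun_mem hy hyc hm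

lemma alphaLimit_subset {K : Set ℝ} (hK : IsClosed K) (h : f.IsCompletelyInvariant K) {x : ℝ}
    (hx : x ∈ K) : f.alphaLimit x ⊆ K := by
  intro y hy
  rw [← hK.closure_eq]
  refine mem_closure_iff_nhds.2 fun U hU => ?_
  obtain ⟨z, hz, n, -, hr⟩ := ((mem_alphaLimit_iff (h.1 hx)).1 hy).2 0 U hU
  exact ⟨z, hz, h.mem_of_reach' hr hx⟩

/-! ### Minimal completely invariant closed sets -/

lemma isCompletelyInvariant_I (hf : f.IsExpanding) : f.IsCompletelyInvariant f.I := by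
  refine ⟨Subset.rfl, hf.image_I, Subset.antisymm ?_ fun x hx => ?_⟩
  · rintro x ⟨y, -, hs⟩
    exact hs.1
  · by_cases hc : x = f.c
    · exact ⟨f.a, f.a_mem, hc ▸ f.step_c_a⟩
    · exact ⟨_, f.mapsTo x hx hc, step_of_ne hx hc⟩

lemma isMinimalInvariant_I (hf : f.IsExpanding) (hprime : ¬ ∃ g, f.IsRenormalization g) :
    f.IsMinimalInvariant f.I := by
  refine ⟨⟨⟨_, f.c_mem⟩, isClosed_Icc, isCompletelyInvariant_I hf⟩, ?_⟩
  rintro K ⟨hne, hcl, hK⟩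
  by_contra hsub
  obtain ⟨g, l, r, p, q, hg, -⟩ := (hK.isInvariantSet hf hcl hne fun he =>
    hsub he.ge).exists_renormalization hf
  exact hprime ⟨g, l, r, p, q, hg⟩

/-- By the trichotomy, least return times mean the largest critical interval, which the fewest
points avoid. -/
lemma IsStrictRenormalization.isMinimalInvariant (hf : f.IsExpanding) (hnd : f.NoFixedEndpoint)
    {l r : ℕ} {p q : ℝ} (h : f.IsStrictRenormalization g l r p q)
    (hmin : ∀ (g' : LorenzMap) (l' r' : ℕ) (p' q' : ℝ),
      f.IsRenormalizationWith g' l' r' p' q' → l ≤ l' ∧ r ≤ r') :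
    f.IsMinimalInvariant (f.avoiding p q) := by
  refine ⟨⟨⟨p, h.p_mem_avoiding⟩, isClosed_avoiding h.c_mem, h.isCompletelyInvariant hf⟩, ?_⟩
  rintro K ⟨hne, hcl, hK⟩
  by_cases hI : K = f.I
  · exact fun x hx => hI ▸ hx.1
  obtain ⟨g', l', r', p', q', hg', rfl⟩ :=
    (hK.isInvariantSet hf hcl hne hI).exists_eq_avoiding hf hnd
  rcases h.trichotomy hf hg'.toIsRenormalizationWith with ⟨rfl, rfl⟩ | ⟨h1, h2, -⟩ | ⟨-, -, h3, -⟩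
  · exact Subset.rfl
  · exact avoiding_anti (h.p_lt.trans h1).le (h2.trans h.lt_q).le
  · exact absurd (hmin _ _ _ _ _ hg'.toIsRenormalizationWith).1 h3.not_ge

namespace IsMinimalInvariant

variable {D : Set ℝ}

lemma isInvariantSet (hf : f.IsExpanding) (h : f.IsMinimalInvariant D) (hI : D ≠ f.I) :
    f.IsInvariantSet D :=
  h.1.2.2.isInvariantSet hf h.1.2.1 h.1.1 hI

lemma alphaLimit_eq (hf : f.IsExpanding) (hnd : f.NoFixedEndpoint) (h : f.IsMinimalInvariant D)
    (hI : D ≠ f.I) {x : ℝ} (hx : x ∈ D) : f.alphaLimit x = D := by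
  have hsub := alphaLimit_subset h.1.2.1 h.1.2.2 hx
  have hne : f.alphaLimit x ≠ f.I := fun he =>
    hI (Subset.antisymm h.1.2.2.1 (he ▸ hsub))
  have hinv := isInvariantSet_alphaLimit hf (h.1.2.2.1 hx) hne
  refine Subset.antisymm hsub (h.2 ⟨hinv.nonempty, hinv.isClosed, ?_⟩)
  obtain ⟨g, l, r, p, q, hg, he⟩ := hinv.exists_eq_avoiding hf hnd
  rw [he]
  exact hg.isCompletelyInvariant hf

lemma exists_reach_near {x : ℝ} {n : ℕ} (ha : f.Avoids n x)
    (hI : ∀ j < n, f.toFun^[j] x ∈ Ioo f.a f.b) {U : Set ℝ} (hU : U ∈ 𝓝 x) :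
    ∃ V ∈ 𝓝 (f.toFun^[n] x), ∀ y ∈ V, ∃ w ∈ U, f.Reach n w y := by
  induction n with
  | zero => exact ⟨U, hU, fun y hy => ⟨y, hy, rfl⟩⟩
  | succ n ih =>
    obtain ⟨h1, h2⟩ := avoids_succ.1 ha
    obtain ⟨V, hV, hr⟩ := ih h1 fun j hj => hI j (by omega)
    obtain ⟨W, hW, hs⟩ := exists_step_near (hI n n.lt_succ_self) h2 hV
    rw [Function.iterate_succ_apply']
    refine ⟨W, hW, fun y hy => ?_⟩
    obtain ⟨z, hz, hzs⟩ := hs y hy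
    obtain ⟨w, hw, hwr⟩ := hr z hz
    exact ⟨w, hw, reach_succ'.2 ⟨z, hwr, hzs⟩⟩

/-- For each z in D the α-limit set is all of D, so U contains a preimage of z. Local openness then
covers a neighbourhood of z in D, and finitely many of these suffice by compactness. -/
lemma isLeoOn (hf : f.IsExpanding) (hnd : f.NoFixedEndpoint) (h : f.IsMinimalInvariant D)
    (hI : D ≠ f.I) : f.IsLeoOn D := by
  rintro U hU ⟨y, hyU, hyD⟩
  have hinv := h.isInvariantSet hf hI
  have hloc : ∀ z ∈ D, ∃ n, ∃ V ∈ 𝓝 z, ∀ y ∈ V ∩ D, ∃ w ∈ U ∩ D, f.Reach n w y := by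
    intro z hz
    have hzI := h.1.2.2.1 hz
    rw [← h.alphaLimit_eq hf hnd hI hz] at hyD
    obtain ⟨w, hw, n, -, hr⟩ := ((mem_alphaLimit_iff hzI).1 hyD).2 0 U (hU.mem_nhds hyU)
    have hwD := h.1.2.2.mem_of_reach' hr hz
    obtain ⟨V, hV, hnear⟩ := exists_reach_near (hinv.avoids hwD n)
      (fun j _ => hinv.subset (hinv.iterate_mem hwD j)) (hU.mem_nhds hw)
    rw [← (hinv.avoids hwD n).reach_iff.1 hr] at hV
    refine ⟨n, V, hV, fun y hy => ?_⟩
    obtain ⟨w', hw', hr'⟩ := hnear y hy.1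
    exact ⟨w', ⟨hw', h.1.2.2.mem_of_reach' hr' hy.2⟩, hr'⟩
  choose! n V hV hVn using hloc
  obtain ⟨t, ht, hcov⟩ := hinv.isCompact.elim_nhds_subcover V hV
  refine ⟨t.sup n, Subset.antisymm ?_ fun x hx => ?_⟩
  · refine iUnion₂_subset fun k _ x hx => ?_
    obtain ⟨w, hw, hr⟩ := mem_image_iterate.1 hx
    exact h.1.2.2.mem_of_reach hr hw.2
  · obtain ⟨z, hz, hxz⟩ := mem_iUnion₂.1 (hcov hx)
    obtain ⟨w, hw, hr⟩ := hVn z (ht z hz) x ⟨hxz, hx⟩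
    exact mem_iUnion₂.2 ⟨n z, Finset.le_sup hz, mem_image_iterate.2 ⟨w, hw, hr⟩⟩

/-- A proper minimal completely invariant closed set is a periodic orbit or perfect. -/
lemma periodic_or_preperfect (hf : f.IsExpanding) (hnd : f.NoFixedEndpoint)
    (h : f.IsMinimalInvariant D) (hI : D ≠ f.I) :
    (∃ x ∈ D, ∃ n, 1 ≤ n ∧ f.Reach n x x ∧ D ⊆ f.orb {x}) ∨ Preperfect D := by
  by_cases hp : Preperfect D
  · exact Or.inr hp
  left
  simp only [Preperfect, not_forall] at hp
  obtain ⟨y, hy, hacc⟩ := hp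
  rw [accPt_iff_nhds] at hacc
  push Not at hacc
  obtain ⟨U, hU, hUy⟩ := hacc
  -- The point y is isolated in D and is an α-limit point of every z in D, so it must itself be a
  -- preimage of z.
  have key : ∀ z ∈ D, ∃ n, 1 ≤ n ∧ f.Reach n y z := by
    intro z hz
    have hy' := hy
    rw [← h.alphaLimit_eq hf hnd hI hz] at hy'
    obtain ⟨w, hw, n, hn, hr⟩ := ((mem_alphaLimit_iff (h.1.2.2.1 hz)).1 hy').2 1 U hU
    obtain rfl := hUy w ⟨hw, h.1.2.2.mem_of_reach' hr hz⟩
    exact ⟨n, hn, hr⟩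
  obtain ⟨n, hn, hr⟩ := key y hy
  refine ⟨y, hy, n, hn, hr, fun z hz => ?_⟩
  obtain ⟨m, -, hm⟩ := key z hz
  exact mem_orb.2 ⟨y, rfl, m, hm⟩

end IsMinimalInvariant

/-! ### The orbit of the renormalization interval -/

lemma image_orb_subset {S : Set ℝ} : f.image (f.orb S) ⊆ f.orb S := by
  rintro y ⟨x, hx, hs⟩
  obtain ⟨w, hw, n, hr⟩ := mem_orb.1 hx
  exact mem_orb.2 ⟨w, hw, n + 1, reach_succ'.2 ⟨x, hr, hs⟩⟩

namespace Induced

variable {l r : ℕ} {p q : ℝ}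

/-- Only points of S itself need an argument: they are images under `g`, hence reached by `f` in
positive time. -/
lemma image_orb (h : f.Induced g l r p q) {S : Set ℝ} (hS : S ⊆ g.image S) :
    f.image (f.orb S) = f.orb S := by
  refine Subset.antisymm image_orb_subset fun y hy => ?_
  obtain ⟨x, hx, n, hr⟩ := mem_orb.1 hy
  have key : ∀ m, 1 ≤ m → ∀ z ∈ S, f.Reach m z y → y ∈ f.image (f.orb S) := by
    intro m hm z hz hr
    obtain ⟨m, rfl⟩ : ∃ m', m = m' + 1 := ⟨m - 1, by omega⟩
    obtain ⟨w, hw, hs⟩ := reach_succ'.1 hr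
    exact ⟨w, mem_orb.2 ⟨z, hz, m, hw⟩, hs⟩
  cases n with
  | zero =>
    obtain rfl : x = y := hr
    obtain ⟨w, hw, hs⟩ := hS hx
    obtain ⟨k, hk, -, hr⟩ := h.reach_of_step hs
    exact key k hk w hw hr
  | succ n => exact key _ (by omega) x hx hr

lemma branch_left (h : f.Induced g l r p q) {k : ℕ} (hk : k < l) :
    StrictMonoOn f.toFun^[k + 1] (Ico g.a f.c) ∧ ContinuousOn f.toFun^[k + 1] (Ico g.a f.c) :=
  branch ordConnected_Ico fun x hx => (h.left x hx).1.mono hk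

lemma iterate_lt_left (h : f.Induced g l r p q) {k : ℕ} (hk : k < l) {x : ℝ}
    (hx : x ∈ Ico g.a f.c) : f.toFun^[k + 1] x < f.toFun^[k] f.b :=
  lt_of_strictMonoOn_of_tendsto (h.branch_left hk).1 (tendsto_iterate_left (h.avoids_b hk)) hx

lemma exists_eq_left (h : f.Induced g l r p q) {k : ℕ} (hk : k < l) {y : ℝ}
    (hy : y ∈ Ico (f.toFun^[k + 1] g.a) (f.toFun^[k] f.b)) :
    ∃ x ∈ Ico g.a f.c, f.toFun^[k + 1] x = y := by
  obtain ⟨x, hx, hxc⟩ := (((tendsto_iterate_left (h.avoids_b hk)).eventually_const_lt hy.2).and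
    (Ioo_mem_nhdsLT h.a_lt_c)).exists
  obtain ⟨z, hz, hzy⟩ := intermediate_value_Icc hxc.1.le
    ((h.branch_left hk).2.mono fun z hz => ⟨hz.1, hz.2.trans_lt hxc.2⟩) ⟨hy.1, hx.le⟩
  exact ⟨z, ⟨hz.1, hz.2.trans_lt hxc.2⟩, hzy⟩

lemma branch_right (h : f.Induced g l r p q) {k : ℕ} (hk : k < r) :
    StrictMonoOn f.toFun^[k + 1] (Ioc f.c g.b) ∧ ContinuousOn f.toFun^[k + 1] (Ioc f.c g.b) :=
  branch ordConnected_Ioc fun x hx => (h.right x hx).1.mono hk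

lemma lt_iterate_right (h : f.Induced g l r p q) {k : ℕ} (hk : k < r) {x : ℝ}
    (hx : x ∈ Ioc f.c g.b) : f.toFun^[k] f.a < f.toFun^[k + 1] x := by
  have := h.reflect.iterate_lt_left hk (x := -x) ⟨neg_le_neg hx.2, neg_lt_neg hx.1⟩
  rw [reflect_iterate, reflect_iterate, neg_neg, reflect_b, neg_neg] at this
  exact neg_lt_neg_iff.1 this

lemma exists_eq_right (h : f.Induced g l r p q) {k : ℕ} (hk : k < r) {y : ℝ}
    (hy : y ∈ Ioc (f.toFun^[k] f.a) (f.toFun^[k + 1] g.b)) :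
    ∃ x ∈ Ioc f.c g.b, f.toFun^[k + 1] x = y := by
  obtain ⟨x, hx, hxy⟩ := h.reflect.exists_eq_left hk (y := -y) (by
    rw [reflect_iterate, reflect_iterate, reflect_a, neg_neg, reflect_b, neg_neg]
    exact ⟨neg_le_neg hy.2, neg_lt_neg hy.1⟩)
  rw [reflect_iterate, neg_inj] at hxy
  exact ⟨-x, ⟨by linarith [hx.2, f.reflect_c], by linarith [hx.1, g.reflect_a]⟩, hxy⟩

lemma reach_c_iterate_b (h : f.Induced g l r p q) {k : ℕ} (hk : k < l) :
    f.Reach (k + 1) f.c (f.toFun^[k] f.b) := ⟨f.b, f.step_c_b, (h.avoids_b hk).reach⟩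

lemma reach_c_iterate_a (h : f.Induced g l r p q) {k : ℕ} (hk : k < r) :
    f.Reach (k + 1) f.c (f.toFun^[k] f.a) := ⟨f.a, f.step_c_a, (h.avoids_a hk).reach⟩

/-- Every point of the orbit of `g.I` lies in one of the intervals visited by the two branches. -/
lemma mem_piece (hg : g.IsExpanding) (h : f.Induced g l r p q) {y : ℝ} (hy : y ∈ f.orb g.I) :
    (∃ k < l, y ∈ Icc (f.toFun^[k + 1] g.a) (f.toFun^[k] f.b)) ∨
      ∃ k < r, y ∈ Icc (f.toFun^[k] f.a) (f.toFun^[k + 1] g.b) := by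
  classical
  have hl := h.one_le_l
  have hr1 := h.one_le_r
  have hleft : ∀ k < l, ∀ x ∈ Ico g.a f.c,
      f.toFun^[k + 1] x ∈ Icc (f.toFun^[k + 1] g.a) (f.toFun^[k] f.b) := fun k hk x hx =>
    ⟨(h.branch_left hk).1.monotoneOn ⟨le_rfl, h.a_lt_c⟩ hx hx.1, (h.iterate_lt_left hk hx).le⟩
  have hright : ∀ k < r, ∀ x ∈ Ioc f.c g.b,
      f.toFun^[k + 1] x ∈ Icc (f.toFun^[k] f.a) (f.toFun^[k + 1] g.b) := fun k hk x hx =>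
    ⟨(h.lt_iterate_right hk hx).le, (h.branch_right hk).1.monotoneOn hx ⟨h.c_lt_b, le_rfl⟩ hx.2⟩
  have hbmem : ∀ k < l, f.toFun^[k] f.b ∈ Icc (f.toFun^[k + 1] g.a) (f.toFun^[k] f.b) :=
    fun k hk => ⟨(h.iterate_lt_left hk ⟨le_rfl, h.a_lt_c⟩).le, le_rfl⟩
  have hamem : ∀ k < r, f.toFun^[k] f.a ∈ Icc (f.toFun^[k] f.a) (f.toFun^[k + 1] g.b) :=
    fun k hk => ⟨le_rfl, (h.lt_iterate_right hk ⟨h.c_lt_b, le_rfl⟩).le⟩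
  have hex : ∃ n, ∃ x ∈ g.I, f.Reach n x y := by
    obtain ⟨x, hx, n, hr⟩ := mem_orb.1 hy
    exact ⟨n, x, hx, hr⟩
  -- A shortest itinerary is shorter than a full return or is a single completed return. If its
  -- length is 0, surjectivity of `g` makes y the end of a full return.
  obtain ⟨x, hx, hr⟩ := Nat.find_spec hex
  have hmin : ∀ m < Nat.find hex, ∀ z ∈ g.I, ¬ f.Reach m z y := fun m hm z hz hr' =>
    Nat.find_min hex hm ⟨z, hz, hr'⟩
  generalize Nat.find hex = n at hr hmin
  cases n with
  | zero =>
    obtain rfl : x = y := hr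
    obtain ⟨w, hw⟩ := hg.exists_step hx
    rcases lt_trichotomy w f.c with hwc | hwc | hwc
    · left
      have hw' : w ∈ Ico g.a f.c := ⟨hw.1.1, hwc⟩
      have := hleft (l - 1) (by omega) w hw'
      rw [Nat.sub_add_cancel hl, ← (h.left w hw').2, ← hw.eq_of_ne (h.c_eq ▸ hwc.ne)] at this
      exact ⟨l - 1, by omega, by rwa [Nat.sub_add_cancel hl]⟩
    · rw [hwc, ← h.c_eq] at hw
      rcases hw.of_c with rfl | rfl
      · exact Or.inr ⟨r - 1, by omega, by
          have := hamem (r - 1) (by omega)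
          rwa [h.iterate_a] at this ⊢⟩
      · exact Or.inl ⟨l - 1, by omega, by
          have := hbmem (l - 1) (by omega)
          rwa [h.iterate_b] at this ⊢⟩
    · right
      have hw' : w ∈ Ioc f.c g.b := ⟨hwc, hw.1.2⟩
      have := hright (r - 1) (by omega) w hw'
      rw [Nat.sub_add_cancel hr1, ← (h.right w hw').2, ← hw.eq_of_ne (h.c_eq ▸ hwc.ne')] at this
      exact ⟨r - 1, by omega, by rwa [Nat.sub_add_cancel hr1]⟩
  | succ n =>
    rcases lt_trichotomy x f.c with hxc | rfl | hxc
    · left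
      have hx' : x ∈ Ico g.a f.c := ⟨hx.1, hxc⟩
      obtain ⟨ha, hgx⟩ := h.left x hx'
      rcases lt_or_ge n l with hn | hn
      · rw [(ha.mono hn).reach_iff.1 hr]
        exact ⟨n, hn, hleft n hn x hx'⟩
      · rw [show n + 1 = l + (n + 1 - l) by omega, reach_add] at hr
        obtain ⟨z, hz, hr⟩ := hr
        rw [ha.reach_iff.1 hz, ← hgx] at hr
        exact absurd hr (hmin _ (by omega) _ (g.mapsTo x hx (h.c_eq ▸ hxc.ne)))
    · obtain ⟨w, hw, hr⟩ := hr
      rcases hw.of_c with rfl | rfl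
      · right
        rcases lt_or_ge n r with hn | hn
        · rw [(h.avoids_a hn).reach_iff.1 hr]
          exact ⟨n, hn, hamem n hn⟩
        · rw [show n = (r - 1) + (n - (r - 1)) by omega, reach_add] at hr
          obtain ⟨z, hz, hr⟩ := hr
          rw [(h.avoids_a (k := r - 1) (by omega)).reach_iff.1 hz, h.iterate_a] at hr
          exact absurd hr (hmin _ (by omega) _ g.a_mem)
      · left
        rcases lt_or_ge n l with hn | hn
        · rw [(h.avoids_b hn).reach_iff.1 hr]
          exact ⟨n, hn, hbmem n hn⟩
        · rw [show n = (l - 1) + (n - (l - 1)) by omega, reach_add] at hr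
          obtain ⟨z, hz, hr⟩ := hr
          rw [(h.avoids_b (k := l - 1) (by omega)).reach_iff.1 hz, h.iterate_b] at hr
          exact absurd hr (hmin _ (by omega) _ g.b_mem)
    · right
      have hx' : x ∈ Ioc f.c g.b := ⟨hxc, hx.2⟩
      obtain ⟨ha, hgx⟩ := h.right x hx'
      rcases lt_or_ge n r with hn | hn
      · rw [(ha.mono hn).reach_iff.1 hr]
        exact ⟨n, hn, hright n hn x hx'⟩
      · rw [show n + 1 = r + (n + 1 - r) by omega, reach_add] at hr
        obtain ⟨z, hz, hr⟩ := hr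
        rw [ha.reach_iff.1 hz, ← hgx] at hr
        exact absurd hr (hmin _ (by omega) _ (g.mapsTo x hx (h.c_eq ▸ hxc.ne')))

lemma left_piece_subset (h : f.Induced g l r p q) {k : ℕ} (hk : k < l) :
    Icc (f.toFun^[k + 1] g.a) (f.toFun^[k] f.b) ⊆ f.orb g.I := by
  intro y hy
  rcases eq_or_lt_of_le hy.2 with rfl | hlt
  · exact mem_orb.2 ⟨f.c, h.c_mem, _, h.reach_c_iterate_b hk⟩
  · obtain ⟨x, hx, rfl⟩ := h.exists_eq_left hk ⟨hy.1, hlt⟩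
    exact mem_orb.2 ⟨x, ⟨hx.1, (hx.2.trans h.c_lt_b).le⟩, _, ((h.left x hx).1.mono hk).reach⟩

lemma right_piece_subset (h : f.Induced g l r p q) {k : ℕ} (hk : k < r) :
    Icc (f.toFun^[k] f.a) (f.toFun^[k + 1] g.b) ⊆ f.orb g.I := by
  intro y hy
  rcases eq_or_lt_of_le hy.1 with rfl | hlt
  · exact mem_orb.2 ⟨f.c, h.c_mem, _, h.reach_c_iterate_a hk⟩
  · obtain ⟨x, hx, rfl⟩ := h.exists_eq_right hk ⟨hlt, hy.2⟩
    exact mem_orb.2 ⟨x, ⟨(h.a_lt_c.trans hx.1).le, hx.2⟩, _, ((h.right x hx).1.mono hk).reach⟩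

lemma isFiniteUnionOfIntervals_orb (hg : g.IsExpanding) (h : f.Induced g l r p q) :
    IsFiniteUnionOfIntervals (f.orb g.I) := by
  classical
  refine ⟨(Finset.range l).image (fun k => (f.toFun^[k + 1] g.a, f.toFun^[k] f.b)) ∪
    (Finset.range r).image (fun k => (f.toFun^[k] f.a, f.toFun^[k + 1] g.b)), ?_, ?_⟩
  · intro t ht
    rcases Finset.mem_union.1 ht with ht | ht
    · obtain ⟨k, hk, rfl⟩ := Finset.mem_image.1 ht
      exact h.iterate_lt_left (Finset.mem_range.1 hk) ⟨le_rfl, h.a_lt_c⟩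
    · obtain ⟨k, hk, rfl⟩ := Finset.mem_image.1 ht
      exact h.lt_iterate_right (Finset.mem_range.1 hk) ⟨h.c_lt_b, le_rfl⟩
  · refine Subset.antisymm (fun y hy => ?_) (iUnion₂_subset fun t ht => ?_)
    · rcases h.mem_piece hg hy with ⟨k, hk, hy⟩ | ⟨k, hk, hy⟩
      · exact mem_iUnion₂.2 ⟨_, Finset.mem_union_left _
          (Finset.mem_image_of_mem _ (Finset.mem_range.2 hk)), hy⟩
      · exact mem_iUnion₂.2 ⟨_, Finset.mem_union_right _
          (Finset.mem_image_of_mem _ (Finset.mem_range.2 hk)), hy⟩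
    · rcases Finset.mem_union.1 ht with ht | ht
      · obtain ⟨k, hk, rfl⟩ := Finset.mem_image.1 ht
        exact h.left_piece_subset (Finset.mem_range.1 hk)
      · obtain ⟨k, hk, rfl⟩ := Finset.mem_image.1 ht
        exact h.right_piece_subset (Finset.mem_range.1 hk)

lemma isClosed_orb (hg : g.IsExpanding) (h : f.Induced g l r p q) : IsClosed (f.orb g.I) := by
  obtain ⟨T, -, hT⟩ := h.isFiniteUnionOfIntervals_orb hg
  rw [hT]
  exact T.finite_toSet.isClosed_biUnion fun t _ => isClosed_Icc

/-- Local eventual onto-ness passes from the induced map on `S` to the whole map on `orb S`. -/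
lemma isLeoOn_orb (h : f.Induced g l r p q) {S : Set ℝ} (hSI : S ⊆ g.I) (hS : g.image S = S)
    (hleo : g.IsLeoOn S) (hdense : ∀ U, IsOpen U → (U ∩ f.orb S).Nonempty →
      ∃ x ∈ S, ∃ k, f.Avoids k x ∧ f.toFun^[k] x ∈ U) : f.IsLeoOn (f.orb S) := by
  have hfwd : ∀ n x y, x ∈ S → g.Reach n x y → y ∈ S := by
    intro n
    induction n with
    | zero => exact fun x y hx hr => hr ▸ hx
    | succ n ih =>
      rintro x y hx ⟨z, hz, hr⟩
      exact ih z y (hS ▸ ⟨x, hx, hz⟩) hr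
  have hbwd : ∀ n, ∀ y ∈ S, ∃ x ∈ S, g.Reach n x y := by
    intro n
    induction n with
    | zero => exact fun y hy => ⟨y, hy, rfl⟩
    | succ n ih =>
      intro y hy
      obtain ⟨z, hz, hs⟩ := hS.ge hy
      obtain ⟨x, hx, hr⟩ := ih z hz
      exact ⟨x, hx, reach_succ'.2 ⟨z, hr, hs⟩⟩
  intro U hU hne
  obtain ⟨x, hx, k, ha, hxU⟩ := hdense U hU hne
  -- The open set is pulled back to a neighbourhood of a point of S, where l.e.o. of `g` applies.
  have hev : ∀ᶠ z in 𝓝 x, z ∈ f.I → f.Avoids k z ∧ f.toFun^[k] z ∈ U :=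
    eventually_nhdsWithin_iff.1
      (ha.eventually.and (ha.continuousWithinAt.eventually (hU.mem_nhds hxU)))
  obtain ⟨V, hV, hVo, hxV⟩ := mem_nhds_iff.1 hev
  obtain ⟨N, hN⟩ := hleo V hVo ⟨x, hxV, hx⟩
  refine ⟨(N + k) * max l r + max l r, Subset.antisymm ?_ fun y hy => ?_⟩
  · refine iUnion₂_subset fun n _ y hy => ?_
    obtain ⟨z, hz, hr⟩ := mem_image_iterate.1 hy
    obtain ⟨w, hw, m, hm⟩ := mem_orb.1 hz.2
    exact mem_orb.2 ⟨w, hw, _, hm.trans hr⟩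
  · obtain ⟨s, hs, n, hr⟩ := mem_orb.1 hy
    obtain ⟨i, z, j, hr1, hr2, hj, -⟩ := h.decompose (hSI hs) hr
    -- Going back k extra steps of `g` makes the total time at least k, so that the first k steps,
    -- which lead into U, can be cut off.
    obtain ⟨z', hz', hzz⟩ := hbwd k z (hfwd _ _ _ hs hr1)
    rw [← hN] at hz'
    obtain ⟨n', hn', hz'⟩ := mem_iUnion₂.1 hz'
    obtain ⟨w, hw, hwz⟩ := mem_image_iterate.1 hz'
    obtain ⟨m, hm1, hm2, hm⟩ := h.reach_of_reach (hwz.trans hzz)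
    have hwI := h.subset (hSI hw.2)
    obtain ⟨haw, hwU⟩ := hV hw.1 hwI
    have htot := hm.trans hr2
    have hm3 : m ≤ (N + k) * max l r := hm2.trans (Nat.mul_le_mul_right _ (by omega))
    rw [show m + j = k + (m + j - k) by omega, reach_add] at htot
    obtain ⟨v, hv, hvy⟩ := htot
    rw [haw.reach_iff.1 hv] at hvy
    exact mem_iUnion₂.2 ⟨m + j - k, by omega, mem_image_iterate.2
      ⟨_, ⟨hwU, mem_orb.2 ⟨w, hw.2, k, haw.reach⟩⟩, hvy⟩⟩

/-- A point of the orbit may be reached only through `c`; it is then a one-sided limit of points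
reached without meeting `c`. -/
lemma exists_iterate_mem_of_isOpen (hg : g.IsExpanding) (h : f.Induced g l r p q) {U : Set ℝ}
    (hU : IsOpen U) (hne : (U ∩ f.orb g.I).Nonempty) :
    ∃ x ∈ g.I, ∃ k, f.Avoids k x ∧ f.toFun^[k] x ∈ U := by
  obtain ⟨y, hyU, hy⟩ := hne
  rcases h.mem_piece hg hy with ⟨k, hk, hy⟩ | ⟨k, hk, hy⟩
  · obtain ⟨x, hx, hxU⟩ : ∃ x ∈ Ico g.a f.c, f.toFun^[k + 1] x ∈ U := by
      rcases eq_or_lt_of_le hy.2 with rfl | hlt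
      · obtain ⟨x, hx, hxc⟩ := (((tendsto_iterate_left (h.avoids_b hk)).eventually
          (hU.mem_nhds hyU)).and (Ioo_mem_nhdsLT h.a_lt_c)).exists
        exact ⟨x, ⟨hxc.1.le, hxc.2⟩, hx⟩
      · obtain ⟨x, hx, rfl⟩ := h.exists_eq_left hk ⟨hy.1, hlt⟩
        exact ⟨x, hx, hyU⟩
    exact ⟨x, ⟨hx.1, (hx.2.trans h.c_lt_b).le⟩, k + 1, (h.left x hx).1.mono hk, hxU⟩
  · obtain ⟨x, hx, hxU⟩ : ∃ x ∈ Ioc f.c g.b, f.toFun^[k + 1] x ∈ U := by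
      rcases eq_or_lt_of_le hy.1 with rfl | hlt
      · have ht := tendsto_iterate_left (h.reflect.avoids_b hk)
        obtain ⟨x, hx, hxc⟩ := ((ht.eventually ((hU.preimage continuous_neg).mem_nhds (by
          simpa [reflect_iterate] using hyU))).and (Ioo_mem_nhdsLT h.reflect.a_lt_c)).exists
        refine ⟨-x, ⟨by linarith [hxc.2, f.reflect_c], by linarith [hxc.1, g.reflect_a]⟩, ?_⟩
        simpa only [reflect_iterate, mem_preimage, neg_neg] using hx
      · obtain ⟨x, hx, rfl⟩ := h.exists_eq_right hk ⟨hlt, hy.2⟩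
        exact ⟨x, hx, hyU⟩
    exact ⟨x, ⟨(h.a_lt_c.trans hx.1).le, hx.2⟩, k + 1, (h.right x hx).1.mono hk, hxU⟩

end Induced

/-! ### Entering the renormalization interval -/

namespace IsStrictRenormalization

variable {l r : ℕ} {p q : ℝ}

/-- The branch f^l pushes the point to the right. If it never passed `g.a`, its iterates would
converge to a fixed point of the branch in (p, c), and there is none. -/
lemma exists_iterate_mem_of_le (hf : f.IsExpanding) (h : f.IsStrictRenormalization g l r p q)
    {x : ℝ} (hx : x ∈ Ioc p g.a) : ∃ n, f.Avoids n x ∧ f.toFun^[n] x ∈ Ioo g.a g.b := by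
  by_contra! hcon
  have hac : g.a < f.c := h.c_eq ▸ g.a_lt_c
  have hall : ∀ k, f.Avoids (l * k) x ∧ (f.toFun^[l])^[k] x ∈ Ioc p g.a := by
    intro k
    induction k with
    | zero => exact ⟨avoids_zero (h.Ioo_left_subset ⟨hx.1, hx.2.trans_lt hac⟩), hx⟩
    | succ k ih =>
      obtain ⟨h1, h2⟩ := ih
      have hmem : (f.toFun^[l])^[k] x ∈ Ioo p f.c := ⟨h2.1, h2.2.trans_lt hac⟩
      have ha : f.Avoids (l * (k + 1)) x := by
        rw [Nat.mul_succ]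
        refine avoids_add.2 ⟨h1, ?_⟩
        rw [Function.iterate_mul]
        exact h.avoids_left ⟨hmem.1.le, hmem.2⟩
      have h3 := h.iterate_left_mem hmem
      refine ⟨ha, ?_⟩
      rw [Function.iterate_succ_apply']
      refine ⟨h3.1, ?_⟩
      by_contra! hlt
      refine hcon _ ha ?_
      rw [Function.iterate_mul, Function.iterate_succ_apply']
      exact ⟨hlt, h3.2⟩
  have hmono : Monotone fun k => (f.toFun^[l])^[k] x := by
    refine monotone_nat_of_le_succ fun k => ?_
    rw [Function.iterate_succ_apply']
    exact (h.lt_iterate_left hf ⟨(hall k).2.1, (hall k).2.2.trans_lt hac⟩).le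
  have hbdd : BddAbove (range fun k => (f.toFun^[l])^[k] x) :=
    ⟨g.a, by rintro _ ⟨k, rfl⟩; exact (hall k).2.2⟩
  have ht := tendsto_atTop_ciSup hmono hbdd
  set y := ⨆ k, (f.toFun^[l])^[k] x with hy
  have hxy : x ≤ y := le_ciSup hbdd 0
  have hya : y ≤ g.a := ciSup_le fun k => (hall k).2.2
  have hy' : y ∈ Ioo p f.c := ⟨hx.1.trans_le hxy, hya.trans_lt hac⟩
  have hcont : ContinuousAt f.toFun^[l] y :=
    ((h.continuousOn_left le_rfl) y ⟨hy'.1.le, hy'.2⟩).continuousAt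
      (Filter.mem_of_superset (Ioo_mem_nhds hy'.1 hy'.2) Ioo_subset_Ico_self)
  exact (h.lt_iterate_left hf hy').ne' (isFixedPt_of_tendsto_iterate ht hcont)

/-- The orbits of the points of the critical interval enter the interior of the renormalization
interval. -/
lemma exists_iterate_mem (hf : f.IsExpanding) (h : f.IsStrictRenormalization g l r p q) {x : ℝ}
    (hx : x ∈ Ioo p q) : ∃ n, f.Avoids n x ∧ f.toFun^[n] x ∈ Ioo g.a g.b := by
  rcases le_or_gt x g.a with h1 | h1
  · exact h.exists_iterate_mem_of_le hf ⟨hx.1, h1⟩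
  rcases le_or_gt g.b x with h2 | h2
  · obtain ⟨n, ha, hn⟩ := h.reflect.exists_iterate_mem_of_le hf.reflect (x := -x)
      ⟨neg_lt_neg hx.2, neg_le_neg h2⟩
    refine ⟨n, by simpa [reflect_avoids] using ha, ?_⟩
    simpa [reflect_iterate, and_comm] using hn
  · exact ⟨0, avoids_zero (h.Ioo_subset hx), h1, h2⟩

lemma exists_iterate_mem_of_notMem (hf : f.IsExpanding)
    (h : f.IsStrictRenormalization g l r p q) {x : ℝ} (hx : x ∈ f.I)
    (hn : x ∉ f.avoiding p q) : ∃ n, f.Avoids n x ∧ f.toFun^[n] x ∈ Ioo g.a g.b := by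
  obtain ⟨n, ha, hmem⟩ := exists_iterate_of_notMem_avoiding h.c_mem hx hn
  obtain ⟨m, hm, hmem'⟩ := h.exists_iterate_mem hf hmem
  refine ⟨n + m, avoids_add.2 ⟨ha, hm⟩, ?_⟩
  rwa [add_comm, Function.iterate_add_apply]

end IsStrictRenormalization

/-! ### Invariant sets of an induced map -/

lemma Induced.avoiding_eq {l r : ℕ} {p q P Q : ℝ} (h : f.Induced g l r p q)
    (hPQ : Ioo P Q ⊆ Ioo p q) : g.avoiding P Q = f.avoiding P Q ∩ g.I := by
  ext x
  constructor
  · rintro ⟨hx, hd⟩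
    refine ⟨⟨h.subset hx, disjoint_left.2 fun y hy hy' => ?_⟩, hx⟩
    obtain ⟨_, rfl, n, hr⟩ := mem_orb.1 hy
    obtain ⟨k, hk, -⟩ := h.reach_return hx (hPQ hy') hr
    exact disjoint_left.1 hd (mem_orb.2 ⟨_, rfl, k, hk⟩) hy'
  · rintro ⟨hx, hxI⟩
    refine ⟨hxI, disjoint_left.2 fun y hy hy' => ?_⟩
    obtain ⟨_, rfl, n, hr⟩ := mem_orb.1 hy
    obtain ⟨k, -, -, hk⟩ := h.reach_of_reach hr
    exact notMem_of_mem_avoiding hx hk hy'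

/-- The end points of `g.I` are reached from `c`, so a completely invariant K without `c` misses
them. -/
lemma Induced.isInvariantSet_inter {l r : ℕ} {p q : ℝ} (h : f.Induced g l r p q) {K : Set ℝ}
    (hK : f.IsInvariantSet K) (hci : f.IsCompletelyInvariant K) (hne : (K ∩ g.I).Nonempty) :
    g.IsInvariantSet (K ∩ g.I) := by
  have ha : g.a ∉ K := by
    intro ha
    have hr := h.reach_c_a
    exact hK.c_notMem (hci.mem_of_reach' hr ha)
  have hb : g.b ∉ K := by
    intro hb
    have hr := h.reach_c_b
    exact hK.c_notMem (hci.mem_of_reach' hr hb)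
  refine ⟨hne, hK.isClosed.inter isClosed_Icc, fun x hx => ⟨lt_of_le_of_ne hx.2.1 fun he =>
    ha (he ▸ hx.1), lt_of_le_of_ne hx.2.2 fun he => hb (he ▸ hx.1)⟩,
    fun hc => hK.c_notMem (h.c_eq ▸ hc.1), fun x hx => ?_, fun x hx hxc hm => ?_⟩
  · have hxc : x ≠ g.c := fun he => hK.c_notMem (by rw [← h.c_eq, ← he]; exact hx.1)
    have hs := step_of_ne hx.2 hxc
    obtain ⟨k, -, -, hr⟩ := h.reach_of_step hs
    exact ⟨hci.mem_of_reach hr hx.1, hs.mem⟩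
  · have hs := step_of_ne (Ioo_subset_Icc_self hx) hxc
    obtain ⟨k, -, -, hr⟩ := h.reach_of_step hs
    exact ⟨hci.mem_of_reach' hr hm.1, Ioo_subset_Icc_self hx⟩

/-! ### Towers of renormalizations -/

/-- The sequence `R` of successive minimal renormalizations of `f`, seen as first return maps
of `f` with return times `l i`, `r i` to the critical intervals `(p i, q i)`. -/
structure IsTower (f : LorenzMap) (m : ℕ∞) (R : ℕ → LorenzMap) (l r : ℕ → ℕ) (p q : ℕ → ℝ) :
    Prop where
  zero : R 0 = f
  expanding : ∀ i : ℕ, (i : ℕ∞) ≤ m → (R i).IsExpanding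
  noFixedEndpoint : ∀ i : ℕ, (i : ℕ∞) ≤ m → (R i).NoFixedEndpoint
  induced : ∀ i : ℕ, (i : ℕ∞) ≤ m → f.Induced (R i) (l i) (r i) (p i) (q i)
  strict : ∀ i : ℕ, 1 ≤ i → (i : ℕ∞) ≤ m →
    f.IsStrictRenormalization (R i) (l i) (r i) (p i) (q i)
  minimal : ∀ i : ℕ, ((i + 1 : ℕ) : ℕ∞) ≤ m → ∃ L M : ℕ,
    (R i).IsStrictRenormalization (R (i + 1)) L M (p (i + 1)) (q (i + 1)) ∧
    ∀ (g' : LorenzMap) (l' r' : ℕ) (p' q' : ℝ),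
      (R i).IsRenormalizationWith g' l' r' p' q' → L ≤ l' ∧ M ≤ r'
  last : ∀ i : ℕ, (i : ℕ∞) = m → ¬ ∃ g : LorenzMap, (R i).IsRenormalization g

lemma coe_lt_iff {i : ℕ} {m : ℕ∞} : (i : ℕ∞) < m ↔ ((i + 1 : ℕ) : ℕ∞) ≤ m := by
  rw [Nat.cast_add, Nat.cast_one, ENat.add_one_le_iff (ENat.natCast_ne_top i)]

lemma coe_le_of_le {i j : ℕ} {m : ℕ∞} (hij : i ≤ j) (hj : (j : ℕ∞) ≤ m) : (i : ℕ∞) ≤ m :=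
  (Nat.cast_le.2 hij).trans hj

lemma IsRenormalizationSequence.exists_isTower (hf : f.IsExpanding) (hnd : f.NoFixedEndpoint)
    {m : ℕ∞} {R : ℕ → LorenzMap} (hR : f.IsRenormalizationSequence m R) :
    ∃ l r p q, f.IsTower m R l r p q := by
  have key : ∀ i : ℕ, (i : ℕ∞) ≤ m → ((R i).IsExpanding ∧ (R i).NoFixedEndpoint) ∧
      ∃ l r p q, f.Induced (R i) l r p q ∧ (1 ≤ i → f.IsStrictRenormalization (R i) l r p q) ∧
        ∀ j, i = j + 1 → ∃ L M : ℕ, (R j).IsStrictRenormalization (R (j + 1)) L M p q ∧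
          ∀ (g' : LorenzMap) (l' r' : ℕ) (p' q' : ℝ),
            (R j).IsRenormalizationWith g' l' r' p' q' → L ≤ l' ∧ M ≤ r' := by
    intro i
    induction i with
    | zero =>
      intro _
      rw [hR.zero]
      exact ⟨⟨hf, hnd⟩, 1, 1, _, _, Induced.refl f, fun h => absurd h (by norm_num),
        fun j hj => absurd hj (by omega)⟩
    | succ i ih =>
      intro hi
      obtain ⟨⟨hexp, hndi⟩, l, r, p, q, hind, hstr, -⟩ := ih (coe_le_of_le i.le_succ hi)
      obtain ⟨L, M, P, Q, hren, hmin⟩ := hR.succ i (coe_lt_iff.2 hi)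
      have hcomp : ∃ l' r', f.IsRenormalizationWith (R (i + 1)) l' r' P Q := by
        cases i with
        | zero => exact ⟨L, M, hR.zero ▸ hren⟩
        | succ i => exact (hstr (by omega)).comp hf hren
      obtain ⟨l', r', hren'⟩ := hcomp
      have hstr' := hnd.strict hren'
      have hind' := hstr'.induced hf
      refine ⟨⟨hind'.expanding hf, ?_⟩, l', r', P, Q, hind', fun _ => hstr', fun j hj => ?_⟩
      · rintro h ⟨a, b, s, t, hh⟩
        obtain ⟨_, _, hh'⟩ := hstr'.comp hf hh
        exact hnd h ⟨_, _, _, _, hh'⟩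
      · obtain rfl : i = j := by omega
        exact ⟨L, M, hndi.strict hren, hmin⟩
  have key' : ∀ i : ℕ, ∃ l r p q, (i : ℕ∞) ≤ m → f.Induced (R i) l r p q ∧
      (1 ≤ i → f.IsStrictRenormalization (R i) l r p q) ∧
        ∀ j, i = j + 1 → ∃ L M : ℕ, (R j).IsStrictRenormalization (R (j + 1)) L M p q ∧
          ∀ (g' : LorenzMap) (l' r' : ℕ) (p' q' : ℝ),
            (R j).IsRenormalizationWith g' l' r' p' q' → L ≤ l' ∧ M ≤ r' := by
    intro i
    by_cases hi : (i : ℕ∞) ≤ m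
    · obtain ⟨-, l, r, p, q, h⟩ := key i hi
      exact ⟨l, r, p, q, fun _ => h⟩
    · exact ⟨0, 0, 0, 0, fun h => absurd h hi⟩
  choose l r p q h using key'
  exact ⟨l, r, p, q, hR.zero, fun i hi => (key i hi).1.1, fun i hi => (key i hi).1.2,
    fun i hi => (h i hi).1, fun i h1 hi => (h i hi).2.1 h1, fun i hi => (h _ hi).2.2 i rfl, hR.last⟩

namespace IsTower

variable {m : ℕ∞} {R : ℕ → LorenzMap} {l r : ℕ → ℕ} {p q : ℕ → ℝ}

lemma isExpanding (h : f.IsTower m R l r p q) : f.IsExpanding := h.zero ▸ h.expanding 0 (by simp)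

lemma noFixed (h : f.IsTower m R l r p q) : f.NoFixedEndpoint :=
  h.zero ▸ h.noFixedEndpoint 0 (by simp)

lemma nested (h : f.IsTower m R l r p q) {i : ℕ} (hi : ((i + 1 : ℕ) : ℕ∞) ≤ m) :
    (R i).a < p (i + 1) ∧ q (i + 1) < (R i).b := by
  obtain ⟨L, M, hs, -⟩ := h.minimal i hi
  have hinv := hs.isInvariantSet (h.expanding i (coe_le_of_le i.le_succ hi))
  exact ⟨(hinv.subset hs.p_mem_avoiding).1, (hinv.subset hs.q_mem_avoiding).2⟩

lemma Ioo_succ_subset (h : f.IsTower m R l r p q) {i : ℕ} (hi : ((i + 1 : ℕ) : ℕ∞) ≤ m) :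
    Ioo (p (i + 1)) (q (i + 1)) ⊆ (R i).I := fun _ hx =>
  ⟨((h.nested hi).1.trans hx.1).le, (hx.2.trans (h.nested hi).2).le⟩

lemma a_lt_succ (h : f.IsTower m R l r p q) {i : ℕ} (hi : ((i + 1 : ℕ) : ℕ∞) ≤ m) :
    (R i).a < (R (i + 1)).a :=
  (h.nested hi).1.trans (h.induced _ hi).p_lt

lemma succ_lt_b (h : f.IsTower m R l r p q) {i : ℕ} (hi : ((i + 1 : ℕ) : ℕ∞) ≤ m) :
    (R (i + 1)).b < (R i).b :=
  (h.induced _ hi).lt_q.trans (h.nested hi).2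

lemma I_subset (h : f.IsTower m R l r p q) {i j : ℕ} (hij : i ≤ j) (hj : (j : ℕ∞) ≤ m) :
    (R j).I ⊆ (R i).I := by
  induction j, hij using Nat.le_induction with
  | base => exact Subset.rfl
  | succ j hij ih =>
    exact (Icc_subset_Icc (h.a_lt_succ hj).le (h.succ_lt_b hj).le).trans
      (ih (coe_le_of_le j.le_succ hj))

lemma lt_of_lt (h : f.IsTower m R l r p q) {i j : ℕ} (hij : i < j) (hj : (j : ℕ∞) ≤ m) :
    p i < p j ∧ q j < q i := by
  obtain ⟨j, rfl⟩ : ∃ k, j = k + 1 := ⟨j - 1, by omega⟩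
  have hi := h.induced i (coe_le_of_le hij.le hj)
  have hsub := h.I_subset (Nat.lt_succ_iff.1 hij) (coe_le_of_le j.le_succ hj)
  have hn := h.nested hj
  exact ⟨hi.p_lt.trans_le ((hsub (R j).a_mem).1.trans hn.1.le),
    (hn.2.le.trans (hsub (R j).b_mem).2).trans_lt hi.lt_q⟩

/-- Strict nesting of the critical intervals makes both return times strictly increasing. -/
lemma le_l (h : f.IsTower m R l r p q) {i : ℕ} (h1 : 1 ≤ i) (hi : (i : ℕ∞) ≤ m) :
    i ≤ l i ∧ i ≤ r i := by
  induction i, h1 using Nat.le_induction with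
  | base => exact ⟨(h.induced _ hi).one_le_l, (h.induced _ hi).one_le_r⟩
  | succ i h1 ih =>
    have hi' := coe_le_of_le i.le_succ hi
    have hlt := h.lt_of_lt i.lt_succ_self hi
    rcases (h.strict i h1 hi').trichotomy h.isExpanding
      (h.strict (i + 1) (by omega) hi).toIsRenormalizationWith with ⟨h2, -⟩ | ⟨-, -, h2, h3⟩ | ⟨h2, -⟩
    · exact absurd h2 hlt.1.ne
    · have := ih hi'
      omega
    · exact absurd (hlt.1.trans (h.induced _ hi).p_lt) h2.not_gt

/-- Every proper invariant set is one of the sets given by the tower. -/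
theorem exists_eq_avoiding (h : f.IsTower m R l r p q) {K : Set ℝ} (hK : f.IsInvariantSet K) :
    ∃ i : ℕ, 1 ≤ i ∧ (i : ℕ∞) ≤ m ∧ K = f.avoiding (p i) (q i) := by
  have hf := h.isExpanding
  by_contra! hcon
  obtain ⟨G, L, M, P, Q, hG, rfl⟩ := hK.exists_eq_avoiding hf h.noFixed
  have hP := hG.p_mem_avoiding
  have hQ := hG.q_mem_avoiding
  have hci := hG.isCompletelyInvariant hf
  have hPc := hG.p_lt_c
  have hcQ := hG.c_lt_q
  have hgap : ∀ x ∈ f.avoiding P Q, x ∉ Ioo P Q := fun x hx =>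
    notMem_of_mem_avoiding (n := 0) hx rfl
  -- As long as P and Q lie inside I_i, the trace of K on I_i is invariant for `R i` and has the
  -- same gap around `c`.
  have hren : ∀ i : ℕ, (i : ℕ∞) ≤ m → (R i).a < P ∧ Q < (R i).b →
      ∃ g' l' r', (R i).IsRenormalizationWith g' l' r' P Q := by
    intro i hi ⟨haP, hQb⟩
    have hind := h.induced i hi
    have hPI : P ∈ (R i).I := ⟨haP.le, (hPc.trans hind.c_lt_b).le⟩
    have hQI : Q ∈ (R i).I := ⟨(hind.a_lt_c.trans hcQ).le, hQb.le⟩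
    have hinv := hind.isInvariantSet_inter hK hci ⟨P, hP, hPI⟩
    obtain ⟨g', l', r', p', q', hg', hp', hq', hd⟩ := hinv.exists_renormalization (h.expanding i hi)
    have hp'c := hg'.p_lt_c
    have hcq' := hg'.c_lt_q
    rw [hind.c_eq] at hp'c hcq'
    have hpP : p' = P := by
      refine le_antisymm ?_ ?_
      · by_contra! hlt
        exact hgap p' hp'.1 ⟨hlt, hp'c.trans hcQ⟩
      · by_contra! hlt
        exact disjoint_left.1 hd ⟨hlt, hPc.trans hcq'⟩ ⟨hP, hPI⟩
    have hqQ : q' = Q := by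
      refine le_antisymm ?_ ?_
      · by_contra! hlt
        exact disjoint_left.1 hd ⟨hp'c.trans hcQ, hlt⟩ ⟨hQ, hQI⟩
      · by_contra! hlt
        exact hgap q' hq'.1 ⟨hPc.trans hcq', hlt⟩
    subst hpP hqQ
    exact ⟨g', l', r', hg'⟩
  -- Compared with the next minimal renormalization, (P, Q) can be neither equal, by assumption, nor
  -- larger, by minimality; so it descends one level further.
  have hall : ∀ i : ℕ, (i : ℕ∞) ≤ m → (R i).a < P ∧ Q < (R i).b := by
    intro i
    induction i with
    | zero =>
      intro _
      rw [h.zero]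
      exact ⟨(hK.subset hP).1, (hK.subset hQ).2⟩
    | succ i ih =>
      intro hi
      have hi' := coe_le_of_le i.le_succ hi
      obtain ⟨g', l', r', hg'⟩ := hren i hi' (ih hi')
      obtain ⟨L', M', hs, hmin⟩ := h.minimal i hi
      rcases hs.trichotomy (h.expanding i hi') hg' with ⟨h1, h2⟩ | ⟨h1, h2, -⟩ | ⟨-, -, h3, -⟩
      · exact absurd (by rw [h1, h2]) (hcon (i + 1) (by omega) hi)
      · exact ⟨h1, h2⟩
      · exact absurd (hmin _ _ _ _ _ hg').1 h3.not_ge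
  -- For m = ∞, level L + 1 has left return time at least L + 1, whereas nesting requires it to be
  -- below L. For finite m, the prime map at level m would be renormalized.
  rcases eq_or_ne m ⊤ with rfl | hm
  · have hi := hall (L + 1) le_top
    have hs := h.strict (L + 1) (by omega) le_top
    rcases hs.trichotomy hf hG.toIsRenormalizationWith with ⟨h1, -⟩ | ⟨-, -, h1, -⟩ | ⟨h1, -⟩
    · exact absurd (hs.p_lt.trans hi.1) h1.not_lt
    · have := (h.le_l (i := L + 1) (by omega) le_top).1
      omega
    · exact absurd (hG.p_lt.trans h1) (hs.p_lt.trans hi.1).not_gt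
  · obtain ⟨n, rfl⟩ := ENat.ne_top_iff_exists.1 hm
    obtain ⟨g', l', r', hg'⟩ := hren n le_rfl (hall n le_rfl)
    exact h.last n rfl ⟨g', l', r', _, _, hg'⟩

/-- The `i`-th critical end point lies in its own `α`-limit set. -/
lemma alphaLimit_p (h : f.IsTower m R l r p q) {i : ℕ} (h1 : 1 ≤ i) (hi : (i : ℕ∞) ≤ m) :
    f.alphaLimit (p i) = f.avoiding (p i) (q i) := by
  have hf := h.isExpanding
  have hs := h.strict i h1 hi
  have hci := hs.isCompletelyInvariant hf
  have hsub := alphaLimit_subset (isClosed_avoiding hs.c_mem) hci hs.p_mem_avoiding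
  have hper : f.Reach (l i) (p i) (p i) := by
    have := (hs.avoids_p (l i)).reach
    rwa [hs.left_periodic] at this
  have hmul : ∀ n, f.Reach (n * l i) (p i) (p i) := by
    intro n
    induction n with
    | zero =>
      rw [Nat.zero_mul]
      rfl
    | succ n ih =>
      rw [Nat.succ_mul]
      exact ih.trans hper
  have hmem : p i ∈ f.alphaLimit (p i) := by
    refine (mem_alphaLimit_iff hs.p_mem).2 ⟨hs.p_mem, fun N U hU =>
      ⟨p i, mem_of_mem_nhds hU, N * l i, ?_, hmul N⟩⟩
    exact Nat.le_mul_of_pos_right N (by have := hs.one_lt_l; omega)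
  have hne : f.alphaLimit (p i) ≠ f.I := fun he => hs.c_notMem (hsub (he ▸ f.c_mem))
  have hinv := isInvariantSet_alphaLimit hf hs.p_mem hne
  obtain ⟨g, L, M, P, Q, hg, he⟩ := hinv.exists_eq_avoiding hf h.noFixed
  rw [he] at hmem hsub ⊢
  -- The α-limit set is contained in E_i, so its gap contains (p_i, q_i). It cannot be larger, since
  -- p_i is its own α-limit point.
  have hle : P ≤ p i := by
    by_contra! hlt
    exact notMem_of_mem_avoiding (n := 0) (hsub hg.p_mem_avoiding) rfl
      ⟨hlt, hg.p_lt_c.trans hs.c_lt_q⟩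
  rcases hs.trichotomy hf hg.toIsRenormalizationWith with ⟨h2, h3⟩ | ⟨h2, -⟩ | ⟨h2, -⟩
  · rw [h2, h3]
  · exact absurd (hs.p_lt.trans h2) hle.not_gt
  · exact absurd ⟨hg.p_lt.trans h2, hs.p_lt_c.trans hg.c_lt_q⟩
      (notMem_of_mem_avoiding (n := 0) hmem rfl)

lemma avoiding_subset (h : f.IsTower m R l r p q) {i j : ℕ} (hij : i ≤ j) (hj : (j : ℕ∞) ≤ m) :
    f.avoiding (p i) (q i) ⊆ f.avoiding (p j) (q j) := by
  rcases eq_or_lt_of_le hij with rfl | hlt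
  · exact Subset.rfl
  · have := h.lt_of_lt hlt hj
    exact avoiding_anti this.1.le this.2.le

lemma avoiding_ssubset (h : f.IsTower m R l r p q) {i j : ℕ} (h1 : 1 ≤ i) (hij : i < j)
    (hj : (j : ℕ∞) ≤ m) : f.avoiding (p i) (q i) ⊂ f.avoiding (p j) (q j) := by
  refine ⟨h.avoiding_subset hij.le hj, fun hsub => ?_⟩
  have hs := h.strict j (by omega) hj
  exact notMem_of_mem_avoiding (n := 0) (hsub hs.p_mem_avoiding) rfl
    ⟨(h.lt_of_lt hij hj).1, hs.p_lt_c.trans (h.strict i h1 (coe_le_of_le hij.le hj)).c_lt_q⟩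

theorem setOf_alphaLimit (h : f.IsTower m R l r p q) :
    {S : Set ℝ | ∃ x ∈ f.I, S = f.alphaLimit x} = {S : Set ℝ | S = f.I ∨
      ∃ i : ℕ, 1 ≤ i ∧ (i : ℕ∞) ≤ m ∧ S = f.avoiding (p i) (q i)} := by
  ext S
  constructor
  · rintro ⟨x, hx, rfl⟩
    by_cases hI : f.alphaLimit x = f.I
    · exact Or.inl hI
    · exact Or.inr (h.exists_eq_avoiding (isInvariantSet_alphaLimit h.isExpanding hx hI))
  · rintro (rfl | ⟨i, h1, hi, rfl⟩)
    · exact ⟨f.c, f.c_mem, (alphaLimit_c h.isExpanding).symm⟩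
    · exact ⟨p i, (h.strict i h1 hi).p_mem, (h.alphaLimit_p h1 hi).symm⟩

/-! ### The orbits of the renormalization intervals -/

lemma isClosed_orb (h : f.IsTower m R l r p q) {i : ℕ} (hi : (i : ℕ∞) ≤ m) :
    IsClosed (f.orb (R i).I) := (h.induced i hi).isClosed_orb (h.expanding i hi)

lemma orb_I_subset (h : f.IsTower m R l r p q) {i : ℕ} (hi : (i : ℕ∞) ≤ m) :
    f.orb (R i).I ⊆ f.I := orb_subset_I (h.induced i hi).subset

lemma image_orb (h : f.IsTower m R l r p q) {i : ℕ} (hi : (i : ℕ∞) ≤ m) :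
    f.image (f.orb (R i).I) = f.orb (R i).I :=
  (h.induced i hi).image_orb (h.expanding i hi).image_I.ge

lemma orb_zero (h : f.IsTower m R l r p q) : f.orb (R 0).I = f.I :=
  Subset.antisymm (h.orb_I_subset (by simp)) (h.zero ▸ subset_orb)

lemma orb_anti (h : f.IsTower m R l r p q) {i j : ℕ} (hij : i ≤ j) (hj : (j : ℕ∞) ≤ m) :
    f.orb (R j).I ⊆ f.orb (R i).I := orb_mono (h.I_subset hij hj)

/-- The orbit of a point of `orb (R i).I` enters the critical interval. -/
lemma disjoint_avoiding_orb (h : f.IsTower m R l r p q) {i : ℕ} (h1 : 1 ≤ i) (hi : (i : ℕ∞) ≤ m) :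
    Disjoint (f.avoiding (p i) (q i)) (f.orb (R i).I) := by
  refine disjoint_left.2 fun y hy hy' => ?_
  obtain ⟨x, hx, n, hr⟩ := mem_orb.1 hy'
  have hci := (h.strict i h1 hi).isCompletelyInvariant h.isExpanding
  exact notMem_of_mem_avoiding (n := 0) (hci.mem_of_reach' hr hy) rfl ((h.induced i hi).I_subset hx)

end IsTower

/-! ### Total disconnectedness, perfectness and recurrence -/

lemma isTotallyDisconnected_of_forall_not_Icc_subset {S : Set ℝ}
    (h : ∀ s t, s < t → ¬ Icc s t ⊆ S) : IsTotallyDisconnected S := by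
  intro t htS ht x hx y hy
  by_contra hne
  rcases lt_or_gt_of_ne hne with hlt | hlt
  · exact h x y hlt ((ht.ordConnected.out hx hy).trans htS)
  · exact h y x hlt ((ht.ordConnected.out hy hx).trans htS)

lemma IsInvariantSet.isTotallyDisconnected (hf : f.IsExpanding) {K : Set ℝ}
    (h : f.IsInvariantSet K) : IsTotallyDisconnected K := by
  refine isTotallyDisconnected_of_forall_not_Icc_subset fun s t hst hsub => ?_
  have hI : Ioo s t ⊆ K := Ioo_subset_Icc_self.trans hsub
  obtain ⟨n, x, hx, hr⟩ := hf.exists_reach hst (hI.trans h.subset_I)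
  exact h.c_notMem (h.mem_of_reach hr (hI hx))

/-- If `D` consists of points whose orbits avoid `c` and has no isolated point, then neither has
its orbit. -/
lemma preperfect_orb {D : Set ℝ} (hD : ∀ x ∈ D, ∀ n, f.Avoids n x) (hp : Preperfect D) :
    Preperfect (f.orb D) := by
  intro y hy
  obtain ⟨x, hx, n, hr⟩ := mem_orb.1 hy
  have ha := hD x hx n
  obtain rfl := ha.reach_iff.1 hr
  refine accPt_iff_nhds.2 fun U hU => ?_
  have hev : ∀ᶠ z in 𝓝 x, z ∈ f.I → f.toFun^[n] z ∈ U :=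
    eventually_nhdsWithin_iff.1 (ha.continuousWithinAt.eventually hU)
  -- Discarding the finitely many other preimages of the image of x makes nearby points have
  -- different images.
  have hfin : ({z | f.Reach n z (f.toFun^[n] x)} \ {x}).Finite := (finite_reach f n _).sdiff
  have hopen : ({z | f.Reach n z (f.toFun^[n] x)} \ {x})ᶜ ∈ 𝓝 x :=
    hfin.isClosed.isOpen_compl.mem_nhds fun hx' => hx'.2 rfl
  obtain ⟨z, hz, hzx⟩ := accPt_iff_nhds.1 (hp x hx) _ (inter_mem hev hopen)
  have haz := hD z hz.2 n
  refine ⟨f.toFun^[n] z, ⟨hz.1.1 haz.1, mem_orb.2 ⟨z, hz.2, n, haz.reach⟩⟩, fun he => ?_⟩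
  exact hz.1.2 ⟨he ▸ haz.reach, hzx⟩

/-- L.e.o. allows time 0, so it is applied to a preimage of x in S, which makes the return time
positive. -/
lemma subset_nonwandering_of_isLeoOn {S : Set ℝ} (hSI : S ⊆ f.I) (himg : f.image S = S)
    (hleo : f.IsLeoOn S) : S ⊆ f.nonwandering := by
  intro x hx
  refine ⟨hSI hx, fun U hU hxU => ?_⟩
  obtain ⟨N, hN⟩ := hleo U hU ⟨x, hxU, hx⟩
  obtain ⟨y, hy, hs⟩ := himg.ge hx
  rw [← hN] at hy
  obtain ⟨n, -, hy⟩ := mem_iUnion₂.1 hy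
  obtain ⟨z, hz, hr⟩ := mem_image_iterate.1 hy
  exact ⟨n + 1, by omega, x, mem_image_iterate.2
    ⟨z, ⟨hz.1, hSI hz.2⟩, reach_succ'.2 ⟨y, hr, hs⟩⟩, hxU⟩

namespace IsTower

variable {m : ℕ∞} {R : ℕ → LorenzMap} {l r : ℕ → ℕ} {p q : ℕ → ℝ}

/-! ### The pieces of the nonwandering set -/

section Piece

variable {i : ℕ} (h : f.IsTower m R l r p q) (hi : ((i + 1 : ℕ) : ℕ∞) ≤ m)
include h hi

lemma avoiding_inter_I : (R i).avoiding (p (i + 1)) (q (i + 1)) =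
    f.avoiding (p (i + 1)) (q (i + 1)) ∩ (R i).I := by
  have hind := h.induced i (coe_le_of_le i.le_succ hi)
  exact hind.avoiding_eq ((h.Ioo_succ_subset hi).trans hind.I_subset)

lemma isMinimalInvariant_avoiding :
    (R i).IsMinimalInvariant ((R i).avoiding (p (i + 1)) (q (i + 1))) := by
  have hi' := coe_le_of_le i.le_succ hi
  obtain ⟨L, M, hs, hmin⟩ := h.minimal i hi
  exact hs.isMinimalInvariant (h.expanding i hi') (h.noFixedEndpoint i hi') hmin

lemma avoiding_ne_I : (R i).avoiding (p (i + 1)) (q (i + 1)) ≠ (R i).I := by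
  obtain ⟨L, M, hs, -⟩ := h.minimal i hi
  exact fun he => hs.c_notMem (he ▸ (R i).c_mem)

lemma isInvariantSet_avoiding : f.IsInvariantSet (f.avoiding (p (i + 1)) (q (i + 1))) :=
  (h.strict (i + 1) (by omega) hi).isInvariantSet h.isExpanding

/-- Complete invariance carries membership in E_{i+1} both ways along an itinerary. -/
lemma orb_avoiding : f.orb ((R i).avoiding (p (i + 1)) (q (i + 1))) =
    f.avoiding (p (i + 1)) (q (i + 1)) ∩ f.orb (R i).I := by
  have hci := (h.strict (i + 1) (by omega) hi).isCompletelyInvariant h.isExpanding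
  rw [h.avoiding_inter_I hi]
  ext y
  constructor
  · intro hy
    obtain ⟨x, hx, n, hr⟩ := mem_orb.1 hy
    exact ⟨hci.mem_of_reach hr hx.1, mem_orb.2 ⟨x, hx.2, n, hr⟩⟩
  · rintro ⟨hy, hy'⟩
    obtain ⟨x, hx, n, hr⟩ := mem_orb.1 hy'
    exact mem_orb.2 ⟨x, ⟨hci.mem_of_reach' hr hy, hx⟩, n, hr⟩

lemma isClosed_piece : IsClosed (f.avoiding (p (i + 1)) (q (i + 1)) ∩ f.orb (R i).I) :=
  (h.isInvariantSet_avoiding hi).isClosed.inter (h.isClosed_orb (coe_le_of_le i.le_succ hi))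

lemma image_piece : f.image (f.avoiding (p (i + 1)) (q (i + 1)) ∩ f.orb (R i).I) =
    f.avoiding (p (i + 1)) (q (i + 1)) ∩ f.orb (R i).I := by
  rw [← h.orb_avoiding hi]
  exact (h.induced i (coe_le_of_le i.le_succ hi)).image_orb
    (h.isMinimalInvariant_avoiding hi).1.2.2.2.1.ge

lemma avoids_of_mem_avoiding {x : ℝ} (hx : x ∈ (R i).avoiding (p (i + 1)) (q (i + 1))) (n : ℕ) :
    f.Avoids n x := by
  rw [h.avoiding_inter_I hi] at hx
  exact (h.isInvariantSet_avoiding hi).avoids hx.1 n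

lemma isLeoOn_piece : f.IsLeoOn (f.avoiding (p (i + 1)) (q (i + 1)) ∩ f.orb (R i).I) := by
  have hi' := coe_le_of_le i.le_succ hi
  have hmin := h.isMinimalInvariant_avoiding hi
  rw [← h.orb_avoiding hi]
  refine (h.induced i hi').isLeoOn_orb hmin.1.2.2.1 hmin.1.2.2.2.1
    (hmin.isLeoOn (h.expanding i hi') (h.noFixedEndpoint i hi') (h.avoiding_ne_I hi)) ?_
  rintro U - ⟨y, hyU, hy⟩
  obtain ⟨x, hx, n, hr⟩ := mem_orb.1 hy
  have ha := h.avoids_of_mem_avoiding hi hx n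
  exact ⟨x, hx, n, ha, ha.reach_iff.1 hr ▸ hyU⟩

lemma p_mem_avoiding : p (i + 1) ∈ (R i).avoiding (p (i + 1)) (q (i + 1)) := by
  obtain ⟨L, M, hs, -⟩ := h.minimal i hi
  exact hs.p_mem_avoiding

lemma q_mem_avoiding : q (i + 1) ∈ (R i).avoiding (p (i + 1)) (q (i + 1)) := by
  obtain ⟨L, M, hs, -⟩ := h.minimal i hi
  exact hs.q_mem_avoiding

/-- If `q` is in the orbit of `p`, the minimal set has isolated points: otherwise `q` would be
accumulated from the left, like `p`. -/
lemma not_preperfect_of_mem_orb (hq : q (i + 1) ∈ f.orb {p (i + 1)}) :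
    ¬ Preperfect ((R i).avoiding (p (i + 1)) (q (i + 1))) := by
  intro hp
  have hs := h.strict (i + 1) (by omega) hi
  obtain ⟨_, rfl, n, hr⟩ := mem_orb.1 hq
  have hav := h.avoids_of_mem_avoiding hi (h.p_mem_avoiding hi) n
  have hqe := hav.reach_iff.1 hr
  have hsub : ∀ x ∈ (R i).avoiding (p (i + 1)) (q (i + 1)),
      x ∈ f.avoiding (p (i + 1)) (q (i + 1)) := fun x hx => by
    rw [h.avoiding_inter_I hi] at hx
    exact hx.1
  have hpI : p (i + 1) ∈ Ioo f.a f.b := (h.isInvariantSet_avoiding hi).subset hs.p_mem_avoiding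
  have hev := eventually_nhdsWithin_iff.1 (hav.eventually.and
    (hav.continuousWithinAt.eventually (lt_mem_nhds (hqe ▸ hs.p_lt_c.trans hs.c_lt_q))))
  obtain ⟨s, t, hst, hV⟩ := mem_nhds_iff_exists_Ioo_subset.1
    (inter_mem (inter_mem hev (isOpen_Ioo.mem_nhds hpI)) (gt_mem_nhds hs.p_lt_c))
  obtain ⟨z, ⟨hz, hzD⟩, hzp⟩ := accPt_iff_nhds.1 (hp _ (h.p_mem_avoiding hi)) _
    (Ioo_mem_nhds hst.1 hst.2)
  have hzE := hsub z hzD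
  have hV' := fun x (hx : x ∈ Ioo s t) => (hV hx).1.1 (Ioo_subset_Icc_self (hV hx).1.2)
  have hzlt : z < p (i + 1) := by
    refine lt_of_le_of_ne ?_ hzp
    by_contra! hlt
    exact notMem_of_mem_avoiding (n := 0) hzE rfl ⟨hlt, (mem_Iio.1 (hV hz).2).trans hs.c_lt_q⟩
  -- Points of the set near p lie to its left because of the gap. The increasing branch from p to q
  -- sends them just below q, hence into the gap.
  have hmono := (branch (ordConnected_Ioo (a := s) (b := t)) fun x hx => (hV' x hx).1).1
  have hlt := hmono hz hst hzlt
  rw [← hqe] at hlt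
  exact notMem_of_mem_avoiding hzE (hV' z hz).1.reach ⟨(hV' z hz).2, hlt⟩

lemma mem_orb_of_isPeriodicRenormalization (hper : f.IsPeriodicRenormalization (R (i + 1))) :
    q (i + 1) ∈ f.orb {p (i + 1)} := by
  obtain ⟨l', r', p', q', hren, hq⟩ := hper
  obtain ⟨rfl, rfl⟩ := hren.unique h.isExpanding
    (h.strict (i + 1) (by omega) hi).toIsRenormalizationWith
  exact hq

lemma periodic_or_preperfect :
    (∃ x ∈ (R i).avoiding (p (i + 1)) (q (i + 1)), ∃ n, 1 ≤ n ∧ f.toFun^[n] x = x ∧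
      f.avoiding (p (i + 1)) (q (i + 1)) ∩ f.orb (R i).I = f.orb {x} ∧
      q (i + 1) ∈ f.orb {p (i + 1)}) ∨
    Preperfect ((R i).avoiding (p (i + 1)) (q (i + 1))) := by
  have hi' := coe_le_of_le i.le_succ hi
  have hind := h.induced i hi'
  rcases (h.isMinimalInvariant_avoiding hi).periodic_or_preperfect (h.expanding i hi')
    (h.noFixedEndpoint i hi') (h.avoiding_ne_I hi) with ⟨x, hx, n, hn, hr, hsub⟩ | hp
  · left
    obtain ⟨k, hk, -, hk'⟩ := hind.reach_of_reach hr
    have hkx := ((h.avoids_of_mem_avoiding hi hx k).reach_iff.1 hk').symm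
    have horb : ∀ y ∈ (R i).avoiding (p (i + 1)) (q (i + 1)), ∃ n, f.Reach n x y := by
      intro y hy
      obtain ⟨_, rfl, n, hr⟩ := mem_orb.1 (hsub hy)
      obtain ⟨k, -, -, hk⟩ := hind.reach_of_reach hr
      exact ⟨k, hk⟩
    refine ⟨x, hx, k, hn.trans hk, hkx, ?_, ?_⟩
    · rw [← h.orb_avoiding hi]
      refine Subset.antisymm (fun y hy => ?_) (orb_mono (singleton_subset_iff.2 hx))
      obtain ⟨z, hz, n, hr⟩ := mem_orb.1 hy
      obtain ⟨j, hj⟩ := horb z hz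
      exact mem_orb.2 ⟨x, rfl, j + n, hj.trans hr⟩
    · obtain ⟨a, ha⟩ := horb _ (h.p_mem_avoiding hi)
      obtain ⟨b, hb⟩ := horb _ (h.q_mem_avoiding hi)
      have hmul : ∀ n, f.toFun^[n * k] x = x := by
        intro n
        rw [mul_comm, Function.iterate_mul]
        exact Function.iterate_fixed hkx n
      -- The point p is reached from x at time a, and x has period k; so p leads back to x after the
      -- remaining a * k - a steps.
      have hpx : f.Reach (a * k - a) (p (i + 1)) x := by
        rw [(h.avoids_of_mem_avoiding hi hx a).reach_iff] at ha
        have h1 : a ≤ a * k := Nat.le_mul_of_pos_right a (by omega)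
        have := (h.avoids_of_mem_avoiding hi (h.p_mem_avoiding hi) (a * k - a)).reach
        rwa [ha, ← Function.iterate_add_apply, Nat.sub_add_cancel h1, hmul, ← ha] at this
      exact mem_orb.2 ⟨_, rfl, _, hpx.trans hb⟩
  · exact Or.inr hp

lemma isPeriodicOrbit_piece (hper : f.IsPeriodicRenormalization (R (i + 1))) :
    f.IsPeriodicOrbit (f.avoiding (p (i + 1)) (q (i + 1)) ∩ f.orb (R i).I) := by
  rcases h.periodic_or_preperfect hi with ⟨x, hx, n, hn, hnx, heq, -⟩ | hp
  · refine ⟨x, (h.avoids_of_mem_avoiding hi hx 0).1, n, hn, hnx, fun hc => ?_, heq⟩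
    obtain ⟨_, rfl, k, hr⟩ := mem_orb.1 hc
    have ha := h.avoids_of_mem_avoiding hi hx (k + 1)
    exact ha.2 k k.lt_succ_self ((ha.mono k.le_succ).reach_iff.1 hr).symm
  · exact absurd hp
      (h.not_preperfect_of_mem_orb hi (h.mem_orb_of_isPeriodicRenormalization hi hper))

lemma isCantorSet_piece (hper : ¬ f.IsPeriodicRenormalization (R (i + 1))) :
    IsCantorSet (f.avoiding (p (i + 1)) (q (i + 1)) ∩ f.orb (R i).I) := by
  have hs := h.strict (i + 1) (by omega) hi
  rcases h.periodic_or_preperfect hi with ⟨-, -, -, -, -, -, hq⟩ | hp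
  · exact absurd ⟨_, _, _, _, hs.toIsRenormalizationWith, hq⟩ hper
  have hcl := h.isClosed_piece hi
  refine ⟨⟨p (i + 1), ?_⟩, isCompact_Icc.of_isClosed_subset hcl fun x hx => hx.1.1, ⟨hcl, ?_⟩, ?_⟩
  · rw [← h.orb_avoiding hi]
    exact subset_orb (h.p_mem_avoiding hi)
  · rw [← h.orb_avoiding hi]
    exact preperfect_orb (fun x hx => h.avoids_of_mem_avoiding hi hx) hp
  · intro t ht
    exact ((h.isInvariantSet_avoiding hi).isTotallyDisconnected h.isExpanding) t
      (ht.trans inter_subset_left)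

end Piece

/-! ### The attractor -/

/-- The intersection of the orbits of the renormalization intervals. -/
def attractor (f : LorenzMap) (m : ℕ∞) (R : ℕ → LorenzMap) : Set ℝ :=
  ⋂ i : ℕ, ⋂ _ : (i : ℕ∞) ≤ m, f.orb (R i).I

lemma mem_attractor {x : ℝ} :
    x ∈ attractor f m R ↔ ∀ i : ℕ, (i : ℕ∞) ≤ m → x ∈ f.orb (R i).I := by
  simp [attractor]

lemma attractor_coe (n : ℕ) (h : f.IsTower n R l r p q) :
    attractor f n R = f.orb (R n).I := by
  ext x
  rw [mem_attractor]
  exact ⟨fun hx => hx n le_rfl, fun hx i hi => h.orb_anti (by exact_mod_cast hi) le_rfl hx⟩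

lemma attractor_subset_I (h : f.IsTower m R l r p q) : attractor f m R ⊆ f.I := fun _ hx =>
  h.orb_zero ▸ mem_attractor.1 hx 0 (by simp)

lemma isClosed_attractor (h : f.IsTower m R l r p q) : IsClosed (attractor f m R) :=
  isClosed_iInter fun i => isClosed_iInter fun hi => h.isClosed_orb (i := i) hi

lemma attractor_of_reach {x y : ℝ} {n : ℕ}
    (hx : x ∈ attractor f m R) (hr : f.Reach n x y) : y ∈ attractor f m R := by
  refine mem_attractor.2 fun i hi => ?_
  obtain ⟨z, hz, k, hk⟩ := mem_orb.1 (mem_attractor.1 hx i hi)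
  exact mem_orb.2 ⟨z, hz, _, hk.trans hr⟩

lemma c_mem_attractor (h : f.IsTower m R l r p q) : f.c ∈ attractor f m R :=
  mem_attractor.2 fun i hi => subset_orb (h.induced i hi).c_mem

/-- A point outside of all `avoiding (p i) (q i)` is attracted by the attractor. -/
lemma omegaLimit_subset (h : f.IsTower m R l r p q) {x : ℝ} (hx : x ∈ f.I)
    (hn : ∀ i : ℕ, 1 ≤ i → (i : ℕ∞) ≤ m → x ∉ f.avoiding (p i) (q i)) :
    f.omegaLimit x ⊆ attractor f m R := by
  intro y hy
  refine mem_attractor.2 fun i hi => ?_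
  have hexi : ∃ N, ∀ k ≥ N, ∀ z, f.Reach k x z → z ∈ f.orb (R i).I := by
    rcases Nat.eq_zero_or_pos i with rfl | h1
    · refine ⟨0, fun k _ z hr => ?_⟩
      rw [h.orb_zero]
      exact hr.mem hx
    · obtain ⟨N, ha, hmem⟩ := (h.strict i h1 hi).exists_iterate_mem_of_notMem h.isExpanding hx
        (hn i h1 hi)
      refine ⟨N, fun k hk z hr => ?_⟩
      rw [show k = N + (k - N) by omega, reach_add] at hr
      obtain ⟨w, hw, hr⟩ := hr
      rw [ha.reach_iff.1 hw] at hr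
      exact mem_orb.2 ⟨_, Ioo_subset_Icc_self hmem, _, hr⟩
  obtain ⟨N, hN⟩ := hexi
  refine closure_minimal (iUnion₂_subset fun k hk z hz => ?_) (h.isClosed_orb hi)
    (mem_iInter.1 hy N)
  obtain ⟨_, rfl, hr⟩ := mem_image_iterate.1 hz
  exact hN k hk z hr

/-- A nonwandering point lies in the attractor or in one of the pieces. -/
lemma nonwandering_subset (h : f.IsTower m R l r p q) {x : ℝ} (hx : x ∈ f.nonwandering)
    (hA : x ∉ attractor f m R) : ∃ i : ℕ, ((i + 1 : ℕ) : ℕ∞) ≤ m ∧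
      x ∈ f.avoiding (p (i + 1)) (q (i + 1)) ∩ f.orb (R i).I := by
  classical
  have hex : ∃ i : ℕ, (i : ℕ∞) ≤ m ∧ x ∉ f.orb (R i).I := by
    by_contra! hcon
    exact hA (mem_attractor.2 hcon)
  obtain ⟨hi, hxi⟩ := Nat.find_spec hex
  have hmin : ∀ j < Nat.find hex, (j : ℕ∞) ≤ m → x ∈ f.orb (R j).I := fun j hj hjm => by
    by_contra hn
    exact Nat.find_min hex hj ⟨hjm, hn⟩
  generalize Nat.find hex = i at hi hxi hmin
  cases i with
  | zero => exact absurd (h.orb_zero ▸ hx.1) hxi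
  | succ i =>
    refine ⟨i, hi, ?_, hmin i i.lt_succ_self (coe_le_of_le i.le_succ hi)⟩
    by_contra hn
    obtain ⟨n, ha, hmem⟩ :=
      (h.strict (i + 1) (by omega) hi).exists_iterate_mem_of_notMem h.isExpanding hx.1 hn
    -- A periodic x would come back after entering I_{i+1} and hence belong to its orbit.
    have hne : ∀ k < n, 1 ≤ k → f.toFun^[k] x ≠ x := by
      intro k hk h1 hkx
      have hper : ∀ j, f.toFun^[k * j] x = x := fun j => by
        rw [Function.iterate_mul]
        exact Function.iterate_fixed hkx j
      have hle : n ≤ k * n := Nat.le_mul_of_pos_left n h1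
      have hav : ∀ j, f.Avoids (k * j) x := by
        intro j
        induction j with
        | zero => exact avoids_zero hx.1
        | succ j ih =>
          rw [Nat.mul_succ, avoids_add, hper]
          exact ⟨ih, ha.mono hk.le⟩
      have h2 := (avoids_add.1 ((Nat.add_sub_cancel' hle).symm ▸ hav n)).2.reach
      rw [← Function.iterate_add_apply, Nat.sub_add_cancel hle, hper] at h2
      exact hxi (mem_orb.2 ⟨_, Ioo_subset_Icc_self hmem, _, h2⟩)
    have hev1 : ∀ k < n, 1 ≤ k → ∃ V ∈ 𝓝 x, ∀ y ∈ V, y ∈ f.I → f.toFun^[k] y ∉ V := by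
      intro k hk h1
      obtain ⟨W₁, W₂, hW₁, hW₂, hx1, hx2, hd⟩ := t2_separation (hne k hk h1)
      have hev := eventually_nhdsWithin_iff.1
        ((ha.mono hk.le).continuousWithinAt.eventually (hW₁.mem_nhds hx1))
      refine ⟨_, inter_mem hev (hW₂.mem_nhds hx2), fun y hy hyI hmem => ?_⟩
      exact disjoint_left.1 hd (hy.1 hyI) hmem.2
    choose! V hV hVd using hev1
    have hev2 := eventually_nhdsWithin_iff.1
      (ha.eventually.and (ha.continuousWithinAt.eventually (isOpen_Ioo.mem_nhds hmem)))
    -- Returns before time n are excluded by separating x from its iterates; later ones land in the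
    -- closed set orb(I_{i+1}), which misses x.
    have hbig : (⋂ k ∈ Finset.Ico 1 n, V k) ∈ 𝓝 x := by
      refine (Finset.iInter_mem_sets _).2 fun k hk => ?_
      rw [Finset.mem_Ico] at hk
      exact hV k hk.2 hk.1
    obtain ⟨U, hUsub, hU, hxU⟩ := mem_nhds_iff.1 (inter_mem (inter_mem hbig hev2)
      ((h.isClosed_orb hi).isOpen_compl.mem_nhds hxi))
    obtain ⟨k, hk1, y, hy, hyU⟩ := hx.2 U hU hxU
    obtain ⟨z, hz, hr⟩ := mem_image_iterate.1 hy
    obtain ⟨haz, hzmem⟩ := (hUsub hz.1).1.2 hz.2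
    rcases lt_or_ge k n with hkn | hkn
    · rw [(haz.mono hkn.le).reach_iff.1 hr] at hyU
      have hkI : k ∈ Finset.Ico 1 n := Finset.mem_Ico.2 ⟨hk1, hkn⟩
      exact hVd k hkn hk1 z (mem_iInter₂.1 (hUsub hz.1).1.1 k hkI) hz.2
        (mem_iInter₂.1 (hUsub hyU).1.1 k hkI)
    · rw [show k = n + (k - n) by omega, reach_add] at hr
      obtain ⟨w, hw, hr⟩ := hr
      rw [haz.reach_iff.1 hw] at hr
      exact (hUsub hyU).2 (mem_orb.2 ⟨_, Ioo_subset_Icc_self hzmem, _, hr⟩)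

/-! ### Finitely renormalizable maps -/

lemma isLeoOn_attractor_coe (n : ℕ) (h : f.IsTower n R l r p q) :
    f.IsLeoOn (attractor f n R) := by
  have hexp := h.expanding n le_rfl
  have hind := h.induced n le_rfl
  rw [attractor_coe n h]
  refine hind.isLeoOn_orb Subset.rfl hexp.image_I (isLeoOn_I hexp (h.last n rfl)) fun U hU hne => ?_
  exact hind.exists_iterate_mem_of_isOpen hexp hU hne

end IsTower

/-- Points have finitely many preimages of each order, so a preimage in every orb(I_i) can be chosen
independently of i. -/
lemma exists_mem_forall_of_finite {F : Set ℝ} (hF : F.Finite) {B : ℕ → Set ℝ} (hB : Antitone B)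
    (hne : ∀ i, (F ∩ B i).Nonempty) : ∃ x ∈ F, ∀ i, x ∈ B i := by
  have : (⋂ i, F ∩ B i).Nonempty := by
    refine IsCompact.nonempty_iInter_of_sequence_nonempty_isCompact_isClosed _ ?_ hne ?_ ?_
    · exact fun i => inter_subset_inter_right F (hB i.le_succ)
    · exact (hF.inter_of_left _).isCompact
    · exact fun i => (hF.inter_of_left _).isClosed
  obtain ⟨x, hx⟩ := this
  rw [mem_iInter] at hx
  exact ⟨x, (hx 0).1, fun i => (hx i).2⟩

/-! ### Passing from one branch of a renormalization to the other -/

namespace IsStrictRenormalization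

variable {l r : ℕ} {p q : ℝ}

/-- Otherwise a point of (c, w] is sent to `c` in one step, too early because r > 1. -/
lemma toFun_lt_c (h : f.IsStrictRenormalization g l r p q) {w : ℝ} (hw : w ∈ Ioc f.c q) :
    f.toFun w < f.c := by
  by_contra! hle
  have hwb : w ≤ f.b := hw.2.trans h.q_mem.2
  obtain ⟨x, hx, hxc⟩ := exists_step_right
    (hle.trans (f.strictMonoOn_right.monotoneOn ⟨hw.1, hwb⟩ ⟨f.c_lt_b, le_rfl⟩ hwb)) f.a_lt_c
  have hxw : x ≤ w := by
    by_contra! hlt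
    exact (f.strictMonoOn_right ⟨hw.1, hwb⟩ hx hlt).not_ge (hxc ▸ hle)
  exact (h.avoids_right ⟨hx.1, hxw.trans hw.2⟩).2 1 h.one_lt_r hxc

lemma exists_left (h : f.IsStrictRenormalization g l r p q) {w : ℝ} (hw : w ∈ g.I)
    (hc : w ≠ f.c) : ∃ s ∈ Ico f.a f.c, s = w ∨ f.Step w s := by
  have hwI := h.proper.1 hw
  rcases lt_or_gt_of_ne hc with hlt | hlt
  · exact ⟨w, ⟨hwI.1, hlt⟩, Or.inl rfl⟩
  · have hs := step_of_ne hwI hc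
    exact ⟨_, ⟨hs.mem.1, h.toFun_lt_c ⟨hlt, hw.2.trans h.right_mem.1⟩⟩, Or.inr hs⟩

/-- Every image under `g` of a point `w` of `g.I` is reached from an image of a point in the left
half of `f.I` which is `w` or an image of `w`. -/
lemma exists_reach_left (hf : f.IsExpanding) (h : f.IsStrictRenormalization g l r p q) {w w' : ℝ}
    (hs : g.Step w w') : ∃ y, ∃ n ≤ l + r, f.Reach n y w' ∧
      ((∃ s ∈ Ico f.a f.c, (s = w ∨ f.Step w s) ∧ y = f.toFun s) ∨ y = f.b) := by
  have hi := h.induced hf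
  have hl := h.one_lt_l
  have hr := h.one_lt_r
  have hwI := h.proper.1 hs.1
  rcases lt_trichotomy w f.c with hc | rfl | hc
  · obtain ⟨ha, hgw⟩ := hi.left w ⟨hs.1.1, hc⟩
    have hreach := ha.reach
    rw [← hgw, ← hs.eq_of_ne (h.c_eq ▸ hc.ne), show l = (l - 1) + 1 by omega] at hreach
    obtain ⟨z, hz, hreach⟩ := hreach
    exact ⟨z, l - 1, by omega, hreach, Or.inl ⟨w, ⟨hwI.1, hc⟩, Or.inl rfl, hz.eq_of_ne hc.ne⟩⟩
  · rw [← h.c_eq] at hs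
    rcases hs.of_c with rfl | rfl
    -- After leaving `c` through `f.a` the itinerary is already in the left half, so the next image
    -- has the required form.
    · have hreach := (hi.avoids_a (k := r - 1) (by omega)).reach
      rw [hi.iterate_a, show r - 1 = (r - 2) + 1 by omega] at hreach
      obtain ⟨z, hz, hreach⟩ := hreach
      exact ⟨z, r - 2, by omega, hreach, Or.inl ⟨f.a, ⟨le_rfl, f.a_lt_c⟩, Or.inr f.step_c_a,
        hz.eq_of_ne f.a_lt_c.ne⟩⟩
    · have hreach := (hi.avoids_b (k := l - 1) (by omega)).reach
      rw [hi.iterate_b] at hreach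
      exact ⟨f.b, l - 1, by omega, hreach, Or.inr rfl⟩
  · have hw : w ∈ Ioc f.c g.b := ⟨hc, hs.1.2⟩
    obtain ⟨ha, hgw⟩ := hi.right w hw
    have hreach := ha.reach
    rw [← hgw, ← hs.eq_of_ne (h.c_eq ▸ hc.ne'), show r = (r - 2) + 1 + 1 by omega] at hreach
    obtain ⟨z, hz, y, hy, hreach⟩ := hreach
    have hzw := hz.eq_of_ne hc.ne'
    have hzc : z < f.c := hzw ▸ h.toFun_lt_c ⟨hc, hw.2.trans h.right_mem.1⟩
    exact ⟨y, r - 2, by omega, hreach, Or.inl ⟨z, ⟨hz.mem.1, hzc⟩, Or.inr hz, hy.eq_of_ne hzc.ne⟩⟩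

lemma exists_right (h : f.IsStrictRenormalization g l r p q) {w : ℝ} (hw : w ∈ g.I)
    (hc : w ≠ f.c) : ∃ s ∈ Ioc f.c f.b, s = w ∨ f.Step w s := by
  obtain ⟨s, hs, hsw⟩ := h.reflect.exists_left (w := -w) (by simpa using hw)
    (fun he => hc (neg_inj.1 he))
  refine ⟨-s, ⟨by linarith [hs.2, f.reflect_c], by linarith [hs.1, f.reflect_a]⟩, ?_⟩
  rcases hsw with rfl | hsw
  · exact Or.inl (neg_neg _)
  · exact Or.inr (by simpa [reflect_step] using hsw)

lemma exists_reach_right (hf : f.IsExpanding) (h : f.IsStrictRenormalization g l r p q) {w w' : ℝ}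
    (hs : g.Step w w') : ∃ y, ∃ n ≤ l + r, f.Reach n y w' ∧
      ((∃ s ∈ Ioc f.c f.b, (s = w ∨ f.Step w s) ∧ y = f.toFun s) ∨ y = f.a) := by
  obtain ⟨y, n, hn, hr, hy⟩ := h.reflect.exists_reach_left hf.reflect (w := -w) (w' := -w')
    (by simpa [reflect_step] using hs)
  refine ⟨-y, n, by omega, by simpa [reflect_reach] using hr, ?_⟩
  rcases hy with ⟨s, hs, hsw, rfl⟩ | rfl
  · refine Or.inl ⟨-s, ⟨by linarith [hs.2, f.reflect_c], by linarith [hs.1, f.reflect_a]⟩, ?_,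
      by simp [reflect_toFun]⟩
    rcases hsw with rfl | hsw
    · exact Or.inl (neg_neg _)
    · exact Or.inr (by simpa [reflect_step] using hsw)
  · exact Or.inr (by simp)

end IsStrictRenormalization

namespace IsTower

variable {R : ℕ → LorenzMap} {l r : ℕ → ℕ} {p q : ℕ → ℝ}

/-! ### Infinitely renormalizable maps -/

section Infinite

variable (h : f.IsTower ⊤ R l r p q)
include h

/-- The interval (x, c) hits `c` at some time n, but points of [p_{n+1}, c) avoid `c` before time
l_{n+1} > n. -/
lemma exists_lt_p {x : ℝ} (hx : x < f.c) : ∃ i, 1 ≤ i ∧ x < p i := by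
  by_contra! hcon
  have hlt : max x f.a < f.c := max_lt hx f.a_lt_c
  have hI : Ioo (max x f.a) f.c ⊆ f.I := fun y hy =>
    ⟨(le_max_right _ _).trans hy.1.le, (hy.2.trans f.c_lt_b).le⟩
  obtain ⟨n, -, z, hz, hzc⟩ := h.isExpanding.exists_firstHit hlt hI
  have hs := h.strict (n + 1) (by omega) le_top
  have hle := (h.le_l (i := n + 1) (by omega) le_top).1
  have hpz : p (n + 1) ≤ z := (hcon (n + 1) (by omega)).trans ((le_max_left _ _).trans hz.1.le)
  exact (hs.avoids_left ⟨hpz, hz.2⟩).2 n (by omega) hzc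

lemma p_notMem_attractor {i : ℕ} (h1 : 1 ≤ i) : p i ∉ attractor f ⊤ R := fun hmem =>
  disjoint_left.1 (h.disjoint_avoiding_orb h1 le_top) (h.strict i h1 le_top).p_mem_avoiding
    (mem_attractor.1 hmem i le_top)

/-- Some image of an interval is a neighbourhood of `c`, so it contains a p_i, which is not in the
forward invariant attractor. -/
lemma not_Icc_subset_attractor {s t : ℝ} (hst : s < t) : ¬ Icc s t ⊆ attractor f ⊤ R := by
  intro hsub
  have hI : Ioo s t ⊆ f.I := fun x hx => h.attractor_subset_I (hsub (Ioo_subset_Icc_self hx))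
  obtain ⟨x, hx⟩ := nonempty_Ioo.2 hst
  obtain ⟨n, V, hV, hreach⟩ := exists_image_mem_nhds_c h.isExpanding isOpen_Ioo ⟨hx, hI hx⟩
  obtain ⟨u, v, huv, hVsub⟩ := mem_nhds_iff_exists_Ioo_subset.1 hV
  obtain ⟨i, h1, hi⟩ := h.exists_lt_p huv.1
  obtain ⟨w, hw, hr⟩ := hreach (p i) (hVsub ⟨hi, (h.strict i h1 le_top).p_lt_c.trans huv.2⟩)
  exact h.p_notMem_attractor h1 (attractor_of_reach (hsub (Ioo_subset_Icc_self hw.1)) hr)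

/-- Small neighbourhoods of points of the attractor contain one of the intervals visited by the
branches of some renormalization. -/
lemma exists_piece_subset {y : ℝ} (hy : y ∈ attractor f ⊤ R) {U : Set ℝ} (hU : U ∈ 𝓝 y) :
    ∃ i, (∃ k < l i, Icc (f.toFun^[k + 1] (R i).a) (f.toFun^[k] f.b) ⊆ U) ∨
      ∃ k < r i, Icc (f.toFun^[k] f.a) (f.toFun^[k + 1] (R i).b) ⊆ U := by
  obtain ⟨s, t, hst, hsub⟩ := mem_nhds_iff_exists_Ioo_subset.1 hU
  have hgap : ∀ s t, s < t → ∃ x ∈ Ioo s t, x ∉ attractor f ⊤ R := by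
    intro s t hst
    obtain ⟨s', hs'⟩ := exists_between hst
    obtain ⟨t', ht'⟩ := exists_between hs'.2
    obtain ⟨x, hx, hxA⟩ := not_subset.1 (h.not_Icc_subset_attractor ht'.1)
    exact ⟨x, ⟨hs'.1.trans_le hx.1, hx.2.trans_lt ht'.2⟩, hxA⟩
  have hout : ∀ x, x ∉ attractor f ⊤ R → ∃ i, x ∉ f.orb (R i).I := by
    intro x hx
    by_contra! hcon
    exact hx (mem_attractor.2 fun i _ => hcon i)
  obtain ⟨s', hs', hsA⟩ := hgap s y hst.1
  obtain ⟨t', ht', htA⟩ := hgap y t hst.2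
  obtain ⟨i, hi⟩ := hout s' hsA
  obtain ⟨j, hj⟩ := hout t' htA
  have hi' : s' ∉ f.orb (R (max i j)).I := fun hm => hi (h.orb_anti (le_max_left _ _) le_top hm)
  have hj' : t' ∉ f.orb (R (max i j)).I := fun hm => hj (h.orb_anti (le_max_right _ _) le_top hm)
  have hind := h.induced (max i j) le_top
  -- An interval through y inside the orbit at a deep enough level is trapped between s' and t',
  -- which are outside that orbit.
  have key : ∀ u v, y ∈ Icc u v → Icc u v ⊆ f.orb (R (max i j)).I → Icc u v ⊆ U := by
    intro u v hyuv hsub' x hx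
    refine hsub ⟨hs'.1.trans ?_, lt_trans ?_ ht'.2⟩
    · by_contra! hle
      exact hi' (hsub' ⟨hx.1.trans hle, hs'.2.le.trans hyuv.2⟩)
    · by_contra! hle
      exact hj' (hsub' ⟨hyuv.1.trans ht'.1.le, hle.trans hx.2⟩)
  refine ⟨max i j, ?_⟩
  rcases hind.mem_piece (h.expanding _ le_top) (mem_attractor.1 hy _ le_top) with
    ⟨k, hk, hyk⟩ | ⟨k, hk, hyk⟩
  · exact Or.inl ⟨k, hk, key _ _ hyk (hind.left_piece_subset hk)⟩
  · exact Or.inr ⟨k, hk, key _ _ hyk (hind.right_piece_subset hk)⟩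

lemma antitone_orb : Antitone fun i => f.orb (R i).I := fun _ _ hij => h.orb_anti hij le_top

/-- Every point of the attractor in `(R j).I` is an image, under `R j`, of such a point. -/
lemma exists_step_attractor (j : ℕ) {y : ℝ} (hy : y ∈ attractor f ⊤ R) (hyI : y ∈ (R j).I) :
    ∃ x ∈ attractor f ⊤ R, (R j).Step x y := by
  have hind := h.induced j le_top
  suffices hne : ∀ i, ({x | (R j).Step x y} ∩ f.orb (R i).I).Nonempty by
    obtain ⟨x, hx, hxB⟩ := exists_mem_forall_of_finite (finite_preimage_singleton (R j) y)
      h.antitone_orb hne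
    exact ⟨x, mem_attractor.2 fun i _ => hxB i, hx⟩
  intro i
  have hmem := mem_attractor.1 hy (max i j) le_top
  rw [← h.image_orb le_top] at hmem
  obtain ⟨w, hw, hs⟩ := hmem
  obtain ⟨x, hx, n, hr⟩ := mem_orb.1 hw
  have hxj := h.I_subset (le_max_right i j) le_top hx
  -- A positive-time itinerary under `f` is used so that the one under `R j` has a last step, whose
  -- source is the preimage sought.
  obtain ⟨k, hk, hk0⟩ := hind.reach_return hxj (hind.I_subset hyI) (reach_succ'.2 ⟨w, hr, hs⟩)
  obtain ⟨k, rfl⟩ : ∃ k', k = k' + 1 :=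
    ⟨k - 1, by by_contra hne; exact absurd (hk0 (by omega)) n.succ_ne_zero⟩
  obtain ⟨z, hz, hzs⟩ := reach_succ'.1 hk
  obtain ⟨n', -, -, hr'⟩ := hind.reach_of_reach hz
  exact ⟨z, hzs, h.orb_anti (le_max_left i j) le_top (mem_orb.2 ⟨x, hx, n', hr'⟩)⟩

lemma image_attractor_top : f.image (attractor f ⊤ R) = attractor f ⊤ R := by
  refine Subset.antisymm ?_ fun y hy => ?_
  · rintro y ⟨x, hx, hs⟩
    exact attractor_of_reach hx (reach_one.2 hs)
  · obtain ⟨x, hx, hs⟩ := h.exists_step_attractor 0 hy (h.zero ▸ h.attractor_subset_I hy)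
    exact ⟨x, hx, h.zero ▸ hs⟩

/-- The attractor is covered by finitely many images of its part in `(R j).I`. -/
lemma exists_reach_attractor (j : ℕ) {y : ℝ} (hy : y ∈ attractor f ⊤ R) :
    ∃ x ∈ attractor f ⊤ R ∩ (R j).I, ∃ n < max (l j) (r j), f.Reach n x y := by
  have hind := h.induced j le_top
  have hfin : {x | x ∈ (R j).I ∧ ∃ n < max (l j) (r j), f.Reach n x y}.Finite := by
    refine ((Finset.range (max (l j) (r j))).finite_toSet.biUnion fun n _ =>
      finite_reach f n y).subset fun x hx => ?_
    obtain ⟨-, n, hn, hr⟩ := hx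
    exact mem_biUnion (by simpa using hn) hr
  suffices hne : ∀ i, ({x | x ∈ (R j).I ∧ ∃ n < max (l j) (r j), f.Reach n x y} ∩
      f.orb (R i).I).Nonempty by
    obtain ⟨x, hx, hxB⟩ := exists_mem_forall_of_finite hfin h.antitone_orb hne
    exact ⟨x, ⟨mem_attractor.2 fun i _ => hxB i, hx.1⟩, hx.2⟩
  intro i
  obtain ⟨x, hx, n, hr⟩ := mem_orb.1 (mem_attractor.1 hy (max i j) le_top)
  obtain ⟨k, z, n', hr1, hr2, hn', -⟩ :=
    hind.decompose (h.I_subset (le_max_right i j) le_top hx) hr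
  obtain ⟨k', -, -, hk'⟩ := hind.reach_of_reach hr1
  exact ⟨z, ⟨hr1.mem (h.I_subset (le_max_right i j) le_top hx), n', hn', hr2⟩,
    h.orb_anti (le_max_left i j) le_top (mem_orb.2 ⟨x, hx, k', hk'⟩)⟩

/-- U contains an interval visited by one branch of `R i`, say the left one. Every step of `R (i +
1)` can be rerouted through a left application of `R i`, or through `f.b`, because `R i` sends the
right half of I_{i+1} to the left of `c`. That application crosses U, and the itinerary is started
there. -/
lemma exists_return {U : Set ℝ} {y : ℝ} (hy : y ∈ attractor f ⊤ R) (hU : U ∈ 𝓝 y) :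
    ∃ i N, ∀ w w', w ∈ attractor f ⊤ R → (R (i + 1)).Step w w' →
      ∃ z ∈ U ∩ attractor f ⊤ R, ∃ n ≤ N, f.Reach n z w' := by
  obtain ⟨i, hpiece⟩ := h.exists_piece_subset hy hU
  have hind := h.induced i le_top
  have hce := hind.c_eq
  have hl := hind.one_le_l
  have hr := hind.one_le_r
  obtain ⟨L, M, hs, -⟩ := h.minimal i le_top
  have hexp := h.expanding i le_top
  have hA : ∀ w s, w ∈ attractor f ⊤ R → (s = w ∨ (R i).Step w s) → s ∈ attractor f ⊤ R := by
    rintro w s hw (rfl | hs)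
    · exact hw
    · obtain ⟨k, -, -, hr⟩ := hind.reach_of_step hs
      exact attractor_of_reach hw hr
  -- The first term finishes the return under way in U; then at most L + M steps of `R i` lead to
  -- w'.
  refine ⟨i, max (l i) (r i) + (L + M) * max (l i) (r i), fun w w' hw hww' => ?_⟩
  have key : ∀ z y n m, z ∈ U ∩ attractor f ⊤ R → f.Reach m z y → m ≤ max (l i) (r i) →
      n ≤ L + M → (R i).Reach n y w' → ∃ z ∈ U ∩ attractor f ⊤ R,
        ∃ n ≤ max (l i) (r i) + (L + M) * max (l i) (r i), f.Reach n z w' := by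
    intro z y n m hz hzy hm hn hyw
    obtain ⟨k, -, hk, hr⟩ := hind.reach_of_reach hyw
    exact ⟨z, hz, m + k, Nat.add_le_add hm (hk.trans (Nat.mul_le_mul_right _ hn)), hzy.trans hr⟩
  rcases hpiece with ⟨k, hk, hsub⟩ | ⟨k, hk, hsub⟩
  · obtain ⟨y, n, hn, hr, ⟨s, hsI, hsw, rfl⟩ | rfl⟩ := hs.exists_reach_left hexp hww'
    · rw [hce] at hsI
      obtain ⟨ha, hgs⟩ := hind.left s hsI
      have ha' : f.Avoids (k + 1) s := ha.mono hk
      have hz : f.toFun^[k + 1] s ∈ U := hsub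
        ⟨(hind.branch_left hk).1.monotoneOn ⟨le_rfl, hind.a_lt_c⟩ hsI hsI.1,
          (hind.iterate_lt_left hk hsI).le⟩
      refine key _ _ n (l i - (k + 1)) ⟨hz, attractor_of_reach (hA w s hw hsw) ha'.reach⟩ ?_
        (by omega) hn hr
      rw [hgs]
      have hl' : l i = (k + 1) + (l i - (k + 1)) := by omega
      have := (avoids_add.1 (hl' ▸ ha)).2.reach
      rwa [← Function.iterate_add_apply, Nat.sub_add_cancel hk] at this
    · have hz : f.toFun^[k] f.b ∈ U :=
        hsub ⟨(hind.iterate_lt_left hk ⟨le_rfl, hind.a_lt_c⟩).le, le_rfl⟩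
      refine key _ _ n (l i - 1 - k) ⟨hz, attractor_of_reach h.c_mem_attractor
        (hind.reach_c_iterate_b hk)⟩ ?_ (by omega) hn hr
      have ha := hind.avoids_b (k := l i - 1) (by omega)
      have hl' : l i - 1 = k + (l i - 1 - k) := by omega
      rw [hl'] at ha
      have := (avoids_add.1 ha).2.reach
      rwa [← Function.iterate_add_apply, Nat.sub_add_cancel (by omega), hind.iterate_b] at this
  · obtain ⟨y, n, hn, hr, ⟨s, hsI, hsw, rfl⟩ | rfl⟩ := hs.exists_reach_right hexp hww'
    · rw [hce] at hsI
      obtain ⟨ha, hgs⟩ := hind.right s hsI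
      have ha' : f.Avoids (k + 1) s := ha.mono hk
      have hz : f.toFun^[k + 1] s ∈ U := hsub ⟨(hind.lt_iterate_right hk hsI).le,
        (hind.branch_right hk).1.monotoneOn hsI ⟨hind.c_lt_b, le_rfl⟩ hsI.2⟩
      refine key _ _ n (r i - (k + 1)) ⟨hz, attractor_of_reach (hA w s hw hsw) ha'.reach⟩ ?_
        (by omega) hn hr
      rw [hgs]
      have hl' : r i = (k + 1) + (r i - (k + 1)) := by omega
      have := (avoids_add.1 (hl' ▸ ha)).2.reach
      rwa [← Function.iterate_add_apply, Nat.sub_add_cancel hk] at this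
    · have hz : f.toFun^[k] f.a ∈ U :=
        hsub ⟨le_rfl, (hind.lt_iterate_right hk ⟨hind.c_lt_b, le_rfl⟩).le⟩
      refine key _ _ n (r i - 1 - k) ⟨hz, attractor_of_reach h.c_mem_attractor
        (hind.reach_c_iterate_a hk)⟩ ?_ (by omega) hn hr
      have ha := hind.avoids_a (k := r i - 1) (by omega)
      have hl' : r i - 1 = k + (r i - 1 - k) := by omega
      rw [hl'] at ha
      have := (avoids_add.1 ha).2.reach
      rwa [← Function.iterate_add_apply, Nat.sub_add_cancel (by omega), hind.iterate_a] at this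

/-- Each point of A is reached in bounded time from A ∩ I_{i+1}, whose points end steps of `R (i +
1)` from A, and these can be started in U. -/
lemma isLeoOn_attractor_top : f.IsLeoOn (attractor f ⊤ R) := by
  rintro U hU ⟨y, hyU, hy⟩
  obtain ⟨i, N, hN⟩ := h.exists_return hy (hU.mem_nhds hyU)
  refine ⟨N + max (l (i + 1)) (r (i + 1)), Subset.antisymm ?_ fun x hx => ?_⟩
  · refine iUnion₂_subset fun n _ x hx => ?_
    obtain ⟨z, hz, hr⟩ := mem_image_iterate.1 hx
    exact attractor_of_reach hz.2 hr
  · obtain ⟨w', hw', n, hn, hr⟩ := h.exists_reach_attractor (i + 1) hx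
    obtain ⟨w, hw, hs⟩ := h.exists_step_attractor (i + 1) hw'.1 hw'.2
    obtain ⟨z, hz, k, hk, hr'⟩ := hN w w' hw hs
    exact mem_iUnion₂.2 ⟨k + n, by omega, mem_image_iterate.2 ⟨z, hz, hr'.trans hr⟩⟩

lemma isCantorSet_attractor_top : IsCantorSet (attractor f ⊤ R) := by
  have hcl := h.isClosed_attractor
  refine ⟨⟨f.c, h.c_mem_attractor⟩, isCompact_Icc.of_isClosed_subset hcl h.attractor_subset_I,
    ⟨hcl, fun y hy => accPt_iff_nhds.2 fun U hU => ?_⟩,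
    isTotallyDisconnected_of_forall_not_Icc_subset fun s t => h.not_Icc_subset_attractor⟩
  obtain ⟨i, hpiece⟩ := h.exists_piece_subset hy hU
  have hind := h.induced i le_top
  have hind' := h.induced (i + 1) le_top
  have key : ∀ x x', x ∈ U ∩ attractor f ⊤ R → x' ∈ U ∩ attractor f ⊤ R → x < x' →
      ∃ z ∈ U ∩ attractor f ⊤ R, z ≠ y := by
    intro x x' hx hx' hlt
    by_cases hxy : x = y
    · exact ⟨x', hx', fun he => hlt.ne (hxy.trans he.symm)⟩
    · exact ⟨x, hx, hxy⟩
  rcases hpiece with ⟨k, hk, hsub⟩ | ⟨k, hk, hsub⟩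
  -- The end points of I_i and I_{i+1} belong to A and are distinct; the branch carries them to two
  -- distinct points of A in U, at least one of them different from y.
  · have hmem : ∀ j, i ≤ j → f.toFun^[k + 1] (R j).a ∈ U ∩ attractor f ⊤ R ∧
        (R j).a ∈ Ico (R i).a f.c := by
      intro j hij
      have hj := h.induced j le_top
      have hI : (R j).a ∈ Ico (R i).a f.c := ⟨(h.I_subset hij le_top (R j).a_mem).1, hj.a_lt_c⟩
      have hA := attractor_of_reach h.c_mem_attractor hj.reach_c_a
      exact ⟨⟨hsub ⟨(hind.branch_left hk).1.monotoneOn ⟨le_rfl, hind.a_lt_c⟩ hI hI.1,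
        (hind.iterate_lt_left hk hI).le⟩, attractor_of_reach hA
          ((hind.left _ hI).1.mono hk).reach⟩, hI⟩
    obtain ⟨h1, h1'⟩ := hmem i le_rfl
    obtain ⟨h2, h2'⟩ := hmem (i + 1) (by omega)
    exact key _ _ h1 h2 ((hind.branch_left hk).1 h1' h2' (h.a_lt_succ le_top))
  · have hmem : ∀ j, i ≤ j → f.toFun^[k + 1] (R j).b ∈ U ∩ attractor f ⊤ R ∧
        (R j).b ∈ Ioc f.c (R i).b := by
      intro j hij
      have hj := h.induced j le_top
      have hI : (R j).b ∈ Ioc f.c (R i).b := ⟨hj.c_lt_b, (h.I_subset hij le_top (R j).b_mem).2⟩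
      have hA := attractor_of_reach h.c_mem_attractor hj.reach_c_b
      exact ⟨⟨hsub ⟨(hind.lt_iterate_right hk hI).le,
        (hind.branch_right hk).1.monotoneOn hI ⟨hind.c_lt_b, le_rfl⟩ hI.2⟩,
        attractor_of_reach hA ((hind.right _ hI).1.mono hk).reach⟩, hI⟩
    obtain ⟨h1, h1'⟩ := hmem i le_rfl
    obtain ⟨h2, h2'⟩ := hmem (i + 1) (by omega)
    exact key _ _ h2 h1 ((hind.branch_right hk).1 h2' h1' (h.succ_lt_b le_top))

/-- Some itinerary of x keeps visiting I_{i+1}. From a late visit w the suitable side of `c` is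
reached, by choice of branch if w = `c` and otherwise at w or its image under `R i`, and from there
the orbit crosses U. -/
lemma omegaLimit_eq_top {x : ℝ} (hx : x ∈ f.I)
    (hn : ∀ i : ℕ, 1 ≤ i → x ∉ f.avoiding (p i) (q i)) :
    f.omegaLimit x = attractor f ⊤ R := by
  refine Subset.antisymm (h.omegaLimit_subset hx fun i h1 _ => hn i h1) fun y hy => ?_
  refine mem_iInter.2 fun N => mem_closure_iff_nhds.2 fun U hU => ?_
  obtain ⟨i, hpiece⟩ := h.exists_piece_subset hy hU
  have hind := h.induced i le_top
  have hind' := h.induced (i + 1) le_top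
  have hexp' := h.expanding (i + 1) le_top
  obtain ⟨L, M, hs, -⟩ := h.minimal i le_top
  obtain ⟨t, ha, hmem⟩ := (h.strict (i + 1) (by omega) le_top).exists_iterate_mem_of_notMem
    h.isExpanding hx (hn (i + 1) (by omega))
  have hstay : ∀ n, ∃ w ∈ (R (i + 1)).I, (R (i + 1)).Reach n (f.toFun^[t] x) w := by
    intro n
    induction n with
    | zero => exact ⟨_, Ioo_subset_Icc_self hmem, rfl⟩
    | succ n ih =>
      obtain ⟨w, hw, hr⟩ := ih
      by_cases hc : w = (R (i + 1)).c
      · exact ⟨_, (R (i + 1)).a_mem, reach_succ'.2 ⟨w, hr, hc ▸ (R (i + 1)).step_c_a⟩⟩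
      · exact ⟨_, (R (i + 1)).mapsTo w hw hc, reach_succ'.2 ⟨w, hr, step_of_ne hw hc⟩⟩
  obtain ⟨w, hw, hr⟩ := hstay N
  obtain ⟨k, hk, -, hr⟩ := hind'.reach_of_reach hr
  have hxw : f.Reach (t + k) x w := ha.reach.trans hr
  have key : ∀ z n, z ∈ U → f.Reach n w z → (U ∩ ⋃ k, ⋃ _ : N ≤ k, f.image^[k] {x}).Nonempty :=
    fun z n hz hwz => ⟨z, hz, mem_iUnion₂.2 ⟨t + k + n, by omega,
      mem_image_iterate.2 ⟨x, rfl, hxw.trans hwz⟩⟩⟩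
  have hstep : ∀ s, s = w ∨ (R i).Step w s → ∃ n, f.Reach n w s := by
    rintro s (rfl | hs)
    · exact ⟨0, rfl⟩
    · obtain ⟨n, -, -, hr⟩ := hind.reach_of_step hs
      exact ⟨n, hr⟩
  rcases hpiece with ⟨k, hk, hsub⟩ | ⟨k, hk, hsub⟩
  · by_cases hwc : w = f.c
    · exact key _ (k + 1) (hsub ⟨(hind.iterate_lt_left hk ⟨le_rfl, hind.a_lt_c⟩).le, le_rfl⟩)
        (hwc ▸ hind.reach_c_iterate_b hk)
    · obtain ⟨s, hsI, hsw⟩ := hs.exists_left hw (hind.c_eq ▸ hwc)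
      rw [hind.c_eq] at hsI
      obtain ⟨n, hn⟩ := hstep s hsw
      exact key _ _ (hsub ⟨(hind.branch_left hk).1.monotoneOn ⟨le_rfl, hind.a_lt_c⟩ hsI hsI.1,
        (hind.iterate_lt_left hk hsI).le⟩) (hn.trans ((hind.left s hsI).1.mono hk).reach)
  · by_cases hwc : w = f.c
    · exact key _ (k + 1) (hsub ⟨le_rfl, (hind.lt_iterate_right hk ⟨hind.c_lt_b, le_rfl⟩).le⟩)
        (hwc ▸ hind.reach_c_iterate_a hk)
    · obtain ⟨s, hsI, hsw⟩ := hs.exists_right hw (hind.c_eq ▸ hwc)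
      rw [hind.c_eq] at hsI
      obtain ⟨n, hn⟩ := hstep s hsw
      exact key _ _ (hsub ⟨(hind.lt_iterate_right hk hsI).le,
        (hind.branch_right hk).1.monotoneOn hsI ⟨hind.c_lt_b, le_rfl⟩ hsI.2⟩)
        (hn.trans ((hind.right s hsI).1.mono hk).reach)

end Infinite

variable {m : ℕ∞}

lemma image_attractor (h : f.IsTower m R l r p q) :
    f.image (attractor f m R) = attractor f m R := by
  rcases eq_or_ne m ⊤ with rfl | hm
  · exact h.image_attractor_top
  · obtain ⟨n, rfl⟩ := ENat.ne_top_iff_exists.1 hm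
    rw [attractor_coe n h]
    exact h.image_orb le_rfl

lemma isLeoOn_attractor (h : f.IsTower m R l r p q) : f.IsLeoOn (attractor f m R) := by
  rcases eq_or_ne m ⊤ with rfl | hm
  · exact h.isLeoOn_attractor_top
  · obtain ⟨n, rfl⟩ := ENat.ne_top_iff_exists.1 hm
    exact isLeoOn_attractor_coe n h

end IsTower

end LorenzMap

/-! ### The decomposition of the nonwandering set -/

theorem propositionD (f : LorenzMap) (hf : f.IsExpanding) (hnd : f.NoFixedEndpoint)
    (m : ℕ∞) (R : ℕ → LorenzMap) (hR : f.IsRenormalizationSequence m R) :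
    ∃ E D Ω : ℕ → Set ℝ, ∃ A : Set ℝ,
      -- the `E i`, `1 ≤ i ≤ m`, and `I` are all the `α`-limit sets, in increasing order
      (E 0 = ∅ ∧
        (∀ i j : ℕ, i < j → (j : ℕ∞) ≤ m → E i ⊂ E j) ∧
        (∀ i : ℕ, (i : ℕ∞) ≤ m → E i ⊂ f.I) ∧
        {S : Set ℝ | ∃ x ∈ f.I, S = f.alphaLimit x} =
          {S : Set ℝ | S = f.I ∨ ∃ i : ℕ, 1 ≤ i ∧ (i : ℕ∞) ≤ m ∧ S = E i}) ∧
      -- `D i` is the minimal completely invariant closed set of the `i`-th renormalization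
      (∀ i : ℕ, (i : ℕ∞) ≤ m → (R i).IsMinimalInvariant (D i)) ∧
      -- the decomposition of the nonwandering set
      f.nonwandering = (⋃ i : ℕ, ⋃ _ : 1 ≤ i ∧ (i : ℕ∞) ≤ m, Ω i) ∪ A ∧
      (∀ i j : ℕ, 1 ≤ i → i < j → (j : ℕ∞) ≤ m → Disjoint (Ω i) (Ω j)) ∧
      (∀ i : ℕ, 1 ≤ i → (i : ℕ∞) ≤ m → Disjoint (Ω i) A) ∧
      -- the pieces `Ω i`
      (∀ i : ℕ, 1 ≤ i → (i : ℕ∞) ≤ m →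
        Ω i = E i ∩ f.orb (R (i - 1)).I ∧
        Ω i = f.orb (D (i - 1)) ∧
        IsClosed (Ω i) ∧ f.image (Ω i) = Ω i ∧
        f.IsLeoOn (Ω i) ∧
        (f.IsPeriodicRenormalization (R i) → f.IsPeriodicOrbit (Ω i)) ∧
        (¬ f.IsPeriodicRenormalization (R i) → IsCantorSet (Ω i))) ∧
      -- the attractor `A`
      A = (⋂ i : ℕ, ⋂ _ : (i : ℕ∞) ≤ m, f.orb (R i).I) ∧
      IsClosed A ∧ f.image A = A ∧
      (∀ x ∈ f.I, (∀ i : ℕ, (i : ℕ∞) ≤ m → x ∉ E i) → f.omegaLimit x ⊆ A) ∧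
      f.IsLeoOn A ∧
      (m = 0 → A = f.I) ∧
      (0 < m → m < ⊤ → IsFiniteUnionOfIntervals A) ∧
      (m = ⊤ → IsCantorSet A ∧
        ∀ x ∈ f.I, (∀ i : ℕ, (i : ℕ∞) ≤ m → x ∉ E i) → f.omegaLimit x = A) := by
  classical
  obtain ⟨l, r, p, q, h⟩ := hR.exists_isTower hf hnd
  have hE : ∀ i : ℕ, 1 ≤ i →
      (if i = 0 then ∅ else f.avoiding (p i) (q i)) = f.avoiding (p i) (q i) :=
    fun i h1 => if_neg (by omega)
  have hnotMem : ∀ x, (∀ i : ℕ, (i : ℕ∞) ≤ m → x ∉ if i = 0 then ∅ else f.avoiding (p i) (q i)) →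
      ∀ i : ℕ, 1 ≤ i → (i : ℕ∞) ≤ m → x ∉ f.avoiding (p i) (q i) :=
    fun x hx i h1 hi => hE i h1 ▸ hx i hi
  have hpiece : ∀ i : ℕ, 1 ≤ i → (i : ℕ∞) ≤ m →
      (if i = 0 then ∅ else f.avoiding (p i) (q i)) ∩ f.orb (R (i - 1)).I ⊆ f.nonwandering := by
    intro i h1 hi
    obtain ⟨i, rfl⟩ := Nat.exists_eq_add_of_le' h1
    rw [hE _ h1]
    exact LorenzMap.subset_nonwandering_of_isLeoOn (inter_subset_left.trans fun x hx => hx.1)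
      (h.image_piece hi) (h.isLeoOn_piece hi)
  -- Index 0 of E is a separate convention. At the last level i = m the map is prime, and its least
  -- invariant set is the whole interval.
  refine ⟨fun i => if i = 0 then ∅ else f.avoiding (p i) (q i),
    fun i => if ((i + 1 : ℕ) : ℕ∞) ≤ m then (R i).avoiding (p (i + 1)) (q (i + 1)) else (R i).I,
    fun i => (if i = 0 then ∅ else f.avoiding (p i) (q i)) ∩ f.orb (R (i - 1)).I,
    LorenzMap.IsTower.attractor f m R, ⟨rfl, ?_, ?_, ?_⟩, ?_, ?_, ?_, ?_, ?_, rfl,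
    h.isClosed_attractor, h.image_attractor,
    fun x hx hn => h.omegaLimit_subset hx (hnotMem x hn), h.isLeoOn_attractor, ?_, ?_, ?_⟩
  · intro i j hij hj
    dsimp only
    rw [hE j (by omega)]
    rcases Nat.eq_zero_or_pos i with rfl | h1
    · exact empty_ssubset.2 ⟨_, (h.strict j (by omega) hj).p_mem_avoiding⟩
    · rw [hE i h1]
      exact h.avoiding_ssubset h1 hij hj
  · intro i hi
    dsimp only
    rcases Nat.eq_zero_or_pos i with rfl | h1
    · exact empty_ssubset.2 ⟨_, f.c_mem⟩
    · rw [hE i h1]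
      exact ⟨fun x hx => hx.1, fun hsub => (h.strict i h1 hi).c_notMem (hsub f.c_mem)⟩
  · rw [h.setOf_alphaLimit]
    ext S
    refine or_congr_right (exists_congr fun i => and_congr_right fun h1 => ?_)
    dsimp only
    rw [hE i h1]
  · intro i hi
    dsimp only
    split_ifs with hi'
    · exact h.isMinimalInvariant_avoiding hi'
    · exact LorenzMap.isMinimalInvariant_I (h.expanding i hi)
        (h.last i (hi.eq_of_not_lt fun hlt => hi' (LorenzMap.coe_lt_iff.1 hlt)))
  · refine Subset.antisymm (fun x hx => ?_) (union_subset ?_ ?_)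
    · by_cases hA : x ∈ LorenzMap.IsTower.attractor f m R
      · exact Or.inr hA
      · obtain ⟨i, hi, hmem⟩ := h.nonwandering_subset hx hA
        exact Or.inl (mem_iUnion₂.2 ⟨i + 1, ⟨by omega, hi⟩, by simpa using hmem⟩)
    · exact iUnion₂_subset fun i hi => hpiece i hi.1 hi.2
    · exact LorenzMap.subset_nonwandering_of_isLeoOn h.attractor_subset_I h.image_attractor
        h.isLeoOn_attractor
  · intro i j h1 hij hj
    dsimp only
    rw [hE i h1]
    exact (h.disjoint_avoiding_orb h1 (LorenzMap.coe_le_of_le hij.le hj)).mono inter_subset_left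
      (inter_subset_right.trans (h.orb_anti (Nat.le_sub_one_of_lt hij)
        (LorenzMap.coe_le_of_le (j.sub_le 1) hj)))
  · intro i h1 hi
    dsimp only
    rw [hE i h1]
    exact (h.disjoint_avoiding_orb h1 hi).mono inter_subset_left
      fun x hx => LorenzMap.IsTower.mem_attractor.1 hx i hi
  · intro i h1 hi
    obtain ⟨i, rfl⟩ := Nat.exists_eq_add_of_le' h1
    dsimp only
    rw [hE _ h1, Nat.add_sub_cancel, if_pos hi]
    exact ⟨rfl, (h.orb_avoiding hi).symm, h.isClosed_piece hi, h.image_piece hi,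
      h.isLeoOn_piece hi, h.isPeriodicOrbit_piece hi, h.isCantorSet_piece hi⟩
  · rintro rfl
    exact (LorenzMap.IsTower.attractor_coe 0 h).trans h.orb_zero
  · intro _ hm
    obtain ⟨n, rfl⟩ := ENat.ne_top_iff_exists.1 hm.ne
    rw [LorenzMap.IsTower.attractor_coe n h]
    exact (h.induced n le_rfl).isFiniteUnionOfIntervals_orb (h.expanding n le_rfl)
  · rintro rfl
    exact ⟨h.isCantorSet_attractor_top, fun x hx hn =>
      h.omegaLimit_eq_top hx fun i h1 => hnotMem x hn i h1 le_top⟩
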